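/- **Setting.** Let $G=(V,E,c,r)$ be a weakly connected finite directed graph ($E\subseteq V\times V$) with $n=|V|$ vertices, $m=|E|$ edges, costs $c:E\to\mathbb R_{\ge 0}$ and resource consumptions $r:E\to\mathbb R_{\ge 0}$. An instance of the restricted shortest path problem (RSP) consists of $G$, vertices $s\neq t$ and a bound $R\ge 0$. A solution is a path $p$ from $s$ to $t$ with $\sum_{e\in p}r(e)\le R$; $C_{\mathrm{opt}}$ is the least cost $\sum_{e\in p}c(e)$ of a solution. For $\varepsilon>0$, a $(1+\varepsilon)$-approximation is a solution of cost at most $(1+\varepsilon)C_{\mathrm{opt}}$. An algorithm for RSP receives the instance and $\varepsilon$; it has to output a $(1+\varepsilon)$-approximation if there is a solution, and to report that there is none otherwise. Algorithms are finite programs for a random access machine with natural-number and real-number memory cells on which every arithmetic operation (including rounding down), comparison and memory access takes one step. In all time bounds $\varepsilon$ is assumed to be at most some constant $\varepsilon_0$; the algorithms do not depend on $\varepsilon_0$, the constant hidden in $O(\cdot)$ may. For integer costs $c':E\to\mathbb N_0$, a start vertex $s$, $v\in V$ and $i\in\mathbb N_0$, let $r_{v,i}$ be the least resource consumption of a path from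 $s$ to $v$ of $c'$-cost at most $i$ ($\infty$ if there is none). The $i$-th row of the table is $(r_{v,i})_{v\in V}$. Let $\mathcal G$ be a class of graphs and let $f$ assign to each $G$ a number $f_G(n,m)$. We say that rows can be computed in time $f$ on $\mathcal G$ if there is a program that, for every $G\in\mathcal G$, every $c':E\to\mathbb N_0$, every $s$ and every $i$, extends the table consisting of the rows $0,\dots,i-1$ by row $i$ in at most $f_G(n,m)$ steps. **Statement.** 1. If rows can be computed in time $f$ on $\mathcal G$, then a $(1+\varepsilon)$-approximation for RSP on graphs in $\mathcal G$ can be found in time $$O\!\left(nm\left(\frac1\varepsilon+\frac{f_G(n,m)}{m}\right)\right),$$ with a constant that does not depend on $\mathcal G$, $f$ and the row program. 2. There is an algorithm that finds a $(1+\varepsilon)$-approximation for RSP on all graphs in time $O\!\left(nm\left(\frac1\varepsilon+\frac{n\log n}{m}\right)\right)$; for every $a>0$ it takes time $O(nm/\varepsilon)$ on the graphs with $m\ge a\,n\log n$, where the constant may depend on $a$. 3. There is an algorithm that finds a $(1+\varepsilon)$-approximation for RSP on acyclic graphs in time $O(nm/\varepsilon)$. -/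

import Mathlib

namespace RSP

/-! ## Weighted directed graphs and the restricted shortest path problem -/

/-- A finite directed graph with vertices `Fin n` and edges `Fin m` (a set of ordered pairs of
vertices, hence no parallel edges), with non-negative real edge costs `c` and resource
consumptions `r`. -/
structure WGraph where
  n : ℕ
  m : ℕ
  src : Fin m → Fin n
  tgt : Fin m → Fin n
  simple : Function.Injective (fun e => (src e, tgt e))
  c : Fin m → ℝ
  r : Fin m → ℝ
  c_nonneg : ∀ e, 0 ≤ c e
  r_nonneg : ∀ e, 0 ≤ r e

namespace WGraph

variable (G : WGraph)

/-- The edge list `p` is a walk from `u` to `v`. -/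
def IsWalk (u : Fin G.n) : List (Fin G.m) → Fin G.n → Prop
  | [], v => u = v
  | e :: p, v => G.src e = u ∧ IsWalk (G.tgt e) p v

/-- The edge list `p` is a path (a walk without repeated vertices) from `u` to `v`. -/
def IsPath (u : Fin G.n) (p : List (Fin G.m)) (v : Fin G.n) : Prop :=
  G.IsWalk u p v ∧ (u :: p.map G.tgt).Nodup

/-- The cost of a path. -/
def cost (p : List (Fin G.m)) : ℝ := (p.map G.c).sum

/-- The resource consumption of a path. -/
def res (p : List (Fin G.m)) : ℝ := (p.map G.r).sum

/-- The underlying undirected graph is connected. -/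
def WeaklyConnected : Prop :=
  (SimpleGraph.fromRel (fun u v : Fin G.n => ∃ e, G.src e = u ∧ G.tgt e = v)).Connected

/-- There is no directed cycle. -/
def Acyclic : Prop := ∀ (u : Fin G.n) (p : List (Fin G.m)), G.IsWalk u p u → p = []

end WGraph

/-- An instance of the restricted shortest path problem. -/
structure Instance where
  G : WGraph
  conn : G.WeaklyConnected
  s : Fin G.n
  t : Fin G.n
  s_ne_t : s ≠ t
  R : ℝ
  R_nonneg : 0 ≤ R

namespace Instance

variable (I : Instance)

/-- A solution is a path from `s` to `t` that respects the resource bound. -/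
def IsSolution (p : List (Fin I.G.m)) : Prop := I.G.IsPath I.s p I.t ∧ I.G.res p ≤ I.R

/-- The least cost of a solution (meaningful only if there is a solution; the set of solutions is
finite, so that the infimum is then a minimum). -/
noncomputable def Copt : ℝ := sInf {x | ∃ p, I.IsSolution p ∧ I.G.cost p = x}

/-- A correct answer: `some p` with a `(1 + ε)`-approximation `p`, or `none` if there is no
solution at all. -/
def IsAnswer (ε : ℝ) : Option (List (Fin I.G.m)) → Prop
  | some p => I.IsSolution p ∧ I.G.cost p ≤ (1 + ε) * I.Copt
  | none => ¬ ∃ p, I.IsSolution p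

end Instance

/-! ## The machine model: a random access machine with unit-cost arithmetic

Programs are finite pieces of syntax of a structured language.  The memory consists of variables
and arrays (indexed by natural numbers) of natural numbers and of real numbers.  The only
constants in a program are natural numbers. -/

/-- The memory: natural variables, natural arrays, real variables, real arrays. -/
structure State where
  nv : ℕ → ℕ
  na : ℕ → ℕ → ℕ
  rv : ℕ → ℝ
  ra : ℕ → ℕ → ℝ

/-- Natural number expressions (with truncated subtraction and rounded-down division). -/
inductive NExp where
  | const (k : ℕ)
  | var (x : ℕ)
  | get (a : ℕ) (i : NExp)
  | add (e₁ e₂ : NExp)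
  | sub (e₁ e₂ : NExp)
  | mul (e₁ e₂ : NExp)
  | div (e₁ e₂ : NExp)

/-- Real number expressions. -/
inductive RExp where
  | ofNat (e : NExp)
  | var (x : ℕ)
  | get (a : ℕ) (i : NExp)
  | add (e₁ e₂ : RExp)
  | sub (e₁ e₂ : RExp)
  | mul (e₁ e₂ : RExp)
  | div (e₁ e₂ : RExp)

/-- Tests. -/
inductive BExp where
  | natLe (e₁ e₂ : NExp)
  | realLe (e₁ e₂ : RExp)
  | not (b : BExp)
  | and (b₁ b₂ : BExp)

/-- The value of an expression. -/
def NExp.eval (σ : State) : NExp → ℕ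
  | const k => k
  | var x => σ.nv x
  | get a i => σ.na a (i.eval σ)
  | add e₁ e₂ => e₁.eval σ + e₂.eval σ
  | sub e₁ e₂ => e₁.eval σ - e₂.eval σ
  | mul e₁ e₂ => e₁.eval σ * e₂.eval σ
  | div e₁ e₂ => e₁.eval σ / e₂.eval σ

/-- The number of steps needed to evaluate an expression: one for every node of its syntax tree. -/
def NExp.size : NExp → ℕ
  | const _ => 1
  | var _ => 1
  | get _ i => i.size + 1
  | add e₁ e₂ => e₁.size + e₂.size + 1
  | sub e₁ e₂ => e₁.size + e₂.size + 1
  | mul e₁ e₂ => e₁.size + e₂.size + 1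
  | div e₁ e₂ => e₁.size + e₂.size + 1

/-- The value of an expression. -/
noncomputable def RExp.eval (σ : State) : RExp → ℝ
  | ofNat e => (e.eval σ : ℝ)
  | var x => σ.rv x
  | get a i => σ.ra a (i.eval σ)
  | add e₁ e₂ => e₁.eval σ + e₂.eval σ
  | sub e₁ e₂ => e₁.eval σ - e₂.eval σ
  | mul e₁ e₂ => e₁.eval σ * e₂.eval σ
  | div e₁ e₂ => e₁.eval σ / e₂.eval σ

/-- The number of steps needed to evaluate an expression. -/
def RExp.size : RExp → ℕ
  | ofNat e => e.size + 1
  | var _ => 1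
  | get _ i => i.size + 1
  | add e₁ e₂ => e₁.size + e₂.size + 1
  | sub e₁ e₂ => e₁.size + e₂.size + 1
  | mul e₁ e₂ => e₁.size + e₂.size + 1
  | div e₁ e₂ => e₁.size + e₂.size + 1

/-- The truth value of a test. -/
def BExp.eval (σ : State) : BExp → Prop
  | natLe e₁ e₂ => e₁.eval σ ≤ e₂.eval σ
  | realLe e₁ e₂ => e₁.eval σ ≤ e₂.eval σ
  | not b => ¬ b.eval σ
  | and b₁ b₂ => b₁.eval σ ∧ b₂.eval σ

/-- The number of steps needed to evaluate a test. -/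
def BExp.size : BExp → ℕ
  | natLe e₁ e₂ => e₁.size + e₂.size + 1
  | realLe e₁ e₂ => e₁.size + e₂.size + 1
  | not b => b.size + 1
  | and b₁ b₂ => b₁.size + b₂.size + 1

/-- Programs. -/
inductive Prog where
  | skip
  | setNat (x : ℕ) (e : NExp)
  | putNat (a : ℕ) (i e : NExp)
  | setReal (x : ℕ) (e : RExp)
  | putReal (a : ℕ) (i : NExp) (e : RExp)
  | setFloor (x : ℕ) (e : RExp)
  | seq (P Q : Prog)
  | cond (b : BExp) (P Q : Prog)
  | loop (b : BExp) (P : Prog)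

/-- `Exec P σ T τ`: started in memory `σ`, the program `P` halts after exactly `T` steps with
memory `τ`.  Every assignment, arithmetic operation, rounding, comparison and memory access takes
one step. -/
inductive Exec : Prog → State → ℕ → State → Prop where
  | skip (σ : State) : Exec Prog.skip σ 1 σ
  | setNat (σ : State) (x : ℕ) (e : NExp) :
      Exec (Prog.setNat x e) σ (e.size + 1) { σ with nv := Function.update σ.nv x (e.eval σ) }
  | putNat (σ : State) (a : ℕ) (i e : NExp) :
      Exec (Prog.putNat a i e) σ (i.size + e.size + 1)
        { σ with na := Function.update σ.na a (Function.update (σ.na a) (i.eval σ) (e.eval σ)) }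
  | setReal (σ : State) (x : ℕ) (e : RExp) :
      Exec (Prog.setReal x e) σ (e.size + 1) { σ with rv := Function.update σ.rv x (e.eval σ) }
  | putReal (σ : State) (a : ℕ) (i : NExp) (e : RExp) :
      Exec (Prog.putReal a i e) σ (i.size + e.size + 1)
        { σ with ra := Function.update σ.ra a (Function.update (σ.ra a) (i.eval σ) (e.eval σ)) }
  | setFloor (σ : State) (x : ℕ) (e : RExp) :
      Exec (Prog.setFloor x e) σ (e.size + 1)
        { σ with nv := Function.update σ.nv x ⌊e.eval σ⌋₊ }
  | seq {P Q : Prog} {σ₀ σ₁ σ₂ : State} {T₁ T₂ : ℕ} :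
      Exec P σ₀ T₁ σ₁ → Exec Q σ₁ T₂ σ₂ → Exec (Prog.seq P Q) σ₀ (T₁ + T₂) σ₂
  | condTrue {b : BExp} {P Q : Prog} {σ₀ σ₁ : State} {T : ℕ} :
      b.eval σ₀ → Exec P σ₀ T σ₁ → Exec (Prog.cond b P Q) σ₀ (b.size + T) σ₁
  | condFalse {b : BExp} {P Q : Prog} {σ₀ σ₁ : State} {T : ℕ} :
      ¬ b.eval σ₀ → Exec Q σ₀ T σ₁ → Exec (Prog.cond b P Q) σ₀ (b.size + T) σ₁
  | loopTrue {b : BExp} {P : Prog} {σ₀ σ₁ σ₂ : State} {T₁ T₂ : ℕ} :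
      b.eval σ₀ → Exec P σ₀ T₁ σ₁ → Exec (Prog.loop b P) σ₁ T₂ σ₂ →
        Exec (Prog.loop b P) σ₀ (b.size + T₁ + T₂) σ₂
  | loopFalse {b : BExp} {P : Prog} {σ : State} :
      ¬ b.eval σ → Exec (Prog.loop b P) σ b.size σ

/-! ## Input and output conventions

Nothing is assumed about the memory cells that are not mentioned. -/

/-- The memory holds the restricted shortest path instance `I` (as a list of edges, in any order)
and the accuracy `ε`. -/
structure HoldsInput (I : Instance) (ε : ℝ) (σ : State) : Prop where
  n : σ.nv 0 = I.G.n
  m : σ.nv 1 = I.G.m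
  s : σ.nv 2 = I.s
  t : σ.nv 3 = I.t
  src : ∀ e : Fin I.G.m, σ.na 0 e = I.G.src e
  tgt : ∀ e : Fin I.G.m, σ.na 1 e = I.G.tgt e
  R : σ.rv 0 = I.R
  eps : σ.rv 1 = ε
  c : ∀ e : Fin I.G.m, σ.ra 0 e = I.G.c e
  r : ∀ e : Fin I.G.m, σ.ra 1 e = I.G.r e

/-- The memory holds the output: no path, or the list of the edges of a path. -/
def HoldsOutput {m : ℕ} (σ : State) : Option (List (Fin m)) → Prop
  | none => σ.nv 0 = 0
  | some p => σ.nv 0 = 1 ∧ σ.nv 1 = p.length ∧ ∀ j : Fin p.length, σ.na 0 j = p.get j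

/-- On every instance whose graph is in the class `𝒢`, and for every `ε > 0`, the program `A` halts
with a `(1 + ε)`-approximation (or the message that there is no solution) after at most
`K ε₀ * τ G ε` steps, for every bound `ε₀ ≥ ε`.  (As usual `ε` is regarded as bounded by a
constant `ε₀`, on which the factor hidden in the `O`-notation may depend; `A` does not depend on
`ε₀`.) -/
def ApproximatesIn (A : Prog) (𝒢 : Set WGraph) (K : ℝ → ℝ) (τ : WGraph → ℝ → ℝ) : Prop :=
  ∀ I : Instance, I.G ∈ 𝒢 → ∀ ε ε₀ : ℝ, 0 < ε → ε ≤ ε₀ → ∀ σ : State, HoldsInput I ε σ →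
    ∃ (T : ℕ) (σ' : State) (o : Option (List (Fin I.G.m))),
      Exec A σ T σ' ∧ HoldsOutput σ' o ∧ I.IsAnswer ε o ∧ (T : ℝ) ≤ K ε₀ * τ I.G ε

/-! ## Rows of the dynamic programming table -/

/-- `x` encodes the table entry `r_{v,i}` for the integer costs `c`: the least resource
consumption of a path from `s` to `v` of cost at most `i`, or `-1` (standing for `∞`) if there is
no such path. -/
def IsEntry (G : WGraph) (c : Fin G.m → ℕ) (s v : Fin G.n) (i : ℕ) (x : ℝ) : Prop :=
  IsLeast {y | ∃ p, G.IsPath s p v ∧ (p.map c).sum ≤ i ∧ G.res p = y} x ∨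
    ((¬ ∃ p, G.IsPath s p v ∧ (p.map c).sum ≤ i) ∧ x = -1)

/-- The memory holds the graph `G` with the integer costs `c` in place of its own costs, the start
vertex `s`, and the rows `0, …, k - 1` of the table. -/
structure HoldsRows (G : WGraph) (c : Fin G.m → ℕ) (s : Fin G.n) (k : ℕ) (σ : State) :
    Prop where
  n : σ.nv 0 = G.n
  m : σ.nv 1 = G.m
  start : σ.nv 2 = s
  src : ∀ e : Fin G.m, σ.na 0 e = G.src e
  tgt : ∀ e : Fin G.m, σ.na 1 e = G.tgt e
  costs : ∀ e : Fin G.m, σ.na 2 e = c e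
  r : ∀ e : Fin G.m, σ.ra 1 e = G.r e
  rows : ∀ i < k, ∀ v : Fin G.n, IsEntry G c s v i (σ.ra 2 (i * G.n + v))

/-- For every graph `G` in the class `𝒢` and all integer costs on its edges, the program `P`
computes any row of the table from the previous rows in at most `f G` steps. -/
def ComputesRow (P : Prog) (𝒢 : Set WGraph) (f : WGraph → ℝ) : Prop :=
  ∀ G ∈ 𝒢, ∀ (c : Fin G.m → ℕ) (s : Fin G.n) (k : ℕ) (σ : State),
    HoldsRows G c s k σ → σ.nv 3 = k →
      ∃ (T : ℕ) (σ' : State), Exec P σ T σ' ∧ HoldsRows G c s (k + 1) σ' ∧ (T : ℝ) ≤ f G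

end RSP

/-!
The approximation algorithm combines rounding of the costs with the dynamic program over the table
of least resource consumptions: if the costs are replaced by `⌊c / δ⌋`, the row of index `i` tells
whether there is a solution of scaled cost at most `i`.

**Bounds for the optimum.**  A test with a single row decides whether there is a solution all edges
of which cost less than `x` (`Instance.feasibleBelow_iff`).  A threshold `x` at which the answer
changes determines the optimum up to the factor `n` (`Instance.bounds_of_threshold`).  There are up
to `n²` candidates for `x`, and a binary search would presuppose that they are sorted; instead, the
search `threshold` takes `O(n)` rounds, each consisting of one row and of a scan of the edges in time
`O(m)`.  The pivot of a round is chosen such that about the square root of the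
number of candidates is discarded (`ScanInv.between_le`), so that `3 n` rounds suffice.  Then `narrow`
improves the ratio of the bounds from `n / g` to `n / (2 g)` by a test with `O(g)` rows, for
`g = 1, 2, 4, …`, until the ratio is at most `8` (`Instance.refine_of_test`,
`Instance.refine_of_not_test`).  These tests compute `O(n)` rows altogether.

**The solution.**  With the lower bound `L` for the optimum and the unit `ε L / n`, the optimum has
scaled cost `O(n / ε)`, and a solution of least scaled cost is a `(1 + ε)`-approximation
(`Instance.approx_of_scaled`).  Adding `1` to every scaled cost does not change this and makes the
scaled costs positive, so that this time rows can be computed in time `O(m + n)` without any row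
program, by relaxing every edge once.  Together this takes time `O(n m / ε + n f)`.  If the optimum is
`0`, the same step with a sufficiently small unit finds a solution of cost `0`
(`Instance.cost_eq_zero_of_scaled`).

**Row programs.**  The entries of a row arise by relaxing the edges of positive cost from previous
rows and closing the labels under the edges of cost `0` (`isEntry_of_closed`, `rowProg_spec`).  In
acyclic graphs the vertices are scanned in a topological order in time `O(m + n)`
(`dagClose_closes`).  In general the labels are closed by Dijkstra's algorithm with a Fibonacci heap,
in time `O(m + n log n)` (`dijClose_closes`); the degrees in the heap are logarithmic by
`HeapInv.two_pow_le`, and the potential `pot` pays for cascading cuts and for the consolidation.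

Programs are reasoned about in a program logic in which the running time is a resource: the weakest
precondition `WP` keeps track of the remaining fuel, which makes amortized bounds ordinary
invariants.
-/

namespace RSP

/-! ### Program logic -/

/-- The memory after an assignment to a natural variable. -/
def State.setN (σ : State) (x v : ℕ) : State := { σ with nv := Function.update σ.nv x v }

/-- The memory after an assignment to a cell of a natural array. -/
def State.putN (σ : State) (a i v : ℕ) : State :=
  { σ with na := Function.update σ.na a (Function.update (σ.na a) i v) }

/-- The memory after an assignment to a real variable. -/
def State.setR (σ : State) (x : ℕ) (v : ℝ) : State := { σ with rv := Function.update σ.rv x v }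

/-- The memory after an assignment to a cell of a real array. -/
def State.putR (σ : State) (a i : ℕ) (v : ℝ) : State :=
  { σ with ra := Function.update σ.ra a (Function.update (σ.ra a) i v) }

namespace State

variable (σ : State) (x y a b i v : ℕ) (w : ℝ)

@[simp] theorem setN_nv : (σ.setN x v).nv y = if y = x then v else σ.nv y := by
  simp [setN, Function.update_apply]
@[simp] theorem setN_na : (σ.setN x v).na = σ.na := rfl
@[simp] theorem setN_rv : (σ.setN x v).rv = σ.rv := rfl
@[simp] theorem setN_ra : (σ.setN x v).ra = σ.ra := rfl
@[simp] theorem putN_nv : (σ.putN a i v).nv = σ.nv := rfl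
@[simp] theorem putN_na :
    (σ.putN a i v).na b = if b = a then Function.update (σ.na a) i v else σ.na b := by
  simp [putN, Function.update_apply]
@[simp] theorem putN_rv : (σ.putN a i v).rv = σ.rv := rfl
@[simp] theorem putN_ra : (σ.putN a i v).ra = σ.ra := rfl
@[simp] theorem setR_nv : (σ.setR x w).nv = σ.nv := rfl
@[simp] theorem setR_na : (σ.setR x w).na = σ.na := rfl
@[simp] theorem setR_rv : (σ.setR x w).rv y = if y = x then w else σ.rv y := by
  simp [setR, Function.update_apply]
@[simp] theorem setR_ra : (σ.setR x w).ra = σ.ra := rfl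
@[simp] theorem putR_nv : (σ.putR a i w).nv = σ.nv := rfl
@[simp] theorem putR_na : (σ.putR a i w).na = σ.na := rfl
@[simp] theorem putR_rv : (σ.putR a i w).rv = σ.rv := rfl
@[simp] theorem putR_ra :
    (σ.putR a i w).ra b = if b = a then Function.update (σ.ra a) i w else σ.ra b := by
  simp [putR, Function.update_apply]

end State

namespace Prog

/-- Sequential composition of programs. -/
infixr:60 " ;; " => Prog.seq

/-- The names of the natural variables that a program may assign to. -/
def wnv : Prog → ℕ → Bool
  | setNat x _, y => y == x
  | setFloor x _, y => y == x
  | seq P Q, y => P.wnv y || Q.wnv y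
  | cond _ P Q, y => P.wnv y || Q.wnv y
  | loop _ P, y => P.wnv y
  | _, _ => false

/-- The names of the natural arrays that a program may assign to. -/
def wna : Prog → ℕ → Bool
  | putNat a _ _, y => y == a
  | seq P Q, y => P.wna y || Q.wna y
  | cond _ P Q, y => P.wna y || Q.wna y
  | loop _ P, y => P.wna y
  | _, _ => false

/-- The names of the real variables that a program may assign to. -/
def wrv : Prog → ℕ → Bool
  | setReal x _, y => y == x
  | seq P Q, y => P.wrv y || Q.wrv y
  | cond _ P Q, y => P.wrv y || Q.wrv y
  | loop _ P, y => P.wrv y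
  | _, _ => false

/-- The names of the real arrays that a program may assign to. -/
def wra : Prog → ℕ → Bool
  | putReal a _ _, y => y == a
  | seq P Q, y => P.wra y || Q.wra y
  | cond _ P Q, y => P.wra y || Q.wra y
  | loop _ P, y => P.wra y
  | _, _ => false

/-- `Frame P σ τ`: the memories `σ` and `τ` agree on all names that `P` does not assign to. -/
structure Frame (P : Prog) (σ τ : State) : Prop where
  nv : ∀ x, P.wnv x = false → τ.nv x = σ.nv x
  na : ∀ x, P.wna x = false → τ.na x = σ.na x
  rv : ∀ x, P.wrv x = false → τ.rv x = σ.rv x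
  ra : ∀ x, P.wra x = false → τ.ra x = σ.ra x

theorem Frame.refl (P : Prog) (σ : State) : P.Frame σ σ :=
  ⟨fun _ _ => rfl, fun _ _ => rfl, fun _ _ => rfl, fun _ _ => rfl⟩

theorem Frame.trans {P : Prog} {σ τ ρ : State} (h : P.Frame σ τ) (k : P.Frame τ ρ) :
    P.Frame σ ρ :=
  ⟨fun x hx => (k.nv x hx).trans (h.nv x hx), fun x hx => (k.na x hx).trans (h.na x hx),
    fun x hx => (k.rv x hx).trans (h.rv x hx), fun x hx => (k.ra x hx).trans (h.ra x hx)⟩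

theorem Frame.mono {P Q : Prog} {σ τ : State} (h : P.Frame σ τ)
    (h1 : ∀ x, Q.wnv x = false → P.wnv x = false) (h2 : ∀ x, Q.wna x = false → P.wna x = false)
    (h3 : ∀ x, Q.wrv x = false → P.wrv x = false) (h4 : ∀ x, Q.wra x = false → P.wra x = false) :
    Q.Frame σ τ :=
  ⟨fun x hx => h.nv x (h1 x hx), fun x hx => h.na x (h2 x hx),
    fun x hx => h.rv x (h3 x hx), fun x hx => h.ra x (h4 x hx)⟩

end Prog

theorem Exec.frame {P : Prog} {σ τ : State} {T : ℕ} (h : Exec P σ T τ) : P.Frame σ τ := by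
  induction h with
  | skip σ => exact .refl _ _
  | setNat | putNat | setReal | putReal | setFloor =>
    constructor <;> intro y hy <;>
      simp_all [Prog.wnv, Prog.wna, Prog.wrv, Prog.wra]
  | seq _ _ h₁ h₂ =>
    exact (h₁.mono (by simp [Prog.wnv]; tauto) (by simp [Prog.wna]; tauto)
      (by simp [Prog.wrv]; tauto) (by simp [Prog.wra]; tauto)).trans
      (h₂.mono (by simp [Prog.wnv]) (by simp [Prog.wna]) (by simp [Prog.wrv]) (by simp [Prog.wra]))
  | condTrue _ _ h₁ =>
    exact h₁.mono (by simp [Prog.wnv]; tauto) (by simp [Prog.wna]; tauto)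
      (by simp [Prog.wrv]; tauto) (by simp [Prog.wra]; tauto)
  | condFalse _ _ h₁ =>
    exact h₁.mono (by simp [Prog.wnv]) (by simp [Prog.wna]) (by simp [Prog.wrv])
      (by simp [Prog.wra])
  | loopTrue _ _ _ h₁ h₂ =>
    exact (h₁.mono (Q := .loop _ _) (fun _ => id) (fun _ => id) (fun _ => id)
      (fun _ => id)).trans h₂
  | loopFalse => exact .refl _ _

/-- `WP P Q t σ`: started in memory `σ` with `t` units of fuel, of which every step consumes one,
the program `P` halts before running out of fuel, in a memory `τ` and with an amount `t'` of fuel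
left such that `Q t' τ`.  Time bounds, including amortized ones, are stated as lower bounds for the
fuel. -/
def WP (P : Prog) (Q : ℕ → State → Prop) (t : ℕ) (σ : State) : Prop :=
  ∃ T τ t', Exec P σ T τ ∧ T + t' = t ∧ Q t' τ

namespace WP

variable {P P' : Prog} {Q R : ℕ → State → Prop} {t : ℕ} {σ : State}

/-- The rule of consequence, with the frame property of `P` for free. -/
theorem conseq (h : WP P Q t σ) (hQ : ∀ t' τ, P.Frame σ τ → Q t' τ → R t' τ) : WP P R t σ := by
  obtain ⟨T, τ, t', h, ht, hq⟩ := h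
  exact ⟨T, τ, t', h, ht, hQ _ _ h.frame hq⟩

theorem add_fuel (h : WP P Q t σ) (k : ℕ) : WP P (fun t' τ => k ≤ t' ∧ Q (t' - k) τ) (t + k) σ := by
  obtain ⟨T, τ, t', h, ht, hq⟩ := h
  exact ⟨T, τ, t' + k, h, by omega, by omega, by simpa using hq⟩

theorem skip (h1 : 1 ≤ t) (h : Q (t - 1) σ) : WP .skip Q t σ :=
  ⟨_, _, _, Exec.skip σ, by omega, h⟩

theorem setNat {x : ℕ} {e : NExp} (h1 : e.size + 1 ≤ t)
    (h : Q (t - (e.size + 1)) (σ.setN x (e.eval σ))) : WP (.setNat x e) Q t σ :=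
  ⟨_, _, _, Exec.setNat σ x e, by omega, h⟩

theorem putNat {a : ℕ} {i e : NExp} (h1 : i.size + e.size + 1 ≤ t)
    (h : Q (t - (i.size + e.size + 1)) (σ.putN a (i.eval σ) (e.eval σ))) :
    WP (.putNat a i e) Q t σ :=
  ⟨_, _, _, Exec.putNat σ a i e, by omega, h⟩

theorem setReal {x : ℕ} {e : RExp} (h1 : e.size + 1 ≤ t)
    (h : Q (t - (e.size + 1)) (σ.setR x (e.eval σ))) : WP (.setReal x e) Q t σ :=
  ⟨_, _, _, Exec.setReal σ x e, by omega, h⟩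

theorem putReal {a : ℕ} {i : NExp} {e : RExp} (h1 : i.size + e.size + 1 ≤ t)
    (h : Q (t - (i.size + e.size + 1)) (σ.putR a (i.eval σ) (e.eval σ))) :
    WP (.putReal a i e) Q t σ :=
  ⟨_, _, _, Exec.putReal σ a i e, by omega, h⟩

theorem setFloor {x : ℕ} {e : RExp} (h1 : e.size + 1 ≤ t)
    (h : Q (t - (e.size + 1)) (σ.setN x ⌊e.eval σ⌋₊)) : WP (.setFloor x e) Q t σ :=
  ⟨_, _, _, Exec.setFloor σ x e, by omega, h⟩

theorem seq (h : WP P (WP P' Q) t σ) : WP (.seq P P') Q t σ := by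
  obtain ⟨T₁, τ₁, t₁, h₁, e₁, T₂, τ₂, t₂, h₂, e₂, hq⟩ := h
  exact ⟨_, _, _, h₁.seq h₂, by omega, hq⟩

theorem cond {b : BExp} (h0 : b.size ≤ t) (h1 : b.eval σ → WP P Q (t - b.size) σ)
    (h2 : ¬ b.eval σ → WP P' Q (t - b.size) σ) : WP (.cond b P P') Q t σ := by
  by_cases hb : b.eval σ
  · obtain ⟨T, τ, t', h, e, hq⟩ := h1 hb
    exact ⟨_, _, _, .condTrue hb h, by omega, hq⟩
  · obtain ⟨T, τ, t', h, e, hq⟩ := h2 hb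
    exact ⟨_, _, _, .condFalse hb h, by omega, hq⟩

theorem _root_.RSP.BExp.size_pos (b : BExp) : 0 < b.size := by cases b <;> simp [BExp.size]

/-- The rule for loops.  The invariant may mention the fuel; since every round consumes fuel, no
separate termination measure is needed. -/
theorem loop {b : BExp} (I : ℕ → State → Prop) (h0 : I t σ)
    (h : ∀ t τ, P.Frame σ τ → I t τ →
      b.size ≤ t ∧ (b.eval τ → WP P I (t - b.size) τ) ∧ (¬ b.eval τ → Q (t - b.size) τ)) :
    WP (.loop b P) Q t σ := by
  suffices ∀ t τ, P.Frame σ τ → I t τ → WP (.loop b P) Q t τ from this t σ (.refl _ _) h0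
  intro t
  induction t using Nat.strong_induction_on with
  | _ t ih =>
    intro τ hf hI
    obtain ⟨hs, ht, hn⟩ := h t τ hf hI
    by_cases hb : b.eval τ
    · obtain ⟨T, τ₁, t₁, h₁, e₁, hI₁⟩ := ht hb
      have := b.size_pos
      obtain ⟨T₂, τ₂, t₂, h₂, e₂, hq⟩ := ih t₁ (by omega) τ₁ (hf.trans h₁.frame) hI₁
      exact ⟨_, _, _, .loopTrue hb h₁ h₂, by omega, hq⟩
    · exact ⟨_, _, _, .loopFalse hb, by omega, hn hb⟩

theorem skip_iff : WP .skip Q t σ ↔ 1 ≤ t ∧ Q (t - 1) σ := by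
  refine ⟨?_, fun h => .skip h.1 h.2⟩
  rintro ⟨_, _, t', ⟨⟩, rfl, hq⟩
  exact ⟨by omega, by rw [Nat.add_sub_cancel_left]; exact hq⟩

theorem setNat_iff {x : ℕ} {e : NExp} : WP (.setNat x e) Q t σ ↔
    e.size + 1 ≤ t ∧ Q (t - (e.size + 1)) (σ.setN x (e.eval σ)) := by
  refine ⟨?_, fun h => .setNat h.1 h.2⟩
  rintro ⟨_, _, t', ⟨⟩, rfl, hq⟩
  exact ⟨by omega, by rw [Nat.add_sub_cancel_left]; exact hq⟩

theorem putNat_iff {a : ℕ} {i e : NExp} : WP (.putNat a i e) Q t σ ↔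
    i.size + e.size + 1 ≤ t ∧
      Q (t - (i.size + e.size + 1)) (σ.putN a (i.eval σ) (e.eval σ)) := by
  refine ⟨?_, fun h => .putNat h.1 h.2⟩
  rintro ⟨_, _, t', ⟨⟩, rfl, hq⟩
  exact ⟨by omega, by rw [Nat.add_sub_cancel_left]; exact hq⟩

theorem setReal_iff {x : ℕ} {e : RExp} : WP (.setReal x e) Q t σ ↔
    e.size + 1 ≤ t ∧ Q (t - (e.size + 1)) (σ.setR x (e.eval σ)) := by
  refine ⟨?_, fun h => .setReal h.1 h.2⟩
  rintro ⟨_, _, t', ⟨⟩, rfl, hq⟩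
  exact ⟨by omega, by rw [Nat.add_sub_cancel_left]; exact hq⟩

theorem putReal_iff {a : ℕ} {i : NExp} {e : RExp} : WP (.putReal a i e) Q t σ ↔
    i.size + e.size + 1 ≤ t ∧
      Q (t - (i.size + e.size + 1)) (σ.putR a (i.eval σ) (e.eval σ)) := by
  refine ⟨?_, fun h => .putReal h.1 h.2⟩
  rintro ⟨_, _, t', ⟨⟩, rfl, hq⟩
  exact ⟨by omega, by rw [Nat.add_sub_cancel_left]; exact hq⟩

theorem setFloor_iff {x : ℕ} {e : RExp} : WP (.setFloor x e) Q t σ ↔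
    e.size + 1 ≤ t ∧ Q (t - (e.size + 1)) (σ.setN x ⌊e.eval σ⌋₊) := by
  refine ⟨?_, fun h => .setFloor h.1 h.2⟩
  rintro ⟨_, _, t', ⟨⟩, rfl, hq⟩
  exact ⟨by omega, by rw [Nat.add_sub_cancel_left]; exact hq⟩

theorem seq_iff : WP (.seq P P') Q t σ ↔ WP P (WP P' Q) t σ := by
  refine ⟨?_, .seq⟩
  rintro ⟨_, _, t', h, rfl, hq⟩
  cases h with
  | seq h1 h2 =>
  exact ⟨_, _, _, h1, (add_assoc _ _ _).symm, _, _, _, h2, rfl, hq⟩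

theorem cond_iff {b : BExp} : WP (.cond b P P') Q t σ ↔ b.size ≤ t ∧
    (b.eval σ → WP P Q (t - b.size) σ) ∧ (¬ b.eval σ → WP P' Q (t - b.size) σ) := by
  refine ⟨?_, fun h => .cond h.1 h.2.1 h.2.2⟩
  rintro ⟨T, τ, t', h, rfl, hq⟩
  cases h with
  | condTrue hb h =>
    exact ⟨by omega, fun _ => ⟨_, _, _, h, by omega, hq⟩, fun hb' => absurd hb hb'⟩
  | condFalse hb h =>
    exact ⟨by omega, fun hb' => absurd hb' hb, fun _ => ⟨_, _, _, h, by omega, hq⟩⟩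

end WP

/-- `for x < y do P`, where `x` and `y` are natural variables. -/
def Prog.forN (x y : ℕ) (P : Prog) : Prog :=
  .setNat x (.const 0) ;;
  .loop (.natLe (.add (.var x) (.const 1)) (.var y)) (P ;; .setNat x (.add (.var x) (.const 1)))

/-- The rule for counting loops with rounds of bounded cost `c`. -/
theorem WP.forN {P : Prog} {Q : ℕ → State → Prop} {t : ℕ} {σ : State} {x y : ℕ} (n c : ℕ)
    (I : ℕ → State → Prop) (hy : σ.nv y = n) (hxy : y ≠ x) (hPy : P.wnv y = false)
    (hPx : P.wnv x = false) (ht : n * (c + 9) + 7 ≤ t) (h0 : I 0 (σ.setN x 0))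
    (h : ∀ j t τ, j < n → τ.nv x = j → (Prog.forN x y P).Frame σ τ → c ≤ t → I j τ →
      WP P (fun t' τ => t ≤ t' + c ∧ I (j + 1) (τ.setN x (j + 1))) t τ)
    (hQ : ∀ t' τ, (Prog.forN x y P).Frame σ τ → t ≤ t' + (n * (c + 9) + 7) → I n τ → Q t' τ) :
    WP (.forN x y P) Q t σ := by
  have hfr : ∀ τ, (Prog.seq P (.setNat x (.add (.var x) (.const 1)))).Frame (σ.setN x 0) τ →
      (Prog.forN x y P).Frame σ τ := by
    intro τ hf
    refine ⟨fun z hz => ?_, fun z hz => ?_, fun z hz => ?_, fun z hz => ?_⟩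
    · simp only [Prog.forN, Prog.wnv, Bool.or_eq_false_iff, beq_eq_false_iff_ne] at hz
      rw [hf.nv z (by simp [Prog.wnv, hz])]; simp [hz]
    · rw [hf.na z (by simpa [Prog.forN, Prog.wna] using hz)]; rfl
    · rw [hf.rv z (by simpa [Prog.forN, Prog.wrv] using hz)]; rfl
    · rw [hf.ra z (by simpa [Prog.forN, Prog.wra] using hz)]; rfl
  refine WP.seq (WP.setNat (by simp [NExp.size]; omega) ?_)
  refine WP.loop (fun t' τ => τ.nv x ≤ n ∧ τ.nv y = n ∧ I (τ.nv x) τ ∧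
    (n - τ.nv x) * (c + 9) + 5 ≤ t' ∧ t ≤ t' + (τ.nv x * (c + 9) + 2)) ?_ ?_
  · simp [NExp.size, NExp.eval, hxy, hy]
    exact ⟨h0, by omega, by omega⟩
  · rintro t' τ hf ⟨hx, hy', hI, ht', htt⟩
    simp only [BExp.size, NExp.size, BExp.eval, NExp.eval, hy']
    refine ⟨by omega, fun hlt => WP.seq ?_, fun hlt => ?_⟩
    · obtain ⟨d, hd⟩ : ∃ d, n - τ.nv x = d + 1 := ⟨n - τ.nv x - 1, by omega⟩
      have hd' : n - (τ.nv x + 1) = d := by omega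
      rw [hd, add_mul] at ht'
      refine (h (τ.nv x) _ τ hlt rfl (hfr τ hf) (by omega) hI).conseq ?_
      rintro t1 τ1 hf1 ⟨h1, h2⟩
      have e1 := hf1.nv x hPx
      refine WP.setNat (by simp [NExp.size]; omega) ?_
      simp only [NExp.size, NExp.eval, e1, State.setN_nv, if_true, if_neg hxy, hf1.nv y hPy, hy',
        hd', add_mul, true_and]
      exact ⟨hlt, h2, by omega, by omega⟩
    · have : τ.nv x = n := by omega
      rw [this] at hI htt
      exact hQ _ _ (hfr τ hf) (by omega) hI

/-! ### Walks, paths and table entries -/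

namespace WGraph

variable (G : WGraph)

theorem isWalk_append {u v : Fin G.n} {p q : List (Fin G.m)} :
    G.IsWalk u (p ++ q) v ↔ ∃ w, G.IsWalk u p w ∧ G.IsWalk w q v := by
  induction p generalizing u with
  | nil => simp [IsWalk]
  | cons e p ih => simp [IsWalk, ih]; tauto

theorem isWalk_concat {u v : Fin G.n} {p : List (Fin G.m)} {e : Fin G.m} :
    G.IsWalk u (p ++ [e]) v ↔ G.IsWalk u p (G.src e) ∧ G.tgt e = v := by
  simp only [isWalk_append, IsWalk]
  exact ⟨fun ⟨w, h, h1, h2⟩ => ⟨h1 ▸ h, h2⟩, fun ⟨h, h2⟩ => ⟨_, h, rfl, h2⟩⟩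

theorem IsPath.suffix {G : WGraph} {w u v : Fin G.n} {q : List (Fin G.m)} (h : G.IsPath w q v)
    (hu : u ∈ w :: q.map G.tgt) : ∃ q', G.IsPath u q' v ∧ q'.Sublist q := by
  induction q generalizing w with
  | nil =>
    simp only [List.map_nil, List.mem_singleton] at hu
    subst hu
    exact ⟨[], h, List.Sublist.refl _⟩
  | cons e q ih =>
    by_cases hw : u = w
    · subst hw; exact ⟨_, h, List.Sublist.refl _⟩
    · obtain ⟨⟨h1, h2⟩, h3⟩ := h
      have := List.mem_of_ne_of_mem hw hu
      obtain ⟨q', h4, h5⟩ := ih (w := G.tgt e) ⟨h2, h3.of_cons⟩ this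
      exact ⟨q', h4, h5.cons _⟩

/-- Removing cycles from a walk leaves a path. -/
theorem exists_isPath_of_isWalk {u v : Fin G.n} {p : List (Fin G.m)} (h : G.IsWalk u p v) :
    ∃ q, G.IsPath u q v ∧ q.Sublist p := by
  induction p generalizing u with
  | nil => exact ⟨[], ⟨h, by simp⟩, List.Sublist.refl _⟩
  | cons e p ih =>
    obtain ⟨h1, h2⟩ := h
    obtain ⟨q, hq, hs⟩ := ih h2
    by_cases hu : u ∈ G.tgt e :: q.map G.tgt
    · obtain ⟨q', h4, h5⟩ := hq.suffix hu
      exact ⟨q', h4, (h5.trans hs).cons _⟩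
    · exact ⟨e :: q, ⟨⟨h1, hq.1⟩, List.nodup_cons.2 ⟨hu, hq.2⟩⟩, hs.cons_cons _⟩

theorem IsPath.length_lt {G : WGraph} {u v : Fin G.n} {p : List (Fin G.m)} (h : G.IsPath u p v) :
    p.length < G.n := by
  have := h.2.length_le_card
  simpa using this

theorem res_nil : G.res [] = 0 := rfl

theorem res_concat (p : List (Fin G.m)) (e : Fin G.m) : G.res (p ++ [e]) = G.res p + G.r e := by
  simp [res]

theorem res_cons (p : List (Fin G.m)) (e : Fin G.m) : G.res (e :: p) = G.r e + G.res p := by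
  simp [res]

theorem res_nonneg (p : List (Fin G.m)) : 0 ≤ G.res p :=
  List.sum_nonneg (by simp only [List.mem_map]; rintro _ ⟨e, -, rfl⟩; exact G.r_nonneg e)

theorem cost_nonneg (p : List (Fin G.m)) : 0 ≤ G.cost p :=
  List.sum_nonneg (by simp only [List.mem_map]; rintro _ ⟨e, -, rfl⟩; exact G.c_nonneg e)

theorem res_le_of_sublist {p q : List (Fin G.m)} (h : q.Sublist p) : G.res q ≤ G.res p :=
  (h.map G.r).sum_le_sum
    (by simp only [List.mem_map]; rintro _ ⟨e, -, rfl⟩; exact G.r_nonneg e)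

theorem sum_le_of_sublist {m : ℕ} (c : Fin m → ℕ) {p q : List (Fin m)} (h : q.Sublist p) :
    (q.map c).sum ≤ (p.map c).sum :=
  (h.map c).sum_le_sum (by simp)

theorem IsPath.res_le {G : WGraph} {u v : Fin G.n} {p : List (Fin G.m)} (h : G.IsPath u p v) :
    G.res p ≤ ∑ e, G.r e := by
  have hn : p.Nodup := (List.nodup_cons.1 h.2).2.of_map
  rw [res, ← List.sum_toFinset G.r hn]
  exact Finset.sum_le_sum_of_subset_of_nonneg (Finset.subset_univ _) fun e _ _ => G.r_nonneg e

theorem m_le : G.m ≤ G.n * G.n := by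
  simpa using Fintype.card_le_of_injective _ G.simple

theorem WeaklyConnected.n_le {G : WGraph} (h : G.WeaklyConnected) : G.n ≤ G.m + 1 := by
  classical
  have h1 := SimpleGraph.Connected.card_vert_le_card_edgeSet_add_one h
  have h2 : Nat.card (SimpleGraph.fromRel
      (fun u v : Fin G.n => ∃ e, G.src e = u ∧ G.tgt e = v)).edgeSet ≤ Nat.card (Fin G.m) := by
    have h (x : (SimpleGraph.fromRel
        (fun u v : Fin G.n => ∃ e, G.src e = u ∧ G.tgt e = v)).edgeSet) :
        ∃ e, s(G.src e, G.tgt e) = x.1 := by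
      obtain ⟨x, hx⟩ := x
      induction x with
      | _ u v =>
        simp only [SimpleGraph.mem_edgeSet, SimpleGraph.fromRel_adj] at hx
        obtain ⟨-, ⟨e, rfl, rfl⟩ | ⟨e, rfl, rfl⟩⟩ := hx
        · exact ⟨e, rfl⟩
        · exact ⟨e, Sym2.eq_swap⟩
    choose g hg using h
    exact Nat.card_le_card_of_injective g fun x y hxy =>
      Subtype.ext (by rw [← hg x, ← hg y, hxy])
  simp only [Nat.card_eq_fintype_card, Fintype.card_fin] at h1 h2
  omega

end WGraph

section Entries

variable {G : WGraph} {c : Fin G.m → ℕ} {s v : Fin G.n} {i : ℕ} {x : ℝ}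

theorem isEntry_of_walk (h1 : ∃ p, G.IsWalk s p v ∧ (p.map c).sum ≤ i ∧ G.res p = x)
    (h2 : ∀ p, G.IsWalk s p v → (p.map c).sum ≤ i → x ≤ G.res p) : IsEntry G c s v i x := by
  left
  obtain ⟨p, hp, hi, rfl⟩ := h1
  obtain ⟨q, hq, hs⟩ := G.exists_isPath_of_isWalk hp
  have hqi := (WGraph.sum_le_of_sublist c hs).trans hi
  refine ⟨⟨q, hq, hqi, le_antisymm (G.res_le_of_sublist hs) (h2 q hq.1 hqi)⟩, ?_⟩
  rintro _ ⟨p', hp', hi', rfl⟩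
  exact h2 p' hp'.1 hi'

theorem IsEntry.of_walk (h : IsEntry G c s v i x) {p : List (Fin G.m)} (hp : G.IsWalk s p v)
    (hi : (p.map c).sum ≤ i) : 0 ≤ x ∧ x ≤ G.res p := by
  obtain ⟨q, hq, hs⟩ := G.exists_isPath_of_isWalk hp
  have hqi := (WGraph.sum_le_of_sublist c hs).trans hi
  obtain h | h := h
  · obtain ⟨p', hp', hi', rfl⟩ := h.1
    exact ⟨G.res_nonneg _, (h.2 ⟨q, hq, hqi, rfl⟩).trans (G.res_le_of_sublist hs)⟩
  · exact absurd ⟨q, hq, hqi⟩ h.1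

theorem IsEntry.exists_isPath (h : IsEntry G c s v i x) (hx : 0 ≤ x) :
    ∃ p, G.IsPath s p v ∧ (p.map c).sum ≤ i ∧ G.res p = x := by
  obtain h | h := h
  · exact h.1
  · linarith [h.2]

/-- Labels that are closed under the edges, and that are attained by walks unless they are too large
for that, are the entries of row `i`. -/
theorem isEntry_of_closed {y : Fin G.n → ℝ} {B : ℝ} (hB : ∑ e, G.r e < B)
    (h1 : ∀ v, B ≤ y v ∨ ∃ p, G.IsWalk s p v ∧ (p.map c).sum ≤ i ∧ G.res p = y v) (h2 : y s ≤ 0)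
    (h3 : ∀ e, 1 ≤ c e → c e ≤ i → ∀ p, G.IsWalk s p (G.src e) → (p.map c).sum ≤ i - c e →
      y (G.tgt e) ≤ G.res p + G.r e)
    (h4 : ∀ e, c e = 0 → y (G.tgt e) ≤ y (G.src e) + G.r e) (v : Fin G.n) :
    IsEntry G c s v i (if B ≤ y v then -1 else y v) := by
  have key : ∀ p : List (Fin G.m), ∀ v, G.IsWalk s p v → (p.map c).sum ≤ i → y v ≤ G.res p := by
    intro p
    induction p using List.reverseRecOn with
    | nil => rintro v rfl -; exact h2
    | append_singleton p e ih =>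
      intro v hp hi
      obtain ⟨hp', rfl⟩ := G.isWalk_concat.1 hp
      simp only [List.map_append, List.map_cons, List.map_nil, List.sum_append, List.sum_cons,
        List.sum_nil, add_zero] at hi
      rw [G.res_concat]
      by_cases hc : c e = 0
      · exact (h4 e hc).trans (by linarith [ih _ hp' (by omega)])
      · exact h3 e (by omega) (by omega) p hp' (by omega)
  split_ifs with hy
  · refine Or.inr ⟨?_, rfl⟩
    rintro ⟨p, hp, hi⟩
    linarith [key p v hp.1 hi, hp.res_le]
  · exact isEntry_of_walk ((h1 v).resolve_left hy) fun p hp hi => key p v hp hi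

end Entries

/-! ### Computing a row of the table -/

/-- The memory holds the graph `G` with the integer edge costs `c`. -/
structure HoldsNet (G : WGraph) (c : Fin G.m → ℕ) (σ : State) : Prop where
  n : σ.nv 0 = G.n
  m : σ.nv 1 = G.m
  src : ∀ e : Fin G.m, σ.na 0 e = G.src e
  tgt : ∀ e : Fin G.m, σ.na 1 e = G.tgt e
  costs : ∀ e : Fin G.m, σ.na 2 e = c e
  r : ∀ e : Fin G.m, σ.ra 1 e = G.r e

/-- The program does not assign to the input of a row program, except possibly to the table. -/
def Prog.keepsNet (P : Prog) : Bool :=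
  !P.wnv 0 && !P.wnv 1 && !P.wnv 2 && !P.wnv 3 && !P.wna 0 && !P.wna 1 && !P.wna 2 && !P.wra 1

section

variable {G : WGraph} {c : Fin G.m → ℕ} {s : Fin G.n} {k : ℕ} {σ τ : State} {P : Prog}

theorem HoldsRows.net (h : HoldsRows G c s k σ) : HoldsNet G c σ :=
  ⟨h.n, h.m, h.src, h.tgt, h.costs, h.r⟩

theorem HoldsNet.frame (h : HoldsNet G c σ) (hf : P.Frame σ τ) (hP : P.keepsNet = true) :
    HoldsNet G c τ := by
  simp only [Prog.keepsNet, Bool.and_eq_true, Bool.not_eq_true'] at hP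
  obtain ⟨⟨⟨⟨⟨⟨⟨h0, h1⟩, -⟩, -⟩, a0⟩, a1⟩, a2⟩, r1⟩ := hP
  exact ⟨by rw [hf.nv 0 h0, h.n], by rw [hf.nv 1 h1, h.m], by rw [hf.na 0 a0]; exact h.src,
    by rw [hf.na 1 a1]; exact h.tgt, by rw [hf.na 2 a2]; exact h.costs,
    by rw [hf.ra 1 r1]; exact h.r⟩

theorem HoldsRows.frame (h : HoldsRows G c s k σ) (hf : P.Frame σ τ) (hP : P.keepsNet = true)
    (hr : P.wra 2 = false) : HoldsRows G c s k τ := by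
  have hn := h.net.frame hf hP
  simp only [Prog.keepsNet, Bool.and_eq_true, Bool.not_eq_true'] at hP
  exact ⟨hn.n, hn.m, by rw [hf.nv 2 (by tauto), h.start], hn.src, hn.tgt, hn.costs, hn.r,
    by rw [hf.ra 2 hr]; exact h.rows⟩

theorem HoldsRows.setR (h : HoldsRows G c s k σ) (x : ℕ) (v : ℝ) :
    HoldsRows G c s k (σ.setR x v) :=
  ⟨h.n, h.m, h.start, h.src, h.tgt, h.costs, h.r, h.rows⟩

theorem HoldsRows.setN (h : HoldsRows G c s k σ) {x : ℕ} (hx : 2 < x) (v : ℕ) :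
    HoldsRows G c s k (σ.setN x v) :=
  ⟨by simp [h.n, show 0 ≠ x by omega], by simp [h.m, show 1 ≠ x by omega],
    by simp [h.start, show 2 ≠ x by omega], h.src, h.tgt, h.costs, h.r, h.rows⟩

theorem HoldsRows.putR (h : HoldsRows G c s k σ) {a : ℕ} (ha : 2 < a) (i : ℕ) (v : ℝ) :
    HoldsRows G c s k (σ.putR a i v) :=
  ⟨h.n, h.m, h.start, h.src, h.tgt, h.costs, by simpa [show 1 ≠ a by omega] using h.r,
    by simpa [show 2 ≠ a by omega] using h.rows⟩

end

/-- Sets the real variable `2` to a bound for the resource consumption of all paths, and every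
label (real array `3`) to the least resource consumption of a path whose last edge has positive
cost, as far as the previous rows tell, or to the bound. -/
def rowInit : Prog :=
  .setReal 2 (.ofNat (.const 1)) ;;
  .forN 4 1 (.setReal 2 (.add (.var 2) (.get 1 (.var 4)))) ;;
  .forN 4 0 (.putReal 3 (.var 4) (.var 2)) ;;
  .putReal 3 (.var 2) (.ofNat (.const 0)) ;;
  .forN 4 1
    (.cond (.and (.natLe (.const 1) (.get 2 (.var 4))) (.natLe (.get 2 (.var 4)) (.var 3)))
      (.setReal 3 (.get 2 (.add (.mul (.sub (.var 3) (.get 2 (.var 4))) (.var 0))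
          (.get 0 (.var 4)))) ;;
        .cond (.and (.realLe (.ofNat (.const 0)) (.var 3))
            (.realLe (.add (.var 3) (.get 1 (.var 4))) (.get 3 (.get 1 (.var 4)))))
          (.putReal 3 (.get 1 (.var 4)) (.add (.var 3) (.get 1 (.var 4)))) .skip) .skip)

/-- Enters the labels into the table. -/
def rowFin : Prog :=
  .forN 4 0
    (.cond (.realLe (.var 2) (.get 3 (.var 4)))
      (.putReal 2 (.add (.mul (.var 3) (.var 0)) (.var 4))
        (.sub (.ofNat (.const 0)) (.ofNat (.const 1))))
      (.putReal 2 (.add (.mul (.var 3) (.var 0)) (.var 4)) (.get 3 (.var 4))))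

/-- The row program with the subprogram `Cl` for closing the labels under edges of cost `0`. -/
def rowProg (Cl : Prog) : Prog := rowInit ;; Cl ;; rowFin

/-- The result of `rowInit`. -/
structure InitLabels (G : WGraph) (c : Fin G.m → ℕ) (s : Fin G.n) (k : ℕ) (D : ℕ → ℝ) (B : ℝ)
    (y : ℕ → ℝ) : Prop where
  bound : B = 1 + ∑ e, G.r e
  nonneg : ∀ v : Fin G.n, 0 ≤ y v
  attained : ∀ v : Fin G.n,
    B ≤ y v ∨ ∃ p, G.IsWalk s p v ∧ (p.map c).sum ≤ k ∧ G.res p = y v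
  start : y s ≤ 0
  relaxed : ∀ e : Fin G.m, 1 ≤ c e → c e ≤ k → 0 ≤ D ((k - c e) * G.n + G.src e) →
    y (G.tgt e) ≤ D ((k - c e) * G.n + G.src e) + G.r e

section

variable {G : WGraph} {c : Fin G.m → ℕ} {s : Fin G.n} {k : ℕ} {σ : State} {t : ℕ}

theorem rowInit_spec (h : HoldsRows G c s k σ) (hk : σ.nv 3 = k)
    (ht : 90 * G.m + 20 * G.n + 40 ≤ t) :
    WP rowInit (fun t' τ => t ≤ t' + (90 * G.m + 20 * G.n + 40) ∧
      InitLabels G c s k (τ.ra 2) (τ.rv 2) (τ.ra 3)) t σ := by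
  refine WP.seq (WP.setReal (by simp [RExp.size, NExp.size]; omega) ?_)
  refine WP.seq (WP.forN G.m 5 (fun j τ => τ.rv 2 = 1 + ∑ i ∈ Finset.range j, σ.ra 1 i)
    (by simp [h.m]) (by simp) rfl rfl (by simp [RExp.size, NExp.size]; omega)
    (by simp [RExp.eval, NExp.eval]) ?_ ?_)
  · intro j t τ hj hx hf hc hI
    have h1 : τ.ra 1 = σ.ra 1 := hf.ra 1 rfl
    refine WP.setReal (by simpa [RExp.size, NExp.size] using hc) ⟨by
      simp [RExp.size, NExp.size]; omega, ?_⟩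
    simp [RExp.eval, NExp.eval, hx, hI, h1, Finset.sum_range_succ, add_assoc]
  intro t1 τ1 hf1 ht1 hB
  have hB : τ1.rv 2 = 1 + ∑ e, G.r e := by
    rw [hB, Finset.sum_range]; simp [h.r]
  have hn1 : τ1.nv 0 = G.n := by rw [hf1.nv 0 rfl]; simpa using h.n
  simp only [RExp.size, NExp.size] at ht1
  refine WP.seq (WP.forN G.n 3 (fun j τ => ∀ v < j, τ.ra 3 v = 1 + ∑ e, G.r e)
    hn1 (by simp) rfl rfl (by omega) (by simp) ?_ ?_)
  · intro j t τ hj hx hf hc hI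
    have h1 : τ.rv 2 = τ1.rv 2 := hf.rv 2 rfl
    refine WP.putReal (by simpa [RExp.size, NExp.size] using hc) ⟨by
      simp [RExp.size, NExp.size]; omega, ?_⟩
    intro v hv
    simp only [RExp.eval, NExp.eval, hx, h1, hB, State.setN_ra, State.putR_ra, if_true,
      Function.update_apply]
    split_ifs with hvj
    · rfl
    · exact hI v (by omega)
  intro t2 τ2 hf2 ht2 hy
  refine WP.seq (WP.putReal (by simp [RExp.size, NExp.size]; omega) ?_)
  have hR0 := (((h.setR 2 _).frame hf1 rfl rfl).frame hf2 rfl rfl).putR (a := 3) (by omega)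
    (NExp.eval τ2 (.var 2)) (RExp.eval τ2 (.ofNat (.const 0)))
  set σ3 := τ2.putR 3 (NExp.eval τ2 (.var 2)) (RExp.eval τ2 (.ofNat (.const 0))) with hσ3
  have hB3 : σ3.rv 2 = 1 + ∑ e, G.r e := by rw [← hB]; exact hf2.rv 2 rfl
  have hk3 : σ3.nv 3 = k := by
    rw [← hk]; exact (hf2.nv 3 rfl).trans (by rw [hf1.nv 3 rfl]; rfl)
  have hs3 : NExp.eval τ2 (.var 2) = s := hR0.start
  have hy3 : ∀ v, σ3.ra 3 v = if v = s then 0 else τ2.ra 3 v := by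
    intro v
    simp [hσ3, hs3, RExp.eval, Function.update_apply]; simp [NExp.eval]
  clear_value σ3
  have hBpos : 0 ≤ 1 + ∑ e, G.r e := by
    have := Finset.sum_nonneg fun e (_ : e ∈ Finset.univ) => G.r_nonneg e
    linarith
  refine WP.forN G.m 60 (fun j τ => (∀ v : Fin G.n, 0 ≤ τ.ra 3 v) ∧
    (∀ v : Fin G.n, 1 + ∑ e, G.r e ≤ τ.ra 3 v ∨
      ∃ p, G.IsWalk s p v ∧ (p.map c).sum ≤ k ∧ G.res p = τ.ra 3 v) ∧
    τ.ra 3 s ≤ 0 ∧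
    ∀ e : Fin G.m, e.val < j → 1 ≤ c e → c e ≤ k → 0 ≤ σ3.ra 2 ((k - c e) * G.n + G.src e) →
      τ.ra 3 (G.tgt e) ≤ σ3.ra 2 ((k - c e) * G.n + G.src e) + G.r e)
    (by rw [hR0.m]) (by simp) rfl rfl (by simp only [RExp.size, NExp.size]; omega) ?_ ?_ ?_
  · refine ⟨fun v => ?_, fun v => ?_, by simp [hy3], by simp⟩
    · simp only [State.setN_ra, hy3]
      split_ifs
      · exact le_rfl
      · rw [hy v v.2]; exact hBpos
    · simp only [State.setN_ra, hy3]
      split_ifs with hv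
      · exact Or.inr ⟨[], (Fin.ext hv).symm, by simp, rfl⟩
      · rw [hy v v.2]; exact Or.inl le_rfl
  · rintro j t τ hj hx hf hc ⟨i1, i2, i3, i4⟩
    have hR := hR0.frame hf rfl rfl
    have h2 : τ.ra 2 = σ3.ra 2 := hf.ra 2 rfl
    have hk' : τ.nv 3 = k := by rw [hf.nv 3 rfl, hk3]
    obtain ⟨e, rfl⟩ : ∃ e : Fin G.m, e.val = j := ⟨⟨j, hj⟩, rfl⟩
    simp only [WP.cond_iff, WP.seq_iff, WP.setReal_iff, WP.putReal_iff, WP.skip_iff, BExp.eval,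
      BExp.size, NExp.eval, NExp.size, RExp.eval, RExp.size, State.setR_rv, State.setR_nv,
      State.setR_na, State.setR_ra, State.putR_ra, State.setN_ra, if_true, hx, hR.costs, hR.src,
      hR.tgt, hR.r, hk', hR.n, h2]
    norm_num only
    have old : ∀ e' : Fin G.m, e'.val < e + 1 → ¬ (1 ≤ c e ∧ c e ≤ k ∧
        0 ≤ σ3.ra 2 ((k - c e) * G.n + G.src e)) → 1 ≤ c e' → c e' ≤ k →
        0 ≤ σ3.ra 2 ((k - c e') * G.n + G.src e') →
        τ.ra 3 (G.tgt e') ≤ σ3.ra 2 ((k - c e') * G.n + G.src e') + G.r e' := by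
      intro e' he' hn h1 h2 h3
      by_cases hee : e' = e
      · subst hee; exact absurd ⟨h1, h2, h3⟩ hn
      · exact i4 e' (by have := Fin.val_ne_of_ne hee; omega) h1 h2 h3
    refine ⟨by omega, fun hce => ⟨by omega, by omega, fun hle => ⟨by omega, by omega, ?_⟩,
      fun hle => ⟨by omega, by omega, i1, i2, i3, ?_⟩⟩,
      fun hce => ⟨by omega, by omega, i1, i2, i3, fun e' he' => old e' he' (by tauto)⟩⟩
    · have hD := hR.rows (k - c e) (by omega) (G.src e)
      rw [h2] at hD
      obtain ⟨p, hp, hpk, hpr⟩ := hD.exists_isPath (by simpa using hle.1)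
      refine ⟨fun v => ?_, fun v => ?_, ?_, fun e' he' h1' h2' h3' => ?_⟩
      · rw [Function.update_apply]
        split_ifs
        · exact add_nonneg (by simpa using hle.1) (G.r_nonneg e)
        · exact i1 v
      · rw [Function.update_apply]
        split_ifs with hv
        · refine Or.inr ⟨p ++ [e], G.isWalk_concat.2 ⟨hp.1, (Fin.ext hv).symm⟩, ?_, ?_⟩
          · simp; omega
          · rw [G.res_concat, hpr]
        · exact i2 v
      · rw [Function.update_apply]
        split_ifs with hv
        · rw [hv] at i3; exact hle.2.trans i3
        · exact i3
      · rw [Function.update_apply]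
        by_cases hee : e' = e
        · subst hee; simp
        have := i4 e' (by have := Fin.val_ne_of_ne hee; omega) h1' h2' h3'
        split_ifs with hv
        · rw [hv] at this; exact hle.2.trans this
        · exact this
    · intro e' he' h1' h2' h3'
      by_cases hee : e' = e
      · subst hee
        rcases not_and_or.1 hle with hn | hn
        · exact absurd h3' (by simpa using hn)
        · exact (not_le.1 hn).le
      · exact i4 e' (by have := Fin.val_ne_of_ne hee; omega) h1' h2' h3'
  · rintro t' τ hf ht' ⟨i1, i2, i3, i4⟩
    refine ⟨by simp only [RExp.size, NExp.size] at ht'; omega, ?_⟩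
    have e2 : τ.rv 2 = 1 + ∑ e, G.r e := by rw [hf.rv 2 rfl, hB3]
    refine ⟨e2, i1, by rwa [e2], i3, fun e => ?_⟩
    rw [hf.ra 2 rfl]
    exact i4 e e.2

/-- `Cl` closes labels of vertices under the edges of cost `0` in time `F`: the new labels are not
larger than the old ones and arise from them by relaxing edges of cost `0`. -/
def Closes (Cl : Prog) (G : WGraph) (c : Fin G.m → ℕ) (F : ℕ) : Prop :=
  ∀ t σ, HoldsNet G c σ → (∀ v : Fin G.n, 0 ≤ σ.ra 3 v) → F ≤ t →
    WP Cl (fun t' τ => t ≤ t' + F ∧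
      (∀ v : Fin G.n, τ.ra 3 v ≤ σ.ra 3 v) ∧
      (∀ e, c e = 0 → τ.ra 3 (G.tgt e) ≤ τ.ra 3 (G.src e) + G.r e) ∧
      ∀ Q : Fin G.n → ℝ → Prop, (∀ e y, c e = 0 → Q (G.src e) y → Q (G.tgt e) (y + G.r e)) →
        (∀ v, Q v (σ.ra 3 v)) → ∀ v, Q v (τ.ra 3 v)) t σ

theorem rowFin_spec (h : HoldsRows G c s k σ) (hk : σ.nv 3 = k)
    (ht : 40 * G.n + 7 ≤ t)
    (hE : ∀ v : Fin G.n, IsEntry G c s v k (if σ.rv 2 ≤ σ.ra 3 v then -1 else σ.ra 3 v)) :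
    WP rowFin (fun t' τ => t ≤ t' + (40 * G.n + 7) ∧ HoldsRows G c s (k + 1) τ) t σ := by
  have hinj : ∀ i a b, a < G.n → b < G.n → i < k → i * G.n + a ≠ k * G.n + b := by
    intro i a b ha hb hi he
    have : (i + 1) * G.n ≤ k * G.n := Nat.mul_le_mul_right _ hi
    rw [add_mul] at this
    omega
  refine WP.forN G.n 31 (fun j τ => HoldsRows G c s k τ ∧ ∀ v : Fin G.n, v.val < j →
      IsEntry G c s v k (τ.ra 2 (k * G.n + v)))
    (by rw [h.n]) (by simp) rfl rfl (by omega) ⟨h.setN (by omega) _, by simp⟩ ?_ ?_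
  · rintro j t τ hj hx hf hc ⟨hR, hI⟩
    have h2 : τ.rv 2 = σ.rv 2 := hf.rv 2 rfl
    have h3 : τ.ra 3 = σ.ra 3 := hf.ra 3 rfl
    have hk' : τ.nv 3 = k := by rw [hf.nv 3 rfl, hk]
    have hEj := hE ⟨j, hj⟩
    simp only [WP.cond_iff, WP.putReal_iff, BExp.eval,
      BExp.size, NExp.eval, NExp.size, RExp.eval, RExp.size, hx, hk', hR.n, h2, h3]
    have key : ∀ x, IsEntry G c s ⟨j, hj⟩ k x →
        HoldsRows G c s k ((τ.putR 2 (k * G.n + j) x).setN 4 (j + 1)) ∧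
        ∀ v : Fin G.n, v.val < j + 1 →
          IsEntry G c s v k (((τ.putR 2 (k * G.n + j) x).setN 4 (j + 1)).ra 2 (k * G.n + v)) := by
      intro x hx
      constructor
      · refine ⟨hR.n, hR.m, hR.start, hR.src, hR.tgt, hR.costs, hR.r, fun i hi v => ?_⟩
        simp only [State.setN_ra, State.putR_ra, if_true, Function.update_apply,
          if_neg (hinj i v j v.2 hj hi)]
        exact hR.rows i hi v
      · intro v hv
        simp only [State.setN_ra, State.putR_ra, if_true, Function.update_apply,
          Nat.add_left_cancel_iff]
        split_ifs with hvj
        · obtain rfl : v = ⟨j, hj⟩ := Fin.ext hvj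
          exact hx
        · exact hI v (by omega)
    refine ⟨by omega, fun hb => ⟨by omega, by omega, key _ ?_⟩,
      fun hb => ⟨by omega, by omega, key _ ?_⟩⟩
    · simpa [hb] using hEj
    · simpa [hb] using hEj
  · rintro t' τ hf ht' ⟨hR, hI⟩
    refine ⟨by omega, hR.n, hR.m, hR.start, hR.src, hR.tgt, hR.costs, hR.r, fun i hi v => ?_⟩
    rcases Nat.lt_succ_iff_lt_or_eq.1 hi with hi | rfl
    · exact hR.rows i hi v
    · exact hI v v.2

/-- A row is computed by relaxing the edges of positive cost, closing under the edges of cost `0`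
and entering the labels into the table. -/
theorem rowProg_spec {Cl : Prog} {F : ℕ} (hCl : Closes Cl G c F) (hk1 : Cl.keepsNet = true)
    (hk2 : Cl.wra 2 = false) (hk3 : Cl.wrv 2 = false) (h : HoldsRows G c s k σ) (hk : σ.nv 3 = k)
    (ht : 90 * G.m + 60 * G.n + 50 + F ≤ t) :
    WP (rowProg Cl) (fun t' τ => t ≤ t' + (90 * G.m + 60 * G.n + 50 + F) ∧
      HoldsRows G c s (k + 1) τ) t σ := by
  have hCl3 : Cl.wnv 3 = false := by
    simp only [Prog.keepsNet, Bool.and_eq_true, Bool.not_eq_true'] at hk1; tauto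
  refine WP.seq ((rowInit_spec h hk (by omega)).conseq fun t1 τ1 hf1 ⟨ht1, hI⟩ => ?_)
  have hR1 := h.frame hf1 rfl rfl
  refine WP.seq ((hCl t1 τ1 hR1.net hI.nonneg (by omega)).conseq
    fun t2 τ2 hf2 ⟨ht2, hle, hcl, hQ⟩ => ?_)
  have hR2 := hR1.frame hf2 hk1 hk2
  have hB : τ2.rv 2 = 1 + ∑ e, G.r e := by rw [hf2.rv 2 hk3, hI.bound]
  refine (rowFin_spec hR2 ?_ (by omega) ?_).conseq fun t3 τ3 hf3 ⟨ht3, hR3⟩ => ⟨by omega, hR3⟩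
  · rw [hf2.nv 3 hCl3, hf1.nv 3 rfl, hk]
  rw [hB]
  refine isEntry_of_closed (y := fun v : Fin G.n => τ2.ra 3 v) (by linarith) ?_
    ((hle s).trans hI.start) ?_ hcl
  · refine hQ (fun v y => 1 + ∑ e, G.r e ≤ y ∨
      ∃ p, G.IsWalk s p v ∧ (p.map c).sum ≤ k ∧ G.res p = y) ?_ ?_
    · rintro e y he (hy | ⟨p, hp, hpk, rfl⟩)
      · exact Or.inl (by linarith [G.r_nonneg e])
      · exact Or.inr ⟨p ++ [e], G.isWalk_concat.2 ⟨hp, rfl⟩, by simpa [he] using hpk,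
          G.res_concat _ _⟩
    · intro v
      simpa [hI.bound] using hI.attained v
  · intro e he1 he2 p hp hpk
    have := (hR1.rows (k - c e) (by omega) (G.src e)).of_walk hp hpk
    exact ((hle _).trans (hI.relaxed e he1 he2 this.1)).trans (by linarith [this.2])

end

/-! ### Adjacency lists -/

/-- The successor of the last index below `j` at which the array `S` takes the value `u`, and `0` if
there is none. -/
def lastOut (S : ℕ → ℕ) (u : ℕ) : ℕ → ℕ
  | 0 => 0
  | j + 1 => if S j = u then j + 1 else lastOut S u j

theorem lastOut_le (S : ℕ → ℕ) (u j : ℕ) : lastOut S u j ≤ j := by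
  induction j with
  | zero => simp [lastOut]
  | succ j ih => rw [lastOut]; split_ifs <;> omega

theorem apply_lastOut {S : ℕ → ℕ} {u j e : ℕ} (h : lastOut S u j = e + 1) : S e = u := by
  induction j with
  | zero => simp [lastOut] at h
  | succ j ih =>
    rw [lastOut] at h
    split_ifs at h with hj
    · obtain rfl : j = e := by omega
      exact hj
    · exact ih h

theorem lt_lastOut {S : ℕ → ℕ} {u j e : ℕ} (he : e < j) (h : S e = u) : e < lastOut S u j := by
  induction j with
  | zero => omega
  | succ j ih =>
    rw [lastOut]
    split_ifs with hj
    · omega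
    · exact ih (lt_of_le_of_ne (by omega) (by rintro rfl; exact hj h))

/-- Builds linked lists of the outgoing edges of every vertex, in order of decreasing index: the
natural array `3` holds the heads and the natural array `4` the links, where edges are stored as the
successors of their indices, and `0` ends a list. -/
def buildAdj : Prog :=
  .forN 4 0 (.putNat 3 (.var 4) (.const 0)) ;;
  .forN 4 1 (.putNat 4 (.var 4) (.get 3 (.get 0 (.var 4))) ;;
    .putNat 3 (.get 0 (.var 4)) (.add (.var 4) (.const 1)))

/-- The memory holds the linked lists of outgoing edges. -/
structure HoldsAdj (G : WGraph) (σ : State) : Prop where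
  head : ∀ u : Fin G.n, σ.na 3 u = lastOut (σ.na 0) u G.m
  next : ∀ e : Fin G.m, σ.na 4 e = lastOut (σ.na 0) (G.src e) e

/-- Runs `P` for every outgoing edge of the vertex in the natural variable `5`, with the edge in the
natural variable `7`. -/
def Prog.forOut (P : Prog) : Prog :=
  .setNat 6 (.get 3 (.var 5)) ;;
  .loop (.natLe (.const 1) (.var 6))
    (.setNat 7 (.sub (.var 6) (.const 1)) ;; P ;; .setNat 6 (.get 4 (.var 7)))

theorem card_filter_lt_succ {n m : ℕ} {f : Fin m → Fin n} {z : Fin n} {e : Fin m} (he : f e = z) :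
    (Finset.univ.filter fun e' => f e' = z ∧ e'.val < e + 1).card =
      (Finset.univ.filter fun e' => f e' = z ∧ e'.val < e).card + 1 := by
  rw [← Finset.card_insert_of_notMem (a := e) (by simp)]
  congr 1
  ext e'
  simp only [Finset.mem_filter, Finset.mem_univ, true_and, Finset.mem_insert, Fin.ext_iff]
  constructor
  · rintro ⟨h1, h2⟩
    by_cases h : e'.val = e.val
    · exact Or.inl h
    · exact Or.inr ⟨h1, by omega⟩
  · rintro (h | ⟨h1, h2⟩)
    · obtain rfl := Fin.ext h
      exact ⟨congrArg Fin.val he, by omega⟩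
    · exact ⟨h1, by omega⟩

section

variable {G : WGraph} {c : Fin G.m → ℕ} {s : Fin G.n} {k : ℕ} {σ : State} {t : ℕ}

theorem buildAdj_spec (h : HoldsNet G c σ) (ht : 20 * G.m + 20 * G.n + 20 ≤ t) :
    WP buildAdj (fun t' τ => t ≤ t' + (20 * G.m + 20 * G.n + 20) ∧ HoldsAdj G τ) t σ := by
  refine WP.seq (WP.forN G.n 3 (fun j τ => ∀ u < j, τ.na 3 u = 0)
    (by simp [h.n]) (by simp) rfl rfl (by omega) (by simp) ?_ ?_)
  · intro j t τ hj hx hf hc hI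
    refine WP.putNat (by simpa [NExp.size] using hc) ⟨by simp [NExp.size]; omega, ?_⟩
    intro u hu
    simp only [NExp.eval, hx, State.setN_na, State.putN_na, if_true, Function.update_apply]
    split_ifs with hvj
    · rfl
    · exact hI u (by omega)
  intro t1 τ1 hf1 ht1 hI
  have h1 := h.frame hf1 rfl
  refine WP.forN G.m 11 (fun j τ => (∀ u : Fin G.n, τ.na 3 u = lastOut (σ.na 0) u j) ∧
    ∀ e : Fin G.m, e.val < j → τ.na 4 e = lastOut (σ.na 0) (G.src e) e)
    (by simp [h1.m]) (by simp) rfl rfl (by omega) ?_ ?_ ?_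
  · simpa [lastOut] using fun u : Fin G.n => hI u u.2
  · rintro j t τ hj hx hf hc ⟨i1, i2⟩
    have hN := h1.frame hf rfl
    obtain ⟨e, rfl⟩ : ∃ e : Fin G.m, e.val = j := ⟨⟨j, hj⟩, rfl⟩
    simp only [WP.seq_iff, WP.putNat_iff, NExp.eval, NExp.size, hx, State.putN_nv, State.putN_na,
      State.setN_na, hN.src]
    norm_num only
    refine ⟨by omega, by omega, by omega, fun u => ?_, fun e' he' => ?_⟩
    · simp only [if_true, Function.update_apply, lastOut, h.src, i1, hN.src, if_false]
      simp only [eq_comm]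
    · simp [Function.update_apply]
      split_ifs with he
      · obtain rfl := Fin.ext he
        exact i1 _
      · exact i2 e' (by omega)
  · rintro t' τ hf ht' ⟨i1, i2⟩
    have h0 : τ.na 0 = σ.na 0 := by rw [hf.na 0 rfl, hf1.na 0 rfl]
    exact ⟨by omega, fun u => by rw [i1, h0], fun e => by rw [i2 e e.2, h0]⟩

/-- The rule for `forOut`.  In `I j t τ`, the edges from `z` with index at least `j` have been
dealt with; the fuel for the administration of the loop is accounted for separately. -/
theorem WP.forOut {P : Prog} {Q : ℕ → State → Prop} (z : Fin G.n) (I : ℕ → ℕ → State → Prop)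
    (t₀ : ℕ) (hN : HoldsNet G c σ) (hA : HoldsAdj G σ) (hz : σ.nv 5 = z)
    (hP4 : P.wna 4 = false) (hP7 : P.wnv 7 = false)
    (ht : t₀ + 10 * (Finset.univ.filter fun e => G.src e = z).card + 6 ≤ t) (h0 : I G.m t₀ σ)
    (hmono : ∀ j j' t τ, j' ≤ j → (∀ e, G.src e = z → j' ≤ e.val → j ≤ e.val) → I j t τ → I j' t τ)
    (hset : ∀ j t τ v, I j t τ → I j t (τ.setN 6 v) ∧ I j t (τ.setN 7 v))
    (hbody : ∀ (e : Fin G.m) (t : ℕ) (τ : State), G.src e = z → τ.nv 7 = e →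
      (Prog.forOut P).Frame σ τ → I (e + 1) t τ →
      WP P (fun t' τ' => I e t' τ') t τ)
    (hQ : ∀ t₁ t' τ, (Prog.forOut P).Frame σ τ → t₁ ≤ t' → I 0 t₁ τ → Q t' τ) :
    WP (.forOut P) Q t σ := by
  set cnt : ℕ → ℕ := fun j => (Finset.univ.filter fun e => G.src e = z ∧ e.val < j).card with hcnt
  refine WP.seq (WP.setNat (by simp [NExp.size]; omega) ?_)
  have hfr : ∀ τ, (Prog.seq (.setNat 7 (.sub (.var 6) (.const 1))) (.seq P
      (.setNat 6 (.get 4 (.var 7))))).Frame (σ.setN 6 (NExp.eval σ (.get 3 (.var 5)))) τ →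
      (Prog.forOut P).Frame σ τ := by
    intro τ hf
    refine ⟨fun x hx => ?_, fun x hx => ?_, fun x hx => ?_, fun x hx => ?_⟩
    · simp only [Prog.forOut, Prog.wnv, Bool.or_eq_false_iff, beq_eq_false_iff_ne] at hx
      rw [hf.nv x (by simp [Prog.wnv, hx])]; simp [hx]
    · rw [hf.na x (by simpa [Prog.forOut, Prog.wna] using hx)]; rfl
    · rw [hf.rv x (by simpa [Prog.forOut, Prog.wrv] using hx)]; rfl
    · rw [hf.ra x (by simpa [Prog.forOut, Prog.wra] using hx)]; rfl
  -- moving the pointer to the next entry of the list skips no edge from `z`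
  have hskip : ∀ j, j ≤ G.m → ∀ e : Fin G.m, G.src e = z → lastOut (σ.na 0) z j ≤ e.val →
      j ≤ e.val := by
    intro j hj e he hle
    by_contra hlt
    have := lt_lastOut (S := σ.na 0) (u := z) (not_le.1 hlt) (by rw [hN.src, he])
    omega
  have hcl : ∀ j, j ≤ G.m → cnt (lastOut (σ.na 0) z j) = cnt j := by
    intro j hj
    simp only [hcnt]
    congr 1
    ext e
    simp only [Finset.mem_filter, Finset.mem_univ, true_and, and_congr_right_iff]
    exact fun he => ⟨fun h => lt_of_lt_of_le h (lastOut_le _ _ _), fun h => by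
      by_contra hh; have := hskip j hj e he (by omega); omega⟩
  refine WP.loop (fun t' τ => τ.nv 6 ≤ G.m ∧ (∀ e, τ.nv 6 = e + 1 → σ.na 0 e = z) ∧
    ∃ t₁, I (τ.nv 6) t₁ τ ∧ t₁ + 10 * cnt (τ.nv 6) + 3 ≤ t') ?_ ?_
  · simp only [NExp.eval, NExp.size, hz, hA.head, State.setN_nv, if_true]
    refine ⟨lastOut_le _ _ _, fun e he => apply_lastOut he, t₀, ?_, ?_⟩
    · exact hmono G.m _ _ _ (lastOut_le _ _ _) (hskip _ le_rfl) (hset _ _ _ _ h0).1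
    · rw [hcl _ le_rfl]
      have : cnt G.m ≤ (Finset.univ.filter fun e => G.src e = z).card :=
        Finset.card_le_card fun e => by simp +contextual
      omega
  · rintro t' τ hf ⟨hm, hsrc, t₁, hI, ht₁⟩
    simp only [BExp.size, NExp.size, BExp.eval, NExp.eval]
    refine ⟨by omega, fun h1 => ?_, fun h1 => ?_⟩
    · obtain ⟨j, hj⟩ : ∃ j, τ.nv 6 = j + 1 := ⟨τ.nv 6 - 1, by omega⟩
      rw [hj] at hm hI ht₁
      obtain ⟨e, rfl⟩ : ∃ e : Fin G.m, e.val = j := ⟨⟨j, hm⟩, rfl⟩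
      have hez : G.src e = z := Fin.ext (by rw [← hN.src]; exact hsrc _ hj)
      have hce : cnt (e + 1) = cnt e + 1 := card_filter_lt_succ hez
      rw [hce] at ht₁
      refine WP.seq (WP.setNat (by simp [NExp.size]; omega) ?_)
      simp only [NExp.eval, NExp.size, hj, Nat.add_sub_cancel]
      have hfσ := hfr _ hf
      have hf7 : (Prog.forOut P).Frame σ (τ.setN 7 e) := by
        refine ⟨fun x hx => ?_, hfσ.na, hfσ.rv, hfσ.ra⟩
        rw [← hfσ.nv x hx]
        simp only [Prog.forOut, Prog.wnv, Bool.or_eq_false_iff, beq_eq_false_iff_ne] at hx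
        simp [hx]
      obtain ⟨d, hd⟩ : ∃ d, t' - (1 + 1 + 1) - (1 + 1 + 1 + 1) = t₁ + d := ⟨t' - 7 - t₁, by omega⟩
      rw [hd]
      refine WP.seq (((hbody e t₁ _ hez (by simp) hf7 (hset _ _ _ _ hI).2).add_fuel d).conseq ?_)
      rintro t2 τ2 hf2 ⟨hd2, hI2⟩
      have h4 : τ2.na 4 e = lastOut (σ.na 0) z e := by
        have h40 : τ2.na 4 = σ.na 4 := by
          rw [hf2.na 4 hP4]; exact hf.na 4 (by simp [Prog.wna, hP4])
        rw [h40, hA.next, hez]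
      have h7 : τ2.nv 7 = e := by rw [hf2.nv 7 hP7]; simp
      refine WP.setNat (by simp [NExp.size]; omega) ?_
      simp only [NExp.eval, NExp.size, State.setN_nv, if_true, h7, h4]
      refine ⟨(lastOut_le _ _ _).trans e.2.le, fun e' he' => apply_lastOut he', t2 - d, ?_, ?_⟩
      · exact hmono _ _ _ _ (lastOut_le _ _ _) (hskip _ e.2.le) (hset _ _ _ _ hI2).1
      · rw [hcl _ e.2.le]; omega
    · have h6 : τ.nv 6 = 0 := by omega
      rw [h6] at hI
      exact hQ t₁ _ τ (hfr _ hf) (by omega) hI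

end

/-- The labels `y` arise from `y₀` by relaxing edges of cost `0`. -/
def Relaxed (G : WGraph) (c : Fin G.m → ℕ) (y₀ y : ℕ → ℝ) : Prop :=
  (∀ v : Fin G.n, y v ≤ y₀ v) ∧
    ∀ Q : Fin G.n → ℝ → Prop, (∀ e y, c e = 0 → Q (G.src e) y → Q (G.tgt e) (y + G.r e)) →
      (∀ v, Q v (y₀ v)) → ∀ v, Q v (y v)

theorem Relaxed.refl (G : WGraph) (c : Fin G.m → ℕ) (y : ℕ → ℝ) : Relaxed G c y y :=
  ⟨fun _ => le_rfl, fun _ _ h => h⟩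

theorem Relaxed.step {G : WGraph} {c : Fin G.m → ℕ} {y₀ y : ℕ → ℝ} (h : Relaxed G c y₀ y)
    {e : Fin G.m} (he : c e = 0) (hle : y (G.src e) + G.r e ≤ y (G.tgt e)) :
    Relaxed G c y₀ (Function.update y (G.tgt e) (y (G.src e) + G.r e)) := by
  refine ⟨fun v => ?_, fun Q hQ h0 v => ?_⟩
  · rw [Function.update_apply]
    split_ifs with hv
    · obtain rfl := Fin.ext hv
      exact hle.trans (h.1 _)
    · exact h.1 v
  · rw [Function.update_apply]
    split_ifs with hv
    · obtain rfl := Fin.ext hv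
      exact hQ e _ he (h.2 Q hQ h0 _)
    · exact h.2 Q hQ h0 v

/-! ### Closing labels in acyclic graphs -/

/-- In an acyclic graph, every non-empty set of vertices contains a vertex without incoming edges
from the set. -/
theorem WGraph.Acyclic.exists_source {G : WGraph} (h : G.Acyclic) {U : Fin G.n → Prop}
    {v : Fin G.n} (hv : U v) : ∃ v, U v ∧ ∀ e, G.tgt e = v → ¬ U (G.src e) := by
  by_contra! hc
  have : Nonempty (Fin G.m) := ⟨(hc v hv).choose⟩
  choose! f hf hf' using hc
  set g : Fin G.n → Fin G.n := fun v => G.src (f v) with hg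
  have hU : ∀ k, U (g^[k] v) := by
    intro k
    induction k with
    | zero => exact hv
    | succ k ih => rw [Function.iterate_succ_apply']; exact hf' _ ih
  have hw : ∀ d k, ∃ p, G.IsWalk (g^[k + d] v) p (g^[k] v) ∧ p.length = d := by
    intro d k
    induction d with
    | zero => exact ⟨[], rfl, rfl⟩
    | succ d ih =>
      obtain ⟨p, hp, hl⟩ := ih
      refine ⟨f (g^[k + d] v) :: p, ⟨?_, ?_⟩, by simp [hl]⟩
      · rw [← add_assoc, Function.iterate_succ_apply']
      · rw [hf _ (hU _)]; exact hp
  obtain ⟨i, j, hij, he⟩ := Finite.exists_ne_map_eq_of_infinite fun k => g^[k] v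
  wlog hlt : i < j generalizing i j
  · exact this j i hij.symm he.symm (by omega)
  obtain ⟨d, rfl⟩ := Nat.exists_eq_add_of_lt hlt
  obtain ⟨p, hp, hl⟩ := hw (d + 1) i
  have he' : g^[i] v = g^[i + (d + 1)] v := he
  rw [← he'] at hp
  simp [h _ _ hp] at hl

/-- Relaxes the edge in the natural variable `7` from the vertex in the natural variable `5`, and
pushes its target onto the stack if this was the last edge into the target. -/
def dagRelax : Prog :=
  .setNat 9 (.get 1 (.var 7)) ;;
  .putNat 6 (.var 9) (.sub (.get 6 (.var 9)) (.const 1)) ;;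
  .cond (.natLe (.get 6 (.var 9)) (.const 0))
    (.putNat 7 (.var 8) (.var 9) ;; .setNat 8 (.add (.var 8) (.const 1))) .skip ;;
  .cond (.and (.natLe (.get 2 (.var 7)) (.const 0))
      (.realLe (.add (.get 3 (.var 5)) (.get 1 (.var 7))) (.get 3 (.var 9))))
    (.putReal 3 (.var 9) (.add (.get 3 (.var 5)) (.get 1 (.var 7)))) .skip

/-- Closes labels in an acyclic graph: scans the vertices in a topological order.  The natural array
`6` counts the incoming edges from vertices that have not been scanned, and the natural array `7`
is a stack, of the size in the natural variable `8`, of the unscanned vertices for which this count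
is `0`. -/
def dagClose : Prog :=
  buildAdj ;;
  .forN 4 0 (.putNat 6 (.var 4) (.const 0)) ;;
  .forN 4 1 (.putNat 6 (.get 1 (.var 4)) (.add (.get 6 (.get 1 (.var 4))) (.const 1))) ;;
  .setNat 8 (.const 0) ;;
  .forN 4 0 (.cond (.natLe (.get 6 (.var 4)) (.const 0))
    (.putNat 7 (.var 8) (.var 4) ;; .setNat 8 (.add (.var 8) (.const 1))) .skip) ;;
  .loop (.natLe (.const 1) (.var 8))
    (.setNat 8 (.sub (.var 8) (.const 1)) ;; .setNat 5 (.get 7 (.var 8)) ;; dagRelax.forOut)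

/-- The first `k` entries of `a` are the elements of `S`, without repetitions. -/
structure Lists {n : ℕ} (a : ℕ → ℕ) (k : ℕ) (S : Fin n → Prop) : Prop where
  mem : ∀ j < k, ∃ v : Fin n, a j = v ∧ S v
  inj : ∀ i < k, ∀ j < k, a i = a j → i = j
  all : ∀ v, S v → ∃ j < k, a j = v

theorem Lists.congr {n : ℕ} {a : ℕ → ℕ} {k : ℕ} {S S' : Fin n → Prop} (h : Lists a k S)
    (hS : ∀ v, S v ↔ S' v) : Lists a k S' := by
  obtain rfl : S = S' := funext fun v => propext (hS v)
  exact h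

theorem Lists.push {n : ℕ} {a : ℕ → ℕ} {k : ℕ} {S S' : Fin n → Prop} (h : Lists a k S)
    {v : Fin n} (hv : ¬ S v) (hS : ∀ w, S' w ↔ S w ∨ w = v) :
    Lists (Function.update a k v) (k + 1) S' := by
  have hne : ∀ j < k, a j ≠ v := by
    intro j hj he
    obtain ⟨w, hw, hw'⟩ := h.mem j hj
    exact hv (by rwa [Fin.ext (he.symm.trans hw)])
  refine ⟨fun j hj => ?_, fun i hi j hj hij => ?_, fun w hw => ?_⟩
  · rw [Function.update_apply]
    split_ifs with hjk
    · exact ⟨v, rfl, (hS v).2 (Or.inr rfl)⟩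
    · obtain ⟨w, hw, hw'⟩ := h.mem j (by omega)
      exact ⟨w, hw, (hS w).2 (Or.inl hw')⟩
  · rw [Function.update_apply, Function.update_apply] at hij
    split_ifs at hij with h1 h2 h2
    · omega
    · exact absurd hij.symm (hne j (by omega))
    · exact absurd hij (hne i (by omega))
    · exact h.inj i (by omega) j (by omega) hij
  · rcases (hS w).1 hw with hw | rfl
    · obtain ⟨j, hj, he⟩ := h.all w hw
      exact ⟨j, by omega, by rw [Function.update_of_ne (by omega), he]⟩
    · exact ⟨k, by omega, by simp⟩

theorem Lists.pop {n : ℕ} {a : ℕ → ℕ} {k : ℕ} {S : Fin n → Prop} (h : Lists a (k + 1) S) :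
    ∃ v : Fin n, a k = v ∧ S v ∧ Lists a k (fun w => S w ∧ w ≠ v) := by
  obtain ⟨v, hv, hS⟩ := h.mem k (by omega)
  refine ⟨v, hv, hS, fun j hj => ?_, fun i hi j hj => h.inj i (by omega) j (by omega), ?_⟩
  · obtain ⟨w, hw, hw'⟩ := h.mem j (by omega)
    refine ⟨w, hw, hw', ?_⟩
    rintro rfl
    have := h.inj j (by omega) k (by omega) (by rw [hw, hv])
    omega
  · rintro w ⟨hw, hwv⟩
    obtain ⟨j, hj, he⟩ := h.all w hw
    refine ⟨j, lt_of_le_of_ne (by omega) ?_, he⟩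
    rintro rfl
    exact hwv (Fin.ext (by rw [← he, hv]))

theorem Lists.erase {n : ℕ} {a : ℕ → ℕ} {k : ℕ} {S : Fin n → Prop} (h : Lists a k S) {i : ℕ}
    (hi : i < k) : Lists (Function.update a i (a (k - 1))) (k - 1) fun w => S w ∧ a i ≠ w := by
  refine ⟨fun j hj => ?_, fun j hj l hl hjl => ?_, fun w hw => ?_⟩
  · rw [Function.update_apply]
    split_ifs with hji
    · obtain ⟨w, hw, hS⟩ := h.mem (k - 1) (by omega)
      refine ⟨w, hw, hS, fun he => ?_⟩
      have := h.inj _ hi (k - 1) (by omega) (by rw [he, hw])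
      omega
    · obtain ⟨w, hw, hS⟩ := h.mem j (by omega)
      exact ⟨w, hw, hS, fun he => hji (h.inj j (by omega) _ hi (by rw [he, hw]))⟩
  · rw [Function.update_apply, Function.update_apply] at hjl
    split_ifs at hjl with h1 h2 h2
    · omega
    · have := h.inj _ (by omega) _ (by omega) hjl; omega
    · have := h.inj _ (by omega) _ (by omega) hjl; omega
    · exact h.inj j (by omega) l (by omega) hjl
  · obtain ⟨j, hj, he⟩ := h.all w hw.1
    have hji : j ≠ i := by rintro rfl; exact hw.2 he
    by_cases hjk : j = k - 1
    · subst hjk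
      exact ⟨i, by omega, by simpa using he⟩
    · exact ⟨j, by omega, by rw [Function.update_of_ne hji, he]⟩

section

variable {G : WGraph} {c : Fin G.m → ℕ} {σ : State} {t : ℕ}

/-- The state of the topological scan: `D` is the set of the scanned vertices, but only the edges
from `z` of index at least `j` have been dealt with. -/
structure DagInv (G : WGraph) (c : Fin G.m → ℕ) (y₀ : ℕ → ℝ) (D : Finset (Fin G.n)) (z : Fin G.n)
    (j : ℕ) (τ : State) : Prop where
  indeg : ∀ v : Fin G.n, τ.na 6 v = (Finset.univ.filter fun e => G.tgt e = v ∧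
    (G.src e ∉ D ∨ (G.src e = z ∧ e.val < j))).card
  stack : Lists (τ.na 7) (τ.nv 8) fun v : Fin G.n => v ∉ D ∧ τ.na 6 v = 0
  scanned : ∀ v ∈ D, τ.na 6 v = 0
  closed : ∀ e, c e = 0 → G.src e ∈ D → (G.src e = z → j ≤ e) →
    τ.ra 3 (G.tgt e) ≤ τ.ra 3 (G.src e) + G.r e
  relaxed : Relaxed G c y₀ (τ.ra 3)

theorem dagRelax_spec {y₀ : ℕ → ℝ} {D : Finset (Fin G.n)} {e : Fin G.m}
    (hN : HoldsNet G c σ) (he : G.src e ∈ D) (h5 : σ.nv 5 = G.src e) (h7 : σ.nv 7 = e)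
    (h : DagInv G c y₀ D (G.src e) (e + 1) σ) (ht : 50 ≤ t) :
    WP dagRelax (fun t' τ => t ≤ t' + 50 ∧ DagInv G c y₀ D (G.src e) e τ) t σ := by
  set v := G.tgt e with hv
  -- the edge `e` is the only one that is counted for index `e + 1` and not for index `e`
  have hcard : ∀ w : Fin G.n, σ.na 6 w = (Finset.univ.filter fun e' => G.tgt e' = w ∧
      (G.src e' ∉ D ∨ (G.src e' = G.src e ∧ e'.val < e))).card + if w = v then 1 else 0 := by
    intro w
    rw [h.indeg w]
    split_ifs with hw
    · rw [← Finset.card_insert_of_notMem (a := e) (by simp [he])]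
      congr 1
      ext e'
      simp only [Finset.mem_filter, Finset.mem_univ, true_and, Finset.mem_insert]
      constructor
      · rintro ⟨h1, h2 | ⟨h2, h3⟩⟩
        · exact Or.inr ⟨h1, Or.inl h2⟩
        · by_cases hee : e' = e
          · exact Or.inl hee
          · exact Or.inr ⟨h1, Or.inr ⟨h2, by have := Fin.val_ne_of_ne hee; omega⟩⟩
      · rintro (rfl | ⟨h1, h2 | ⟨h2, h3⟩⟩)
        · exact ⟨hw.symm ▸ hv.symm, Or.inr ⟨rfl, by omega⟩⟩
        · exact ⟨h1, Or.inl h2⟩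
        · exact ⟨h1, Or.inr ⟨h2, by omega⟩⟩
    · rw [add_zero]
      congr 1
      ext e'
      simp only [Finset.mem_filter, Finset.mem_univ, true_and, and_congr_right_iff]
      intro h1
      have hee : e'.val ≠ e := fun hh => hw (by rw [← h1, Fin.ext hh, hv])
      exact or_congr_right (and_congr_right fun _ => by omega)
  have hvD : v ∉ D := fun hD => by
    have := hcard v
    rw [h.scanned v hD, if_pos rfl] at this
    omega
  have hind : ∀ w : Fin G.n, Function.update (σ.na 6) v (σ.na 6 v - 1) w =
      (Finset.univ.filter fun e' => G.tgt e' = w ∧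
      (G.src e' ∉ D ∨ (G.src e' = G.src e ∧ e'.val < e))).card := by
    intro w
    rw [Function.update_apply]
    split_ifs with hw
    · obtain rfl := Fin.ext hw
      have := hcard v
      rw [if_pos rfl] at this
      omega
    · rw [hcard w, if_neg fun hh => hw (congrArg Fin.val hh), add_zero]
  have hpos : 0 < σ.na 6 v := by have := hcard v; rw [if_pos rfl] at this; omega
  have hst : ∀ w : Fin G.n, (w ∉ D ∧ Function.update (σ.na 6) v (σ.na 6 v - 1) w = 0) ↔
      (w ∉ D ∧ σ.na 6 w = 0) ∨ (w = v ∧ σ.na 6 v - 1 = 0) := by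
    intro w
    rw [Function.update_apply]
    by_cases hw : w = v
    · subst hw; simp [hvD, hpos.ne']
    · have hw' : (w : ℕ) ≠ v := fun hh => hw (Fin.ext hh)
      simp [hw, hw']
  have hsc : ∀ w ∈ D, Function.update (σ.na 6) v (σ.na 6 v - 1) w = 0 := by
    intro w hw
    rw [Function.update_of_ne fun hh : (w : ℕ) = v => hvD ((Fin.ext hh : w = v) ▸ hw)]
    exact h.scanned w hw
  have hl1 : c e = 0 → σ.ra 3 (G.src e) + G.r e ≤ σ.ra 3 v →
      (∀ e', c e' = 0 → G.src e' ∈ D → (G.src e' = G.src e → e ≤ e') →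
        Function.update (σ.ra 3) v (σ.ra 3 (G.src e) + G.r e) (G.tgt e') ≤
        Function.update (σ.ra 3) v (σ.ra 3 (G.src e) + G.r e) (G.src e') + G.r e') := by
    intro hc hle e' hc' hD' he'
    have hne : (G.src e' : ℕ) ≠ v := fun hh => hvD (Fin.ext hh ▸ hD')
    rw [Function.update_of_ne hne, Function.update_apply]
    by_cases hee : e' = e
    · subst hee; simp [hv]
    have := h.closed e' hc' hD' fun hh => by
      have := he' hh; have := Fin.val_ne_of_ne hee; have : e.val ≤ e' := he' hh; omega
    split_ifs with hw
    · rw [hw] at this; exact hle.trans this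
    · exact this
  have hl2 : ¬ (c e = 0 ∧ σ.ra 3 (G.src e) + G.r e ≤ σ.ra 3 v) →
      (∀ e', c e' = 0 → G.src e' ∈ D → (G.src e' = G.src e → e ≤ e') →
        σ.ra 3 (G.tgt e') ≤ σ.ra 3 (G.src e') + G.r e') := by
    intro hn e' hc' hD' he'
    by_cases hee : e' = e
    · subst hee
      exact (not_le.1 fun hle => hn ⟨hc', hle⟩).le
    · exact h.closed e' hc' hD' fun hh => by
        have := Fin.val_ne_of_ne hee; have : e.val ≤ e' := he' hh; omega
  simp only [dagRelax, WP.cond_iff, WP.seq_iff, WP.setNat_iff, WP.putNat_iff, WP.putReal_iff,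
    WP.skip_iff, BExp.eval, BExp.size, NExp.eval, NExp.size, RExp.eval, RExp.size, State.setN_nv,
    State.setN_na, State.setN_ra, State.putN_nv, State.putN_na, State.putN_ra, h7, h5, hN.tgt]
  norm_num only
  simp only [if_true, if_false, Function.update_self, hN.costs, hN.r, Nat.le_zero, ← hv]
  refine ⟨by omega, by omega, by omega, fun h0 => ⟨by omega, by omega, by omega, fun h1 =>
    ⟨by omega, by omega, ?_⟩, fun h1 => ⟨by omega, by omega, ?_⟩⟩, fun h0 => ⟨by omega, by omega,
      fun h1 => ⟨by omega, by omega, ?_⟩, fun h1 => ⟨by omega, by omega, ?_⟩⟩⟩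
  · refine ⟨by simpa using hind, ?_, by simpa using hsc, by simpa using hl1 h1.1 h1.2,
      by simpa using h.relaxed.step h1.1 h1.2⟩
    simpa using h.stack.push (v := v) (by simp [hpos.ne']) fun w => (hst w).trans (by simp [h0])
  · refine ⟨by simpa using hind, ?_, by simpa using hsc, by simpa using hl2 (by tauto),
      by simpa using h.relaxed⟩
    simpa using h.stack.push (v := v) (by simp [hpos.ne']) fun w => (hst w).trans (by simp [h0])
  · refine ⟨by simpa using hind, ?_, by simpa using hsc, by simpa using hl1 h1.1 h1.2,
      by simpa using h.relaxed.step h1.1 h1.2⟩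
    simpa using h.stack.congr fun w => ((hst w).trans (by simp [h0])).symm
  · refine ⟨by simpa using hind, ?_, by simpa using hsc, by simpa using hl2 (by tauto),
      by simpa using h.relaxed⟩
    simpa using h.stack.congr fun w => ((hst w).trans (by simp [h0])).symm

/-- Declaring the vertex `z` without unscanned predecessors scanned, before its edges have been
dealt with. -/
theorem DagInv.scan {y₀ : ℕ → ℝ} {D : Finset (Fin G.n)} {z : Fin G.n} {k : ℕ}
    (h : DagInv G c y₀ D z 0 σ) (hz : z ∉ D) (h0 : σ.na 6 z = 0)
    (hst : Lists (σ.na 7) k fun v : Fin G.n => v ∉ D ∧ σ.na 6 v = 0 ∧ v ≠ z) :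
    DagInv G c y₀ (insert z D) z G.m ((σ.setN 8 k).setN 5 z) := by
  refine ⟨fun v => ?_, ?_, ?_, ?_, h.relaxed⟩
  · simp only [State.setN_na, h.indeg v]
    congr 1
    ext e
    simp only [Finset.mem_filter, Finset.mem_univ, true_and, and_congr_right_iff]
    intro _
    by_cases he : G.src e = z
    · simp [he, hz]
    · simp [he]
  · refine Lists.congr (S := fun v : Fin G.n => v ∉ D ∧ σ.na 6 v = 0 ∧ v ≠ z) ?_ fun v => ?_
    · simpa using hst
    · simp only [State.setN_na, Finset.mem_insert]
      tauto
  · simpa [h0] using h.scanned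
  · intro e hc he hz'
    rcases Finset.mem_insert.1 he with he | he
    · exact absurd (hz' he) (by have := e.2; omega)
    · exact h.closed e hc he fun _ => Nat.zero_le _

theorem dagClose_closes (hG : G.Acyclic) :
    Closes dagClose G c (200 * G.m + 200 * G.n + 200) := by
  intro t σ hN _ ht
  refine WP.seq ((buildAdj_spec hN (by omega)).conseq fun t1 τ1 hf1 ⟨ht1, hA⟩ => ?_)
  have hN1 := hN.frame hf1 rfl
  have hl1 : τ1.ra 3 = σ.ra 3 := hf1.ra 3 rfl
  refine WP.seq (WP.forN G.n 3 (fun j τ => ∀ u < j, τ.na 6 u = 0)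
    (by simp [hN1.n]) (by simp) rfl rfl (by omega) (by simp) ?_ ?_)
  · intro j t τ hj hx hf hc hI
    refine WP.putNat (by simpa [NExp.size] using hc) ⟨by simp [NExp.size]; omega, ?_⟩
    intro u hu
    simp only [NExp.eval, hx, State.setN_na, State.putN_na, if_true, Function.update_apply]
    split_ifs with hvj
    · rfl
    · exact hI u (by omega)
  intro t2 τ2 hf2 ht2 hI2
  have hN2 := hN1.frame hf2 rfl
  refine WP.seq (WP.forN G.m 8 (fun j τ => ∀ v : Fin G.n, τ.na 6 v =
    (Finset.univ.filter fun e => G.tgt e = v ∧ e.val < j).card)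
    (by simp [hN2.m]) (by simp) rfl rfl (by omega) (by simpa using fun v : Fin G.n => hI2 v v.2)
    ?_ ?_)
  · intro j t τ hj hx hf hc hI
    have hNτ := hN2.frame hf rfl
    obtain ⟨e, rfl⟩ : ∃ e : Fin G.m, e.val = j := ⟨⟨j, hj⟩, rfl⟩
    refine WP.putNat (by simpa [NExp.size] using hc) ⟨by simp [NExp.size]; omega, ?_⟩
    intro v
    simp only [NExp.eval, hx, State.setN_na, State.putN_na, if_true, Function.update_apply, hNτ.tgt,
      hI]
    split_ifs with hv
    · obtain rfl := Fin.ext hv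
      rw [← Finset.card_insert_of_notMem (a := e) (by simp)]
      congr 1
      ext e'
      simp only [Finset.mem_filter, Finset.mem_univ, true_and, Finset.mem_insert, Fin.ext_iff]
      constructor
      · rintro (h | ⟨h1, h2⟩)
        · exact ⟨by rw [Fin.ext h], by omega⟩
        · exact ⟨h1, by omega⟩
      · rintro ⟨h1, h2⟩
        rcases Nat.lt_succ_iff_lt_or_eq.1 h2 with h | h
        · exact Or.inr ⟨h1, h⟩
        · exact Or.inl h
    · congr 1
      ext e'
      simp only [Finset.mem_filter, Finset.mem_univ, true_and, and_congr_right_iff]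
      intro h1
      have hee : e'.val ≠ e := fun hh => hv (by rw [← h1, Fin.ext hh])
      omega
  intro t3 τ3 hf3 ht3 hI3
  have hN3 := hN2.frame hf3 rfl
  refine WP.seq (WP.setNat (by simp [NExp.size]; omega) ?_)
  simp only [NExp.eval, NExp.size]
  refine WP.seq (WP.forN G.n 12 (fun j τ => Lists (τ.na 7) (τ.nv 8)
    fun v : Fin G.n => v.val < j ∧ τ3.na 6 v = 0)
    (by simp [hN3.n]) (by simp) rfl rfl (by omega)
    ⟨by simp, by simp, by simp⟩ ?_ ?_)
  · intro j t τ hj hx hf hc hI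
    have h6 : τ.na 6 = τ3.na 6 := hf.na 6 rfl
    have hS : ∀ w : Fin G.n, (w.val < j + 1 ∧ τ3.na 6 w = 0) ↔
        (w.val < j ∧ τ3.na 6 w = 0) ∨ (w = ⟨j, hj⟩ ∧ τ3.na 6 j = 0) := by
      intro w
      by_cases hw : w = ⟨j, hj⟩
      · subst hw; simp
      · have : w.val ≠ j := fun hh => hw (Fin.ext hh)
        simp only [hw, false_and, or_false]
        exact and_congr_left fun _ => by omega
    simp only [WP.cond_iff, WP.seq_iff, WP.setNat_iff, WP.putNat_iff, WP.skip_iff, BExp.eval,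
      BExp.size, NExp.eval, NExp.size, State.putN_nv, hx, h6, Nat.le_zero]
    refine ⟨by omega, fun h0 => ⟨by omega, by omega, by omega, ?_⟩,
      fun h0 => ⟨by omega, by omega, ?_⟩⟩
    · simpa using hI.push (v := ⟨j, hj⟩) (by simp) fun w => (hS w).trans (by simp [h0])
    · simpa using hI.congr fun w => ((hS w).trans (by simp [h0])).symm
  intro t4 τ4 hf4 ht4 hI4
  have hN4 : HoldsNet G c τ4 := by
    refine HoldsNet.frame (σ := τ3.setN 8 0) ?_ hf4 rfl
    exact ⟨hN3.n, hN3.m, hN3.src, hN3.tgt, hN3.costs, hN3.r⟩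
  have h46 : τ4.na 6 = τ3.na 6 := hf4.na 6 rfl
  have hl4 : τ4.ra 3 = σ.ra 3 := by
    rw [hf4.ra 3 rfl]; exact ((hf3.ra 3 rfl).trans (hf2.ra 3 rfl)).trans hl1
  have hA4 : HoldsAdj G τ4 := by
    have h0 : τ4.na 0 = τ1.na 0 := by
      rw [hf4.na 0 rfl]; exact (hf3.na 0 rfl).trans (hf2.na 0 rfl)
    have h3 : τ4.na 3 = τ1.na 3 := by
      rw [hf4.na 3 rfl]; exact (hf3.na 3 rfl).trans (hf2.na 3 rfl)
    have h4 : τ4.na 4 = τ1.na 4 := by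
      rw [hf4.na 4 rfl]; exact (hf3.na 4 rfl).trans (hf2.na 4 rfl)
    exact ⟨by rw [h0, h3]; exact hA.head, by rw [h0, h4]; exact hA.next⟩
  refine WP.loop (fun t' τ => ∃ D : Finset (Fin G.n), (∀ z, DagInv G c (σ.ra 3) D z 0 τ) ∧
    Lists (τ.na 7) (τ.nv 8) (fun v : Fin G.n => v ∉ D ∧ τ.na 6 v = 0) ∧
    20 * Dᶜ.card + 60 * (Finset.univ.filter fun e => G.src e ∉ D).card + 3 ≤ t' ∧
    t + 20 * Dᶜ.card + 60 * (Finset.univ.filter fun e => G.src e ∉ D).card ≤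
      t' + (200 * G.m + 200 * G.n + 190)) ?_ ?_
  · refine ⟨∅, fun z => ⟨?_, ?_, by simp, by simp, by rw [hl4]; exact Relaxed.refl _ _ _⟩,
      ?_, ?_, ?_⟩
    · simp [h46, hI3]
    · simpa [h46] using hI4
    · simpa [h46] using hI4
    · simp; omega
    · simp; omega
  · rintro t' τ hf ⟨D, hD, hL, ht', htt⟩
    have hNτ := hN4.frame hf rfl
    simp only [BExp.size, NExp.size, BExp.eval, NExp.eval]
    refine ⟨by omega, fun h1 => ?_, fun h1 => ?_⟩
    · obtain ⟨k, hk⟩ : ∃ k, τ.nv 8 = k + 1 := ⟨τ.nv 8 - 1, by omega⟩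
      obtain ⟨z, hz, ⟨hzD, hz0⟩, hst⟩ :=
        Lists.pop (k := k) (hk ▸ hL)
      have hDz := hD z
      have hc1 : Dᶜ.card = (insert z D)ᶜ.card + 1 := by
        rw [Finset.card_compl, Finset.card_compl, Finset.card_insert_of_notMem hzD]
        have := Finset.card_le_univ (insert z D)
        rw [Finset.card_insert_of_notMem hzD] at this
        omega
      have hc2 : (Finset.univ.filter fun e => G.src e ∉ D).card =
          (Finset.univ.filter fun e => G.src e ∉ insert z D).card +
          (Finset.univ.filter fun e => G.src e = z).card := by
        rw [← Finset.card_union_of_disjoint]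
        · congr 1
          ext e
          simp only [Finset.mem_filter, Finset.mem_univ, true_and, Finset.mem_union,
            Finset.mem_insert]
          by_cases he : G.src e = z
          · simp [he, hzD]
          · simp [he]
        · rw [Finset.disjoint_filter]
          intro e _ h1 h2
          exact h1 (by simp [h2])
      refine WP.seq (WP.setNat (by simp [NExp.size]; omega) (WP.seq (WP.setNat
        (by simp [NExp.size]; omega) ?_)))
      simp only [NExp.size, NExp.eval, State.setN_nv, State.setN_na, hk, if_true,
        Nat.add_sub_cancel, hz]
      have hDz' := DagInv.scan hDz hzD hz0 (hst.congr fun w => and_assoc)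
      refine WP.forOut (c := c) z (fun j t₁ τ' => DagInv G c (σ.ra 3) (insert z D) z j τ' ∧
        20 * (insert z D)ᶜ.card + 60 * (Finset.univ.filter fun e => G.src e ∉ insert z D).card + 3 +
        50 * (Finset.univ.filter fun e => G.src e = z ∧ e.val < j).card ≤ t₁ ∧
        t + 20 * (insert z D)ᶜ.card + 60 * (Finset.univ.filter fun e => G.src e ∉ insert z D).card +
        50 * (Finset.univ.filter fun e => G.src e = z ∧ e.val < j).card ≤
          t₁ + (200 * G.m + 200 * G.n + 190)) (t' - 16 -
          10 * (Finset.univ.filter fun e => G.src e = z).card)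
          ?_ ?_ (by simp) rfl rfl (by omega) ?_ ?_ ?_ ?_ ?_
      · exact ⟨hNτ.n, hNτ.m, hNτ.src, hNτ.tgt, hNτ.costs, hNτ.r⟩
      · have h0 : τ.na 0 = τ4.na 0 := hf.na 0 rfl
        have h3 : τ.na 3 = τ4.na 3 := hf.na 3 rfl
        have h4 : τ.na 4 = τ4.na 4 := hf.na 4 rfl
        exact ⟨by simpa [h0, h3] using hA4.head, by simpa [h0, h4] using hA4.next⟩
      · refine ⟨hDz', ?_, ?_⟩ <;> simp only [Fin.is_lt, and_true] <;> omega
      · rintro j j' t τ' hj he ⟨h1, h2, h3⟩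
        have hiff : ∀ e, (G.src e = z ∧ e.val < j') ↔ (G.src e = z ∧ e.val < j) := fun e =>
          and_congr_right fun h => ⟨fun h' => by omega, fun h' => by
            by_contra hh; have := he e h (by omega); omega⟩
        refine ⟨⟨?_, h1.stack, h1.scanned, ?_, h1.relaxed⟩, ?_, ?_⟩
        · simpa only [hiff] using h1.indeg
        · exact fun e hc hD hz => h1.closed e hc hD fun hh => he e hh (hz hh)
        · simpa only [hiff] using h2
        · simpa only [hiff] using h3
      · rintro j t τ' v ⟨h1, h2, h3⟩
        exact ⟨⟨⟨h1.indeg, h1.stack, h1.scanned, h1.closed, h1.relaxed⟩, h2, h3⟩,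
          ⟨⟨h1.indeg, h1.stack, h1.scanned, h1.closed, h1.relaxed⟩, h2, h3⟩⟩
      · rintro e t₁ τ' rfl h7 hfr ⟨h1, h2, h3⟩
        have hce : (Finset.univ.filter fun e' => G.src e' = G.src e ∧ e'.val < e + 1).card =
            (Finset.univ.filter fun e' => G.src e' = G.src e ∧ e'.val < e).card + 1 :=
          card_filter_lt_succ rfl
        rw [hce] at h2 h3
        have hNτ' : HoldsNet G c τ' := by
          refine HoldsNet.frame (σ := (τ.setN 8 k).setN 5 (G.src e)) ?_ hfr rfl
          exact ⟨hNτ.n, hNτ.m, hNτ.src, hNτ.tgt, hNτ.costs, hNτ.r⟩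
        refine (dagRelax_spec hNτ' (Finset.mem_insert_self _ _) ?_ h7 h1 (by omega)).conseq ?_
        · rw [hfr.nv 5 rfl]; simp
        · rintro t₂ τ₂ hf₂ ⟨ht₂, h₂⟩
          exact ⟨h₂, by omega, by omega⟩
      · rintro t₁ t₂ τ' hfr hle ⟨h1, h2, h3⟩
        refine ⟨insert z D, fun w => ⟨?_, h1.stack, h1.scanned, ?_, h1.relaxed⟩, h1.stack, ?_, ?_⟩
        · simpa using h1.indeg
        · exact fun e hc he _ => h1.closed e hc he fun _ => Nat.zero_le _
        · omega
        · omega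
    · have hall : ∀ v, v ∈ D := by
        by_contra! hv
        obtain ⟨v, hv⟩ := hv
        obtain ⟨w, hw, hw'⟩ := hG.exists_source (U := fun v => v ∉ D) hv
        have h0 : τ.na 6 w = 0 := by
          rw [(hD w).indeg w, Finset.card_eq_zero, Finset.filter_eq_empty_iff]
          rintro e - ⟨he, he' | he'⟩
          · exact hw' e he he'
          · omega
        obtain ⟨j, hj, -⟩ := hL.all w ⟨hw, h0⟩
        omega
      by_cases hn : Nonempty (Fin G.n)
      · obtain ⟨z⟩ := hn
        exact ⟨by omega, (hD z).relaxed.1,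
          fun e he => (hD z).closed e he (hall _) fun _ => Nat.zero_le _, (hD z).relaxed.2⟩
      · exact ⟨by omega, fun v => absurd ⟨v⟩ hn, fun e => absurd ⟨G.src e⟩ hn,
          fun _ _ _ v => absurd ⟨v⟩ hn⟩

end

/-! ### Fibonacci heaps -/

/-- The pointer structure of a Fibonacci heap on the items below `n`.  The status is `0` for items
that are not in the heap, `1` for roots and `2` for children.  The children of `v` are
`ch (j * n + v)` for `j < deg v`, where `j` is the position of the child. -/
structure Heap where
  stat : ℕ → ℕ
  par : ℕ → ℕ
  pos : ℕ → ℕ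
  deg : ℕ → ℕ
  mark : ℕ → ℕ
  ch : ℕ → ℕ

/-- The heap invariant.  The item `x` may violate the heap order and the condition on degrees.  The
number `ln u` is the degree of `u` when it became a child, and `tm u` is the time when it did.  The
items `u` with `stat u = 2` lose at most one child before they are cut, and are marked if they have
lost one.  Since only items of equal degree are linked, at most `k + 1` children of an item had
degree at most `k` when they were linked; this makes the degrees logarithmic. -/
structure HeapInv' (n : ℕ) (H : Heap) (key : ℕ → ℝ) (x : ℕ) (ln tm : ℕ → ℕ) : Prop where
  stat_le : ∀ u < n, H.stat u ≤ 2
  child : ∀ u < n, H.stat u = 2 → H.par u < n ∧ H.stat (H.par u) ≠ 0 ∧ H.pos u < H.deg (H.par u) ∧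
    H.ch (H.pos u * n + H.par u) = u
  slot : ∀ v < n, H.stat v ≠ 0 → ∀ j < H.deg v, H.ch (j * n + v) < n ∧
    H.stat (H.ch (j * n + v)) = 2 ∧ H.par (H.ch (j * n + v)) = v ∧ H.pos (H.ch (j * n + v)) = j
  mark_le : ∀ u < n, H.mark u ≤ 1
  mark_eq : ∀ u < n, H.stat u ≠ 2 → H.mark u = 0
  order : ∀ u < n, H.stat u = 2 → u ≠ x → key (H.par u) ≤ key u
  ln_le : ∀ u < n, H.stat u = 2 → u ≠ x → ln u ≤ H.deg u + H.mark u
  count : ∀ v k, ((Finset.range n).filter fun u =>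
    H.stat u = 2 ∧ H.par u = v ∧ ln u ≤ k).card ≤ k + 1
  tm_lt : ∀ u < n, H.stat u = 2 → H.stat (H.par u) = 2 → tm u < tm (H.par u)

/-- The heap invariant, with a possible exception at `x`; there is no exception if `x = n`. -/
def HeapInv (n : ℕ) (H : Heap) (key : ℕ → ℝ) (x : ℕ) : Prop := ∃ ln tm, HeapInv' n H key x ln tm

/-- Cuts the item `u` from its parent; the last child of the parent takes its position. -/
def Heap.cut (n : ℕ) (H : Heap) (u : ℕ) : Heap where
  stat := Function.update H.stat u 1
  par := H.par
  pos := Function.update H.pos (H.ch ((H.deg (H.par u) - 1) * n + H.par u)) (H.pos u)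
  deg := Function.update H.deg (H.par u) (H.deg (H.par u) - 1)
  mark := Function.update H.mark u 0
  ch := Function.update H.ch (H.pos u * n + H.par u) (H.ch ((H.deg (H.par u) - 1) * n + H.par u))

/-- Marks the item `q`. -/
def Heap.setMark (H : Heap) (q : ℕ) : Heap where
  stat := H.stat
  par := H.par
  pos := H.pos
  deg := H.deg
  mark := Function.update H.mark q 1
  ch := H.ch

/-- Makes the root `y` a child of the root `u`. -/
def Heap.link (n : ℕ) (H : Heap) (y u : ℕ) : Heap where
  stat := Function.update H.stat y 2
  par := Function.update H.par y u
  pos := Function.update H.pos y (H.deg u)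
  deg := Function.update H.deg u (H.deg u + 1)
  mark := H.mark
  ch := Function.update H.ch (H.deg u * n + u) y

theorem mul_add_inj {n i j u v : ℕ} (hu : u < n) (hv : v < n) :
    i * n + u = j * n + v ↔ i = j ∧ u = v := by
  refine ⟨fun h => ?_, by rintro ⟨rfl, rfl⟩; rfl⟩
  have h1 := congrArg (· / n) h
  have h2 := congrArg (· % n) h
  have hn : 0 < n := by omega
  simp only [Nat.add_comm (_ * n), Nat.add_mul_div_right _ _ hn, Nat.add_mul_mod_self_right,
    Nat.div_eq_of_lt hu, Nat.div_eq_of_lt hv, Nat.mod_eq_of_lt hu, Nat.mod_eq_of_lt hv] at h1 h2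
  omega

variable {n : ℕ} {H : Heap} {key : ℕ → ℝ} {x : ℕ} {ln tm : ℕ → ℕ}

theorem HeapInv.congr_exception (h : HeapInv n H key x) (hx : n ≤ x ∨ H.stat x ≠ 2) (x' : ℕ) :
    HeapInv n H key x' := by
  obtain ⟨ln, tm, h⟩ := h
  have hne : ∀ u < n, H.stat u = 2 → u ≠ x := by
    rintro u hu h2 rfl
    rcases hx with hx | hx
    · omega
    · exact hx h2
  exact ⟨ln, tm, h.stat_le, h.child, h.slot, h.mark_le, h.mark_eq,
    fun u hu h2 _ => h.order u hu h2 (hne u hu h2), fun u hu h2 _ => h.ln_le u hu h2 (hne u hu h2),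
    h.count, h.tm_lt⟩

theorem HeapInv'.par_ne (h : HeapInv' n H key x ln tm) {u : ℕ} (hu : u < n) (hs : H.stat u = 2) :
    H.par u ≠ u := by
  intro he
  have := h.tm_lt u hu hs (by rw [he, hs])
  rw [he] at this
  omega

/-- Cutting `u` when its parent is marked, a root, or will be cut next. -/
theorem HeapInv'.cut (h : HeapInv' n H key x ln tm) {u : ℕ} (hu : u < n) (hs : H.stat u = 2)
    (hx : x = u ∨ x = n) : HeapInv' n (H.cut n u) key (H.par u) ln tm := by
  obtain ⟨hq, hq0, hp, hc⟩ := h.child u hu hs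
  have hqu := h.par_ne hu hs
  set q := H.par u with hqdef
  obtain ⟨d, hd⟩ : ∃ d, H.deg q = d + 1 := ⟨H.deg q - 1, by omega⟩
  obtain ⟨hw, hws, hwq, hwp⟩ := h.slot q hq hq0 d (by omega)
  set w := H.ch (d * n + q) with hwdef
  have hH : H.cut n u = ⟨Function.update H.stat u 1, H.par, Function.update H.pos w (H.pos u),
      Function.update H.deg q d, Function.update H.mark u 0,
      Function.update H.ch (H.pos u * n + q) w⟩ := by
    simp only [Heap.cut, ← hqdef, hd, Nat.add_sub_cancel, ← hwdef]
  rw [hH]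
  -- two children of `q` at the same position are equal
  have hpos : ∀ v < n, H.stat v = 2 → H.par v = q → H.pos v = H.pos u → v = u := by
    intro v hv hvs hvq hvp
    have := (h.child v hv hvs).2.2.2
    rw [hvq, hvp, hc] at this
    exact this.symm
  have hposd : ∀ v < n, H.stat v = 2 → H.par v = q → H.pos v = d → v = w := by
    intro v hv hvs hvq hvp
    have := (h.child v hv hvs).2.2.2
    rw [hvq, hvp] at this
    exact this.symm
  refine ⟨fun v hv => ?_, fun v hv h2 => ?_, fun v hv h2 j hj => ?_, fun v hv => ?_,
    fun v hv h2 => ?_, fun v hv h2 hvx => ?_, fun v hv h2 hvx => ?_, fun v k => ?_,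
    fun v hv h2 h3 => ?_⟩
  · simp only [Function.update_apply]; split_ifs
    · omega
    · exact h.stat_le v hv
  · simp only [Function.update_apply] at h2
    have hvu : v ≠ u := by rintro rfl; simp at h2
    rw [if_neg hvu] at h2
    obtain ⟨a1, a2, a3, a4⟩ := h.child v hv h2
    have hst : Function.update H.stat u 1 (H.par v) ≠ 0 := by
      rw [Function.update_apply]; split_ifs <;> simp [a2]
    refine ⟨a1, hst, ?_⟩
    simp only [Function.update_apply, mul_add_inj a1 hq]
    by_cases hvq : H.par v = q
    · simp only [hvq, if_true, and_true]
      rw [hvq] at a3 a4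
      by_cases hvw : v = w
      · subst hvw
        simp only [if_true, and_true]
        have : H.pos u ≠ d := fun hh => hvu (hposd u hu hs rfl hh).symm
        omega
      · rw [if_neg hvw, if_neg (fun hh => hvu (hpos v hv h2 hvq hh))]
        refine ⟨?_, a4⟩
        have : H.pos v ≠ d := fun hh => hvw (hposd v hv h2 hvq hh)
        omega
    · have hvw : v ≠ w := by rintro hh; rw [hh] at hvq; exact hvq hwq
      simp only [hvq, if_false, and_false, hvw]
      exact ⟨a3, a4⟩
  · have h2' : H.stat v ≠ 0 := by
      simp only [Function.update_apply] at h2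
      split_ifs at h2 with hvu
      · rw [hvu, hs]; decide
      · exact h2
    simp only [Function.update_apply, mul_add_inj hv hq] at hj ⊢
    by_cases hvq : v = q
    · subst hvq
      simp only [if_true, and_true] at hj ⊢
      by_cases hjp : j = H.pos u
      · have hwu : w ≠ u := by
          rintro hh; rw [hh] at hwp; omega
        simp only [if_pos hjp, if_true, if_neg hwu]
        exact ⟨hw, hws, hwq, hjp.symm⟩
      · obtain ⟨b1, b2, b3, b4⟩ := h.slot q hv h2' j (by omega)
        have b5 : H.ch (j * n + q) ≠ u := by rintro hh; rw [hh] at b4; exact hjp b4.symm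
        have b6 : H.ch (j * n + q) ≠ w := by rintro hh; rw [hh] at b4; omega
        simp only [if_neg hjp, if_neg b5, if_neg b6]
        exact ⟨b1, b2, b3, b4⟩
    · rw [if_neg hvq] at hj
      obtain ⟨b1, b2, b3, b4⟩ := h.slot v hv h2' j hj
      have b5 : H.ch (j * n + v) ≠ u := by rintro hh; rw [hh] at b3; exact hvq b3.symm
      have b6 : H.ch (j * n + v) ≠ w := by rintro hh; rw [hh] at b3; exact hvq (b3.symm.trans hwq)
      simp only [hvq, and_false, if_false, if_neg b5, if_neg b6]
      exact ⟨b1, b2, b3, b4⟩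
  · simp only [Function.update_apply]; split_ifs
    · omega
    · exact h.mark_le v hv
  · simp only [Function.update_apply] at h2 ⊢; split_ifs at h2 ⊢ with hvu
    · rfl
    · exact h.mark_eq v hv h2
  · simp only [Function.update_apply] at h2
    have hvu : v ≠ u := by rintro rfl; simp at h2
    rw [if_neg hvu] at h2
    exact h.order v hv h2 (by rcases hx with rfl | rfl <;> omega)
  · simp only [Function.update_apply] at h2 ⊢
    have hvu : v ≠ u := by rintro rfl; simp at h2
    rw [if_neg hvu] at h2
    rw [if_neg hvu, if_neg hvx]
    exact h.ln_le v hv h2 (by rcases hx with rfl | rfl <;> omega)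
  · refine (Finset.card_le_card fun y => ?_).trans (h.count v k)
    simp only [Finset.mem_filter, Function.update_apply]
    rintro ⟨h1, h2, h3⟩
    have hyu : y ≠ u := by rintro rfl; simp at h2
    exact ⟨h1, by simpa [hyu] using h2, h3⟩
  · simp only [Function.update_apply] at h2 h3
    have hvu : v ≠ u := by rintro rfl; simp at h2
    have hpu : H.par v ≠ u := by intro hh; simp [hh] at h3
    exact h.tm_lt v hv (by simpa [hvu] using h2) (by simpa [hpu] using h3)

/-- Marking the item `q` that has lost its first child. -/
theorem HeapInv'.cut_mark (h : HeapInv' n H key x ln tm) {u : ℕ} (hu : u < n) (hs : H.stat u = 2)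
    (hx : x = u ∨ x = n) (hq2 : H.stat (H.par u) = 2) (hm : H.mark (H.par u) = 0) :
    HeapInv' n ((H.cut n u).setMark (H.par u)) key n ln tm := by
  have h1 := h.cut hu hs hx
  obtain ⟨hq, hq0, hp, hc⟩ := h.child u hu hs
  have hqu := h.par_ne hu hs
  have hqx : H.par u ≠ x := by rcases hx with rfl | rfl <;> omega
  refine ⟨h1.stat_le, h1.child, h1.slot, fun v hv => ?_, fun v hv h2 => ?_, fun v hv h2 hvx => ?_,
    fun v hv h2 hvx => ?_, h1.count, h1.tm_lt⟩
  · simp only [Heap.setMark, Function.update_apply]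
    split_ifs
    · exact le_rfl
    · exact h1.mark_le v hv
  · simp only [Heap.setMark, Function.update_apply]
    split_ifs with hvq
    · subst hvq
      simp [Heap.setMark, Heap.cut, hqu, hq2] at h2
    · exact h1.mark_eq v hv h2
  · by_cases hvq : v = H.par u
    · subst hvq
      exact h.order _ hv hq2 hqx
    · exact h1.order v hv h2 hvq
  · simp only [Heap.setMark, Function.update_apply]
    by_cases hvq : v = H.par u
    · subst hvq
      have := h.ln_le _ hv hq2 hqx
      simp only [if_true, Heap.cut, Function.update_self]
      omega
    · rw [if_neg hvq]
      exact h1.ln_le v hv h2 hvq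

theorem HeapInv.decrease (h : HeapInv n H key n) {v : ℕ} {y : ℝ} (hy : y ≤ key v) :
    HeapInv n H (Function.update key v y) v := by
  obtain ⟨ln, tm, h⟩ := h
  refine ⟨ln, tm, h.stat_le, h.child, h.slot, h.mark_le, h.mark_eq, fun u hu h2 huv => ?_,
    fun u hu h2 _ => h.ln_le u hu h2 (by omega), h.count, h.tm_lt⟩
  have := h.order u hu h2 (by omega)
  rw [Function.update_of_ne huv, Function.update_apply]
  split_ifs with hp
  · rw [hp] at this; exact hy.trans this
  · exact this

theorem HeapInv'.card_children_le (h : HeapInv' n H key x ln tm) (v : ℕ) :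
    ((Finset.range n).filter fun u => H.stat u = 2 ∧ H.par u = v).card ≤ H.deg v := by
  rw [← Finset.card_range (H.deg v)]
  refine Finset.card_le_card_of_injOn H.pos (fun u hu => ?_) fun u hu w hw huw => ?_
  · simp only [Finset.coe_filter, Finset.mem_range, Set.mem_ofPred_eq] at hu
    simpa [hu.2.2] using (h.child u hu.1 hu.2.1).2.2.1
  · simp only [Finset.coe_filter, Finset.mem_range, Set.mem_ofPred_eq] at hu hw
    have h1 := (h.child u hu.1 hu.2.1).2.2.2
    have h2 := (h.child w hw.1 hw.2.1).2.2.2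
    rw [hu.2.2, huw] at h1
    rw [hw.2.2] at h2
    exact h1.symm.trans h2

theorem HeapInv.link (h : HeapInv n H key n) {y u : ℕ} (hu : u < n) (hy : y < n) (hyu : y ≠ u)
    (hus : H.stat u = 1) (hys : H.stat y = 1) (hd : H.deg y = H.deg u) (hk : key u ≤ key y) :
    HeapInv n (H.link n y u) key n := by
  obtain ⟨ln, tm, h⟩ := h
  have hpar : ∀ v < n, H.stat v = 2 → v ≠ y := by rintro v hv h2 rfl; omega
  refine ⟨Function.update ln y (H.deg u), Function.update tm y (∑ i ∈ Finset.range n, tm i + 1),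
    ⟨fun v hv => ?_, fun v hv h2 => ?_, fun v hv h2 j hj => ?_, h.mark_le,
    fun v hv h2 => ?_, fun v hv h2 hvx => ?_, fun v hv h2 hvx => ?_, fun v k => ?_,
    fun v hv h2 h3 => ?_⟩⟩
  · simp only [Heap.link, Function.update_apply]; split_ifs
    · omega
    · exact h.stat_le v hv
  · simp only [Heap.link, Function.update_apply] at h2 ⊢
    by_cases hvy : v = y
    · subst hvy
      simp [hu, hyu.symm, hus]
    · simp only [if_neg hvy] at h2 ⊢
      obtain ⟨a1, a2, a3, a4⟩ := h.child v hv h2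
      refine ⟨a1, by split_ifs <;> simp [a2], ?_, ?_⟩
      · split_ifs with hh
        · rw [hh] at a3; omega
        · exact a3
      · rw [if_neg, a4]
        rw [mul_add_inj a1 hu]
        rintro ⟨hh, hh'⟩
        rw [hh'] at a3
        omega
  · simp only [Heap.link, Function.update_apply, mul_add_inj hv hu] at h2 hj ⊢
    have h2' : H.stat v ≠ 0 := by
      split_ifs at h2 with hvy
      · rw [hvy, hys]; decide
      · exact h2
    by_cases hjv : j = H.deg u ∧ v = u
    · simp [hjv, hy]
    · have hj' : j < H.deg v := by
        split_ifs at hj with hvu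
        · rw [hvu] at hjv ⊢; omega
        · exact hj
      obtain ⟨b1, b2, b3, b4⟩ := h.slot v hv h2' j hj'
      have hne := hpar _ b1 b2
      simp only [if_neg hjv, if_neg hne]
      exact ⟨b1, b2, b3, b4⟩
  · simp only [Heap.link, Function.update_apply] at h2 ⊢
    split_ifs at h2
    · exact absurd rfl h2
    · exact h.mark_eq v hv h2
  · simp only [Heap.link, Function.update_apply] at h2 ⊢
    by_cases hvy : v = y
    · subst hvy; simpa using hk
    · simp only [if_neg hvy] at h2 ⊢
      exact h.order v hv h2 hvx
  · simp only [Heap.link, Function.update_apply] at h2 ⊢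
    by_cases hvy : v = y
    · subst hvy; simp [hyu, hd]
    · simp only [if_neg hvy] at h2 ⊢
      have := h.ln_le v hv h2 hvx
      split_ifs with hvu
      · subst hvu; omega
      · exact this
  · simp only [Heap.link]
    by_cases hvu : v = u
    · subst hvu
      by_cases hk : k < H.deg v
      · refine (Finset.card_le_card fun w => ?_).trans (h.count v k)
        simp only [Finset.mem_filter, Function.update_apply]
        rintro ⟨h1, h2, h3, h4⟩
        by_cases hwy : w = y
        · rw [if_pos hwy] at h4; omega
        · simp only [if_neg hwy] at h2 h3 h4
          exact ⟨h1, h2, h3, h4⟩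
      · have := h.card_children_le v
        refine (Finset.card_le_card (t := insert y ((Finset.range n).filter fun u =>
          H.stat u = 2 ∧ H.par u = v)) fun w => ?_).trans ((Finset.card_insert_le _ _).trans
            (by omega))
        simp only [Finset.mem_filter, Function.update_apply, Finset.mem_insert]
        rintro ⟨h1, h2, h3, h4⟩
        by_cases hwy : w = y
        · exact Or.inl hwy
        · simp only [if_neg hwy] at h2 h3 h4
          exact Or.inr ⟨h1, h2, h3⟩
    · refine (Finset.card_le_card fun w => ?_).trans (h.count v k)
      simp only [Finset.mem_filter, Function.update_apply]
      rintro ⟨h1, h2, h3, h4⟩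
      by_cases hwy : w = y
      · rw [if_pos hwy] at h3; exact absurd h3.symm hvu
      · simp only [if_neg hwy] at h2 h3 h4
        exact ⟨h1, h2, h3, h4⟩
  · simp only [Heap.link, Function.update_apply] at h2 h3 ⊢
    by_cases hvy : v = y
    · simp [hvy, hyu.symm, hus] at h3
    · simp only [if_neg hvy] at h2 h3 ⊢
      split_ifs at h3 ⊢ with hp
      · have := Finset.single_le_sum (f := tm) (fun i _ => Nat.zero_le _) (Finset.mem_range.2 hv)
        omega
      · exact h.tm_lt v hv h2 h3

theorem HeapInv.remove (h : HeapInv n H key n) {z : ℕ} (hs : H.stat z = 1)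
    (hd : H.deg z = 0) : HeapInv n { H with stat := Function.update H.stat z 0 } key n := by
  obtain ⟨ln, tm, h⟩ := h
  have hz : ∀ v < n, Function.update H.stat z 0 v = 2 → H.stat v = 2 := by
    intro v hv h2
    rw [Function.update_apply] at h2
    split_ifs at h2
    exact h2
  have hp : ∀ v < n, H.stat v = 2 → H.par v ≠ z := by
    intro v hv h2 hh
    have := (h.child v hv h2).2.2.1
    rw [hh, hd] at this
    omega
  refine ⟨ln, tm, ⟨fun v hv => ?_, fun v hv h2 => ?_, fun v hv h2 j hj => ?_, h.mark_le,
    fun v hv h2 => ?_, fun v hv h2 => h.order v hv (hz v hv h2),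
    fun v hv h2 => h.ln_le v hv (hz v hv h2), fun v k => ?_, fun v hv h2 h3 => ?_⟩⟩
  · simp only [Function.update_apply]; split_ifs
    · omega
    · exact h.stat_le v hv
  · have h2' := hz v hv h2
    obtain ⟨a1, a2, a3⟩ := h.child v hv h2'
    exact ⟨a1, by simpa [Function.update_apply, hp v hv h2'] using a2, a3⟩
  · have hvz : v ≠ z := by rintro rfl; simp at h2
    simp only [Function.update_of_ne hvz] at h2
    obtain ⟨b1, b2, b3⟩ := h.slot v hv h2 j hj
    refine ⟨b1, ?_, b3⟩
    have : H.ch (j * n + v) ≠ z := by rintro hh; rw [hh] at b2; omega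
    simpa [Function.update_of_ne this] using b2
  · by_cases hvz : v = z
    · exact h.mark_eq v hv (by rw [hvz]; omega)
    · exact h.mark_eq v hv (by simpa [Function.update_of_ne hvz] using h2)
  · refine (Finset.card_le_card fun w => ?_).trans (h.count v k)
    simp only [Finset.mem_filter]
    rintro ⟨h1, h2, h3⟩
    exact ⟨h1, hz w (Finset.mem_range.1 h1) h2, h3⟩
  · exact h.tm_lt v hv (hz v hv h2) (hz _ (h.child v hv (hz v hv h2)).1 h3)

theorem HeapInv.init (hs : ∀ u < n, H.stat u = 1) (hd : ∀ u < n, H.deg u = 0)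
    (hm : ∀ u < n, H.mark u = 0) : HeapInv n H key n := by
  refine ⟨fun _ => 0, fun _ => 0, ⟨fun v hv => by rw [hs v hv]; decide, fun v hv h2 => ?_,
    fun v hv h2 j hj => ?_, fun v hv => by rw [hm v hv]; decide, fun v hv _ => hm v hv,
    fun v hv h2 => ?_, fun v hv h2 => ?_, fun v k => ?_, fun v hv h2 => ?_⟩⟩
  · rw [hs v hv] at h2; omega
  · rw [hd v hv] at hj; omega
  · rw [hs v hv] at h2; omega
  · rw [hs v hv] at h2; omega
  · rw [Finset.filter_false_of_mem]
    · simp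
    · rintro u hu ⟨h2, -⟩
      rw [hs u (Finset.mem_range.1 hu)] at h2; omega
  · rw [hs v hv] at h2; omega

theorem HeapInv.exists_root_le (h : HeapInv n H key n) {u : ℕ} (hu : u < n) (hs : H.stat u ≠ 0) :
    ∃ w < n, H.stat w = 1 ∧ key w ≤ key u := by
  obtain ⟨ln, tm, h⟩ := h
  have hB : ∀ v < n, tm v ≤ ∑ i ∈ Finset.range n, tm i := fun v hv =>
    Finset.single_le_sum (f := tm) (fun i _ => Nat.zero_le _) (Finset.mem_range.2 hv)
  induction hd : ∑ i ∈ Finset.range n, tm i - tm u using Nat.strong_induction_on generalizing u with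
  | _ d ih =>
    have := h.stat_le u hu
    by_cases h1 : H.stat u = 1
    · exact ⟨u, hu, h1, le_rfl⟩
    have h2 : H.stat u = 2 := by omega
    obtain ⟨a1, a2, -⟩ := h.child u hu h2
    have ho := h.order u hu h2 (by omega)
    by_cases h3 : H.stat (H.par u) = 2
    · have := h.tm_lt u hu h2 h3
      have := hB _ a1
      obtain ⟨w, hw, hw1, hw2⟩ := ih _ (by omega) a1 a2 rfl
      exact ⟨w, hw, hw1, hw2.trans ho⟩
    · have := h.stat_le _ a1
      exact ⟨_, a1, by omega, ho⟩

/-- Degrees are logarithmic: every item of degree at least `k + 3` has two children of degree at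
least `k`. -/
theorem HeapInv.two_pow_le (h : HeapInv n H key n) {u a : ℕ} (hu : u < n) (hs : H.stat u ≠ 0)
    (hd : 3 * a ≤ H.deg u) : 2 ^ a ≤ n := by
  obtain ⟨ln, tm, h⟩ := h
  set A : ℕ → Finset ℕ := fun k => (Finset.range n).filter fun v => H.stat v ≠ 0 ∧ k ≤ H.deg v
    with hA
  have step : ∀ k, 2 * (A (k + 3)).card ≤ (A k).card := by
    intro k
    set C := (A k).filter fun w => H.stat w = 2 ∧ H.par w ∈ A (k + 3) with hC
    have hmaps : ∀ w ∈ C, H.par w ∈ A (k + 3) := fun w hw => (Finset.mem_filter.1 hw).2.2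
    refine le_trans ?_ (Finset.card_le_card (Finset.filter_subset _ _ : C ⊆ A k))
    rw [Finset.card_eq_sum_card_fiberwise hmaps, mul_comm, ← smul_eq_mul]
    refine Finset.card_nsmul_le_sum _ _ _ fun v hv => ?_
    simp only [hA, Finset.mem_filter, Finset.mem_range] at hv
    obtain ⟨hvn, hvs, hvd⟩ := hv
    have h1 : H.deg v ≤ ((Finset.range n).filter fun u => H.stat u = 2 ∧ H.par u = v).card := by
      rw [← Finset.card_range (H.deg v)]
      refine Finset.card_le_card_of_injOn (fun j => H.ch (j * n + v)) (fun j hj => ?_)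
        fun i hi j hj hij => ?_
      · obtain ⟨b1, b2, b3, -⟩ := h.slot v hvn hvs j (by simpa using hj)
        simpa using ⟨b1, b2, b3⟩
      · have h1 := (h.slot v hvn hvs i (by simpa using hi)).2.2.2
        have h2 := (h.slot v hvn hvs j (by simpa using hj)).2.2.2
        simp only at hij
        rw [← h1, ← h2, hij]
    have h2 := h.count v k
    have h3 : ((Finset.range n).filter fun u => H.stat u = 2 ∧ H.par u = v).card ≤
        ((Finset.range n).filter fun u => H.stat u = 2 ∧ H.par u = v ∧ ln u ≤ k).card +
        (C.filter fun w => H.par w = v).card := by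
      refine le_trans (Finset.card_le_card fun w hw => ?_) (Finset.card_union_le _ _)
      simp only [Finset.mem_filter, Finset.mem_range, Finset.mem_union, hC, hA] at hw ⊢
      obtain ⟨c1, c2, c3⟩ := hw
      by_cases hl : ln w ≤ k
      · exact Or.inl ⟨c1, c2, c3, hl⟩
      · have c4 := h.ln_le w c1 c2 (by omega)
        have c5 := h.mark_le w c1
        refine Or.inr ⟨⟨⟨c1, by omega, by omega⟩, c2, ?_⟩, c3⟩
        rw [c3]
        exact ⟨hvn, hvs, hvd⟩
    omega
  have key : ∀ a k, 2 ^ a * (A (k + 3 * a)).card ≤ (A k).card := by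
    intro a
    induction a with
    | zero => simp
    | succ a ih =>
      intro k
      have := ih k
      have h2 := Nat.mul_le_mul_left (2 ^ a) (step (k + 3 * a))
      rw [pow_succ, mul_assoc, show k + 3 * (a + 1) = k + 3 * a + 3 by ring]
      exact h2.trans this
  have h1 : 0 < (A (0 + 3 * a)).card :=
    Finset.card_pos.2 ⟨u, by
      simp only [hA, Finset.mem_filter, Finset.mem_range]
      exact ⟨hu, hs, by omega⟩⟩
  have h2 := key a 0
  have h3 : (A 0).card ≤ n := (Finset.card_filter_le _ _).trans (by simp)
  calc 2 ^ a = 2 ^ a * 1 := (mul_one _).symm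
    _ ≤ 2 ^ a * (A (0 + 3 * a)).card := Nat.mul_le_mul_left _ h1
    _ ≤ n := h2.trans h3

/-! ### Cutting items from their parents -/

/-- The heap in the memory. -/
def heapOf (σ : State) : Heap := ⟨σ.na 5, σ.na 6, σ.na 7, σ.na 8, σ.na 9, σ.na 10⟩

/-- The potential of the heap in the memory: every root and every marked item pays for later
operations. -/
def pot (n : ℕ) (σ : State) : ℕ := 100 * σ.nv 8 + 200 * ∑ i ∈ Finset.range n, σ.na 9 i

/-- The natural array `11` lists the roots other than those in `X`. -/
def HoldsRoots (n : ℕ) (X : Set (Fin n)) (σ : State) : Prop :=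
  Lists (σ.na 11) (σ.nv 8) fun v : Fin n => σ.na 5 v = 1 ∧ v ∉ X

theorem sum_update_range {n v : ℕ} (hv : v < n) (f : ℕ → ℕ) (y : ℕ) :
    ∑ i ∈ Finset.range n, Function.update f v y i + f v = ∑ i ∈ Finset.range n, f i + y := by
  rw [Finset.sum_update_of_mem (Finset.mem_range.2 hv),
    ← Finset.add_sum_erase _ _ (Finset.mem_range.2 hv), Finset.sdiff_singleton_eq_erase]
  ring

/-- Cuts the item in the natural variable `9` from its parent, and leaves the parent in the natural
variable `10`. -/
def cutProg : Prog :=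
  .setNat 10 (.get 6 (.var 9)) ;;
  .setNat 11 (.sub (.get 8 (.var 10)) (.const 1)) ;;
  .setNat 12 (.get 10 (.add (.mul (.var 11) (.var 0)) (.var 10))) ;;
  .putNat 10 (.add (.mul (.get 7 (.var 9)) (.var 0)) (.var 10)) (.var 12) ;;
  .putNat 7 (.var 12) (.get 7 (.var 9)) ;;
  .putNat 8 (.var 10) (.var 11) ;;
  .putNat 5 (.var 9) (.const 1) ;;
  .putNat 9 (.var 9) (.const 0) ;;
  .putNat 11 (.var 8) (.var 9) ;;
  .setNat 8 (.add (.var 8) (.const 1))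

/-- Cuts the item in the natural variable `9`, unless it is a root, and then its ancestors as long
as they are marked.  The item in the natural variable `5` must not be a child. -/
def cascade : Prog :=
  .loop (.natLe (.const 2) (.get 5 (.var 9)))
    (cutProg ;;
      .cond (.natLe (.const 1) (.get 9 (.var 10))) (.setNat 9 (.var 10))
        (.cond (.natLe (.const 2) (.get 5 (.var 10))) (.putNat 9 (.var 10) (.const 1)) .skip ;;
          .setNat 9 (.var 5)))

section

variable {n : ℕ} {σ : State} {t : ℕ}

theorem cutProg_spec (hn : σ.nv 0 = n) (ht : 43 ≤ t) :
    WP cutProg (fun t' τ => t ≤ t' + 43 ∧ heapOf τ = (heapOf σ).cut n (σ.nv 9) ∧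
      τ.na 11 = Function.update (σ.na 11) (σ.nv 8) (σ.nv 9) ∧ τ.nv 8 = σ.nv 8 + 1 ∧
      τ.nv 10 = σ.na 6 (σ.nv 9)) t σ := by
  simp only [cutProg, WP.seq_iff, WP.setNat_iff, WP.putNat_iff, NExp.eval, NExp.size, State.setN_nv,
    State.setN_na, State.putN_nv, State.putN_na]
  norm_num only
  simp only [if_true, if_false]
  refine ⟨by omega, by omega, by omega, by omega, by omega, by omega, by omega, by omega, by omega,
    by omega, by omega, ?_⟩
  simp [heapOf, Heap.cut, hn]

theorem cutProg_inv {X : Set (Fin n)} (hn : σ.nv 0 = n) (ht : 43 ≤ t) (hL : HoldsRoots n X σ)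
    (hu : σ.nv 9 < n)
    (hX : ⟨σ.nv 9, hu⟩ ∉ X)
    (hs : σ.na 5 (σ.nv 9) = 2) :
    WP cutProg (fun t' τ => t ≤ t' + 43 ∧ heapOf τ = (heapOf σ).cut n (σ.nv 9) ∧
      HoldsRoots n X τ ∧ τ.nv 10 = σ.na 6 (σ.nv 9) ∧
      pot n τ + 200 * σ.na 9 (σ.nv 9) = pot n σ + 100 ∧ τ.nv 8 = σ.nv 8 + 1) t σ := by
  refine (cutProg_spec hn ht).conseq fun t' τ hf ⟨ht', hH, h11, h8, h10⟩ => ⟨ht', hH, ?_, h10, ?_, h8⟩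
  · have h5 : τ.na 5 = Function.update (σ.na 5) (σ.nv 9) 1 := congrArg Heap.stat hH
    rw [HoldsRoots, h11, h8, h5]
    refine hL.push (v := ⟨σ.nv 9, hu⟩) (by simp [hs]) fun w => ?_
    rw [Function.update_apply]
    by_cases hw : w = ⟨σ.nv 9, hu⟩
    · subst hw; simpa using hX
    · have : (w : ℕ) ≠ σ.nv 9 := fun hh => hw (Fin.ext hh)
      simp [hw, this]
  · have h9 : τ.na 9 = Function.update (σ.na 9) (σ.nv 9) 0 := congrArg Heap.mark hH
    have := sum_update_range hu (σ.na 9) 0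
    rw [pot, pot, h8, h9]
    omega

theorem cascade_spec (hn : σ.nv 0 = n) (B : ℕ) (hB : pot n σ + 404 + B ≤ t)
    (h : HeapInv n (heapOf σ) (σ.ra 3) (σ.nv 9)) (hL : HoldsRoots n ∅ σ) (hu : σ.nv 9 < n)
    (hz : σ.na 5 (σ.nv 5) ≠ 2) (hzn : σ.nv 5 < n) :
    WP cascade (fun t' τ => HeapInv n (heapOf τ) (τ.ra 3) n ∧ HoldsRoots n ∅ τ ∧
      (∀ w, τ.na 5 w = 0 ↔ σ.na 5 w = 0) ∧ pot n τ + B ≤ t') t σ := by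
  refine WP.loop (fun t' τ => HeapInv n (heapOf τ) (τ.ra 3) (τ.nv 9) ∧ HoldsRoots n ∅ τ ∧
    τ.nv 9 < n ∧ (∀ w, τ.na 5 w = 0 ↔ σ.na 5 w = 0) ∧ τ.na 5 (σ.nv 5) ≠ 2 ∧
    (τ.na 5 (τ.nv 9) ≠ 2 → pot n τ + 4 + B ≤ t') ∧
    (τ.na 5 (τ.nv 9) = 2 → pot n τ + 204 + 200 * (1 - τ.na 9 (τ.nv 9)) + B ≤ t'))
    ⟨h, hL, hu, fun w => Iff.rfl, hz, by omega, by omega⟩ ?_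
  rintro t' τ hf ⟨⟨ln, tm, h⟩, hL, hu, h0, hz, hB1, hB2⟩
  have hs_le := h.stat_le _ hu
  change τ.na 5 (τ.nv 9) ≤ 2 at hs_le
  simp only [BExp.size, BExp.eval, NExp.size, NExp.eval]
  refine ⟨by omega, fun hs => ?_, fun hs => ?_⟩
  · have hs2 : τ.na 5 (τ.nv 9) = 2 := by omega
    have hB := hB2 hs2
    have hm1 := h.mark_le _ hu
    change τ.na 9 (τ.nv 9) ≤ 1 at hm1
    have hq := (h.child _ hu hs2).1
    have hq0 := (h.child _ hu hs2).2.1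
    have hqu := h.par_ne hu hs2
    change τ.na 6 (τ.nv 9) < n at hq
    change τ.na 6 (τ.nv 9) ≠ τ.nv 9 at hqu
    change τ.na 5 (τ.na 6 (τ.nv 9)) ≠ 0 at hq0
    have h5 : τ.nv 5 = σ.nv 5 := hf.nv 5 rfl
    refine WP.seq ((cutProg_inv (by rw [hf.nv 0 rfl, hn]) (by omega) hL hu (by simp) hs2).conseq ?_)
    rintro t1 τ1 hf1 ⟨ht1, hH, hL1, h10, hp1, -⟩
    have hs1 : τ1.na 5 = Function.update (τ.na 5) (τ.nv 9) 1 := congrArg Heap.stat hH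
    have hm1' : τ1.na 9 = Function.update (τ.na 9) (τ.nv 9) 0 := congrArg Heap.mark hH
    have hr1 : τ1.ra 3 = τ.ra 3 := hf1.ra 3 rfl
    have h5' : τ1.nv 5 = σ.nv 5 := by rw [hf1.nv 5 rfl, h5]
    have h01 : ∀ w, τ1.na 5 w = 0 ↔ σ.na 5 w = 0 := by
      intro w
      rw [← h0, hs1, Function.update_apply]
      split_ifs with hw
      · simp [hw, hs2]
      · rfl
    have hz1 : τ1.na 5 (σ.nv 5) ≠ 2 := by
      rw [hs1, Function.update_apply]; split_ifs
      · omega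
      · exact hz
    have hq1 : τ1.na 5 (τ.na 6 (τ.nv 9)) = τ.na 5 (τ.na 6 (τ.nv 9)) := by
      rw [hs1, Function.update_of_ne hqu]
    have hq2 : τ1.na 9 (τ.na 6 (τ.nv 9)) = τ.na 9 (τ.na 6 (τ.nv 9)) := by
      rw [hm1', Function.update_of_ne hqu]
    have hqm := h.mark_le _ hq
    have hqm' := h.mark_eq _ hq
    have hqs := h.stat_le _ hq
    change τ.na 9 (τ.na 6 (τ.nv 9)) ≤ 1 at hqm
    change τ.na 5 (τ.na 6 (τ.nv 9)) ≠ 2 → τ.na 9 (τ.na 6 (τ.nv 9)) = 0 at hqm'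
    change τ.na 5 (τ.na 6 (τ.nv 9)) ≤ 2 at hqs
    simp only [WP.cond_iff, WP.seq_iff, WP.setNat_iff, WP.putNat_iff, WP.skip_iff, BExp.eval,
      BExp.size, NExp.eval, NExp.size, h10, hq1, hq2]
    refine ⟨by omega, fun hm => ⟨by omega, ?_⟩, fun hm => ⟨by omega, fun hqs2 => ⟨by omega, by omega,
      ?_⟩, fun hqs2 => ⟨by omega, by omega, ?_⟩⟩⟩
    · have hq2s : τ.na 5 (τ.na 6 (τ.nv 9)) = 2 := by
        by_contra hh; have := hqm' hh; omega
      refine ⟨⟨ln, tm, ?_⟩, hL1, by simpa using hq, by simpa using h01, by simpa using hz1, ?_, ?_⟩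
      · have := h.cut hu hs2 (Or.inl rfl)
        rw [← hH, ← hr1] at this
        simpa [heapOf] using this
      · simp [hq1, hq2s]
      · intro _
        simp only [State.setN_nv, State.setN_na, if_true, hq2]
        have : pot n (τ1.setN 9 (τ.na 6 (τ.nv 9))) = pot n τ1 := by simp [pot]
        omega
    · have hcm := h.cut_mark hu hs2 (Or.inl rfl) (show (heapOf τ).stat _ = 2 from by
        show τ.na 5 (τ.na 6 (τ.nv 9)) = 2
        omega) (show (heapOf τ).mark _ = 0 from by
        show τ.na 9 (τ.na 6 (τ.nv 9)) = 0
        omega)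
      rw [← hH] at hcm
      have hI : HeapInv n (heapOf ((τ1.putN 9 (τ.na 6 (τ.nv 9)) 1).setN 9 (σ.nv 5)))
          (τ1.ra 3) (σ.nv 5) := by
        refine HeapInv.congr_exception (x := n) ⟨ln, tm, ?_⟩ (Or.inl le_rfl) _
        rw [hr1]
        exact hcm
      refine ⟨?_, ?_, ?_, ?_, ?_, ?_, ?_⟩
      · simpa [h5'] using hI
      · simpa [HoldsRoots] using hL1
      · simpa [h5'] using hzn
      · simpa using h01
      · simpa using hz1
      · intro _
        have h3 := sum_update_range hq (τ1.na 9) 1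
        have : pot n ((τ1.putN 9 (τ.na 6 (τ.nv 9)) 1).setN 9 (σ.nv 5)) ≤ pot n τ1 + 200 := by
          simp only [pot, State.setN_na, State.putN_na, State.setN_nv, State.putN_nv]
          simp only [if_true]
          simp
          omega
        simp only [State.putN_nv, h5']
        omega
      · intro hh
        exact absurd hh (by simpa [h5'] using hz1)
    · have hqs1 : τ.na 5 (τ.na 6 (τ.nv 9)) = 1 := by omega
      have hcm := h.cut hu hs2 (Or.inl rfl)
      rw [← hH] at hcm
      have hI : HeapInv n (heapOf τ1) (τ1.ra 3) (σ.nv 5) := by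
        refine HeapInv.congr_exception ⟨ln, tm, by rw [hr1]; exact hcm⟩ (Or.inr ?_) _
        show τ1.na 5 (τ.na 6 (τ.nv 9)) ≠ 2
        rw [hq1, hqs1]; decide
      refine ⟨by simpa [heapOf, h5'] using hI, by simpa [HoldsRoots] using hL1,
        by simpa [h5'] using hzn, by simpa using h01, by simpa using hz1, fun _ => ?_, fun hh => ?_⟩
      · have : pot n (τ1.setN 9 (σ.nv 5)) = pot n τ1 := by simp [pot]
        simp only [h5']
        omega
      · exact absurd hh (by simpa [h5'] using hz1)
  · have hs2 : τ.na 5 (τ.nv 9) ≠ 2 := by omega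
    have hB := hB1 hs2
    exact ⟨HeapInv.congr_exception ⟨ln, tm, h⟩ (Or.inr hs2) n, hL, h0, by omega⟩

end

/-! ### Relaxing an edge in Dijkstra's algorithm -/

/-- Relaxes the edge in the natural variable `7` from the vertex in the natural variable `5`, which
has been removed from the heap. -/
def dijRelax : Prog :=
  .setNat 9 (.get 1 (.var 7)) ;;
  .cond (.and (.natLe (.get 2 (.var 7)) (.const 0))
      (.not (.realLe (.get 3 (.var 9)) (.add (.get 3 (.var 5)) (.get 1 (.var 7))))))
    (.putReal 3 (.var 9) (.add (.get 3 (.var 5)) (.get 1 (.var 7))) ;; cascade) .skip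

section

variable {G : WGraph} {c : Fin G.m → ℕ} {σ : State} {t : ℕ}

/-- The state of Dijkstra's algorithm when the edges from `z` of index at least `j` have been dealt
with.  Vertices that are not in the heap have been scanned. -/
structure DijInv (G : WGraph) (c : Fin G.m → ℕ) (y₀ : ℕ → ℝ) (W : ℕ) (z : Fin G.n) (j : ℕ)
    (τ : State) : Prop where
  heap : HeapInv G.n (heapOf τ) (τ.ra 3) G.n
  roots : HoldsRoots G.n ∅ τ
  scanned_le : ∀ u w : Fin G.n, τ.na 5 u = 0 → τ.na 5 w ≠ 0 → τ.ra 3 u ≤ τ.ra 3 w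
  le_z : ∀ u : Fin G.n, τ.na 5 u = 0 → τ.ra 3 u ≤ τ.ra 3 z
  closed : ∀ e, c e = 0 → τ.na 5 (G.src e) = 0 → (G.src e = z → j ≤ e) →
    τ.ra 3 (G.tgt e) ≤ τ.ra 3 (G.src e) + G.r e
  relaxed : Relaxed G c y₀ (τ.ra 3)
  bucket : ∀ d < W, τ.na 12 d = 0

theorem dijRelax_spec {y₀ : ℕ → ℝ} {W B : ℕ} {e : Fin G.m}
    (hN : HoldsNet G c σ) (h5 : σ.nv 5 = G.src e) (h7 : σ.nv 7 = e) (hz : σ.na 5 (G.src e) = 0)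
    (h : DijInv G c y₀ W (G.src e) (e + 1) σ) (ht : pot G.n σ + 440 + B ≤ t) :
    WP dijRelax (fun t' τ => DijInv G c y₀ W (G.src e) e τ ∧ pot G.n τ + B ≤ t' ∧
      ∀ w, τ.na 5 w = 0 ↔ σ.na 5 w = 0) t σ := by
  set v := G.tgt e with hv
  have hr := G.r_nonneg e
  simp only [dijRelax, WP.cond_iff, WP.seq_iff, WP.setNat_iff, WP.putReal_iff, WP.skip_iff,
    BExp.eval, BExp.size, NExp.eval, NExp.size, RExp.eval, RExp.size, State.setN_nv,
    State.setN_na, State.setN_ra, h7, h5, hN.tgt]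
  norm_num only
  simp only [if_true, if_false, hN.costs, hN.r, Nat.le_zero, not_le, ← hv]
  refine ⟨by omega, by omega, fun ⟨h0, hlt⟩ => ⟨by omega, ?_⟩, fun hn => ⟨by omega, ?_, ?_, ?_⟩⟩
  · have hvs : σ.na 5 v ≠ 0 := fun hh => by linarith [h.le_z v hh]
    have hvz : (G.src e : ℕ) ≠ v := by intro hh; rw [← hh] at hlt; linarith
    set y := σ.ra 3 (G.src e) + G.r e with hy
    set σ1 := (σ.setN 9 v).putR 3 v y with hσ1
    have hra : σ1.ra 3 = Function.update (σ.ra 3) v y := by simp [hσ1]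
    have hp : pot G.n σ1 = pot G.n σ := by simp [pot, hσ1]
    have hk : ∀ w : Fin G.n, w ≠ v → σ1.ra 3 w = σ.ra 3 w := fun w hw => by
      rw [hra, Function.update_of_ne fun hh => hw (Fin.ext hh)]
    have hkv : σ1.ra 3 v = y := by rw [hra, Function.update_self]
    have hks : σ1.ra 3 (G.src e) = σ.ra 3 (G.src e) := by
      rw [hra, Function.update_of_ne hvz]
    refine (cascade_spec (n := G.n) (σ := σ1) (by simp [hσ1, hN.n]) B (by omega) ?_ ?_
      (by simp [hσ1]) ?_ (by simp [hσ1, h5])).conseq ?_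
    · have := h.heap.decrease (v := v) hlt.le
      rw [hra]
      simpa [hσ1, heapOf] using this
    · simpa [hσ1, HoldsRoots] using h.roots
    · simp [hσ1, h5, hz]
    rintro t' τ hf ⟨hh, hL, h0', hp'⟩
    have h50 : ∀ w, τ.na 5 w = 0 ↔ σ.na 5 w = 0 := fun w => by rw [h0' w]; simp [hσ1]
    have h3 : τ.ra 3 = σ1.ra 3 := hf.ra 3 rfl
    have hsv : ∀ u : Fin G.n, τ.na 5 u = 0 → u ≠ v := by
      rintro u hu rfl; exact hvs ((h50 _).1 hu)
    refine ⟨⟨hh, hL, fun u w hu hw => ?_, fun u hu => ?_, fun e' hc' hs' hj' => ?_, ?_, ?_⟩, hp',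
      h50⟩
    · rw [h3, hk u (hsv u hu)]
      rw [h50] at hu
      rw [Ne, h50] at hw
      by_cases hwv : w = v
      · rw [hwv, hkv]; linarith [h.le_z u hu]
      · rw [hk w hwv]; exact h.scanned_le u w hu hw
    · rw [h3, hks, hk u (hsv u hu)]
      exact h.le_z u ((h50 _).1 hu)
    · rw [h3, hk _ (hsv _ hs')]
      by_cases hee : e' = e
      · subst hee; rw [← hv, hkv]
      have := h.closed e' hc' ((h50 _).1 hs') fun hh => by
        have h1 := Fin.val_ne_of_ne hee
        have h2 : e.val ≤ e' := hj' hh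
        omega
      by_cases hw : G.tgt e' = v
      · rw [hw, hkv]; rw [hw] at this; linarith
      · rw [hk _ hw]; exact this
    · rw [h3, hra]
      exact h.relaxed.step h0 hlt.le
    · rw [hf.na 12 rfl]
      simpa [hσ1] using h.bucket
  · refine ⟨h.heap, h.roots, h.scanned_le, h.le_z, fun e' hc' hs' hj' => ?_, h.relaxed, h.bucket⟩
    by_cases hee : e' = e
    · subst hee
      exact not_lt.1 fun hlt => hn ⟨hc', hlt⟩
    · exact h.closed e' hc' hs' fun hh => by
        have h1 := Fin.val_ne_of_ne hee
        have h2 : e.val ≤ e' := hj' hh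
        omega
  · have : pot G.n (σ.setN 9 v) = pot G.n σ := by simp [pot]
    omega
  · simp

end

/-! ### Consolidating the roots of a Fibonacci heap -/

/-- The state of the consolidation.  The roots in the entries of `rt` from `j` to `k - 1` have not
been looked at; `u` is the root at hand (`u = n` if there is none); the other roots are in the
buckets, `b d` being the successor of the root of degree `d`, or `0`. -/
structure ConsInv (n W : ℕ) (H : Heap) (key : ℕ → ℝ) (b rt : ℕ → ℕ) (k j u : ℕ) : Prop where
  heap : HeapInv n H key n
  rest : ∀ i, j ≤ i → i < k → rt i < n ∧ H.stat (rt i) = 1 ∧ rt i ≠ u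
  bucket : ∀ d < W, b d ≠ 0 → ∃ v < n, b d = v + 1 ∧ H.stat v = 1 ∧ H.deg v = d ∧ v ≠ u ∧
    ∀ i, j ≤ i → i < k → rt i ≠ v
  cover : ∀ v < n, H.stat v = 1 → v = u ∨ (∃ i, j ≤ i ∧ i < k ∧ rt i = v) ∨ b (H.deg v) = v + 1

variable {n W : ℕ} {H : Heap} {key : ℕ → ℝ} {b rt : ℕ → ℕ} {k j u : ℕ}

theorem ConsInv.fetch (h : ConsInv n W H key b rt k j n) (hj : j < k)
    (hi : ∀ i < k, ∀ j < k, rt i = rt j → i = j) :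
    ConsInv n W H key b rt k (j + 1) (rt j) := by
  refine ⟨h.heap, fun i h1 h2 => ⟨(h.rest i (by omega) h2).1, (h.rest i (by omega) h2).2.1,
    fun he => ?_⟩, fun d hd h0 => ?_,
    fun v hv hs => ?_⟩
  · have := hi i h2 j hj he; omega
  · obtain ⟨v, hv, hb, hs, hd', -, hr⟩ := h.bucket d hd h0
    exact ⟨v, hv, hb, hs, hd', (hr j le_rfl hj).symm, fun i h1 h2 => hr i (by omega) h2⟩
  · rcases h.cover v hv hs with hh | ⟨i, h1, h2, h3⟩ | hh
    · omega
    · by_cases hij : i = j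
      · subst hij; exact Or.inl h3.symm
      · exact Or.inr (Or.inl ⟨i, by omega, h2, h3⟩)
    · exact Or.inr (Or.inr hh)

theorem ConsInv.store (h : ConsInv n W H key b rt k j u) (hu : u < n) (hs : H.stat u = 1)
    (h0 : b (H.deg u) = 0) :
    ConsInv n W H key (Function.update b (H.deg u) (u + 1)) rt k j n := by
  refine ⟨h.heap, fun i h1 h2 => ⟨(h.rest i h1 h2).1, (h.rest i h1 h2).2.1,
    (h.rest i h1 h2).1.ne⟩, fun d hd hb => ?_,
    fun v hv hv1 => ?_⟩
  · rw [Function.update_apply] at hb ⊢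
    split_ifs at hb ⊢ with hdu
    · exact ⟨u, hu, rfl, hs, hdu.symm, hu.ne, fun i h1 h2 => (h.rest i h1 h2).2.2⟩
    · obtain ⟨v, hv, hb, hs, hd', -, hr⟩ := h.bucket d hd hb
      exact ⟨v, hv, hb, hs, hd', hv.ne, hr⟩
  · rcases h.cover v hv hv1 with rfl | hh | hh
    · exact Or.inr (Or.inr (by simp))
    · exact Or.inr (Or.inl hh)
    · refine Or.inr (Or.inr ?_)
      rw [Function.update_of_ne, hh]
      intro he; rw [he, h0] at hh; omega

theorem ConsInv.link (h : ConsInv n W H key b rt k j u) (hu : u < n) (hs : H.stat u = 1)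
    (hW : H.deg u < W) {v : ℕ} (hb : b (H.deg u) = v + 1) {x y : ℕ}
    (hxy : (x = u ∧ y = v) ∨ (x = v ∧ y = u)) (hk : key x ≤ key y) :
    ConsInv n W (H.link n y x) key (Function.update b (H.deg u) 0) rt k j x := by
  obtain ⟨v', hv, hb', hvs, hvd, hvu, hvr⟩ := h.bucket _ hW (by omega)
  obtain rfl : v' = v := by omega
  have hur : ∀ i, j ≤ i → i < k → rt i ≠ u := fun i h1 h2 => (h.rest i h1 h2).2.2
  have hx : x < n ∧ H.stat x = 1 ∧ H.deg x = H.deg u ∧ ∀ i, j ≤ i → i < k → rt i ≠ x := by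
    rcases hxy with ⟨rfl, rfl⟩ | ⟨rfl, rfl⟩
    · exact ⟨hu, hs, rfl, hur⟩
    · exact ⟨hv, hvs, hvd, hvr⟩
  have hy : y < n ∧ H.stat y = 1 ∧ H.deg y = H.deg u ∧ ∀ i, j ≤ i → i < k → rt i ≠ y := by
    rcases hxy with ⟨rfl, rfl⟩ | ⟨rfl, rfl⟩
    · exact ⟨hv, hvs, hvd, hvr⟩
    · exact ⟨hu, hs, rfl, hur⟩
  have hyx : y ≠ x := by rcases hxy with ⟨rfl, rfl⟩ | ⟨rfl, rfl⟩ <;> omega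
  have hst : ∀ w, w ≠ y → (H.link n y x).stat w = H.stat w := fun w hw => by
    simp [Heap.link, hw]
  have hdg : ∀ w, w ≠ x → (H.link n y x).deg w = H.deg w := fun w hw => by
    simp [Heap.link, hw]
  refine ⟨h.heap.link hx.1 hy.1 hyx hx.2.1 hy.2.1 (by rw [hx.2.2.1, hy.2.2.1]) hk,
    fun i h1 h2 => ⟨(h.rest i h1 h2).1, ?_, hx.2.2.2 i h1 h2⟩, fun d hd hd0 => ?_, fun w hw hw1 => ?_⟩
  · rw [hst _ (hy.2.2.2 i h1 h2), (h.rest i h1 h2).2.1]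
  · rw [Function.update_apply] at hd0 ⊢
    split_ifs at hd0 ⊢ with hdu
    · exact absurd rfl hd0
    · obtain ⟨w, hw, hbw, hws, hwd, hwu, hwr⟩ := h.bucket d hd hd0
      have h1 : w ≠ x := by rintro rfl; omega
      have h2 : w ≠ y := by rintro rfl; omega
      exact ⟨w, hw, hbw, by rw [hst w h2, hws], by rw [hdg w h1, hwd], h1, hwr⟩
  · by_cases hwx : w = x
    · exact Or.inl hwx
    have hwy : w ≠ y := by rintro rfl; simp [Heap.link] at hw1
    rw [hst w hwy] at hw1
    rw [hdg w hwx]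
    have hwu : w ≠ u ∧ w ≠ v' := by rcases hxy with ⟨rfl, rfl⟩ | ⟨rfl, rfl⟩ <;> exact ⟨‹_›, ‹_›⟩
    rcases h.cover w hw hw1 with hh | hh | hh
    · exact absurd hh hwu.1
    · exact Or.inr (Or.inl hh)
    · refine Or.inr (Or.inr ?_)
      rw [Function.update_of_ne, hh]
      intro he; rw [he, hb] at hh; omega

theorem ConsInv.deg_lt (h : ConsInv n W H key b rt k j u) (hu : u < n) (hs : H.stat u = 1) {a : ℕ}
    (hW : W = 3 * a) (ha : n < 2 ^ a) : H.deg u < W := by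
  by_contra hd
  have := h.heap.two_pow_le (u := u) (a := a) hu (by omega) (by omega)
  omega

/-! ### Programs for the consolidation -/

/-- Links the root in the natural variable `9`, whose degree is in the natural variable `10`, with
the root in the bucket of this degree, and leaves the new root and its degree in these variables. -/
def linkRoots : Prog :=
  .setNat 11 (.sub (.get 12 (.var 10)) (.const 1)) ;;
  .putNat 12 (.var 10) (.const 0) ;;
  .cond (.realLe (.get 3 (.var 9)) (.get 3 (.var 11))) .skip
    (.setNat 12 (.var 9) ;; .setNat 9 (.var 11) ;; .setNat 11 (.var 12)) ;;
  .putNat 5 (.var 11) (.const 2) ;;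
  .putNat 6 (.var 11) (.var 9) ;;
  .putNat 7 (.var 11) (.var 10) ;;
  .putNat 10 (.add (.mul (.var 10) (.var 0)) (.var 9)) (.var 11) ;;
  .setNat 10 (.add (.var 10) (.const 1)) ;;
  .putNat 8 (.var 9) (.var 10)

/-- Links roots of the same degree, as long as there are any, and enters the remaining roots into
the buckets. -/
def consolidate : Prog :=
  .setNat 13 (.const 0) ;;
  .loop (.natLe (.add (.var 13) (.const 1)) (.var 8))
    (.setNat 9 (.get 11 (.var 13)) ;;
      .setNat 10 (.get 8 (.var 9)) ;;
      .loop (.natLe (.const 1) (.get 12 (.var 10))) linkRoots ;;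
      .putNat 12 (.var 10) (.add (.var 9) (.const 1)) ;;
      .setNat 13 (.add (.var 13) (.const 1)))

/-- Empties the buckets into the list of roots. -/
def emptyBuckets : Prog :=
  .setNat 8 (.const 0) ;;
  .forN 13 14 (.cond (.natLe (.const 1) (.get 12 (.var 13)))
    (.putNat 11 (.var 8) (.sub (.get 12 (.var 13)) (.const 1)) ;;
      .setNat 8 (.add (.var 8) (.const 1)) ;;
      .putNat 12 (.var 13) (.const 0)) .skip)

section

variable {n W a : ℕ} {σ : State} {t : ℕ}

theorem linkRoots_spec {v : ℕ} (hn : σ.nv 0 = n) (hd : σ.na 8 (σ.nv 9) = σ.nv 10)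
    (hv : σ.na 8 v = σ.nv 10) (hb : σ.na 12 (σ.nv 10) = v + 1) (ht : 45 ≤ t) :
    WP linkRoots (fun t' τ => t ≤ t' + 45 ∧ ∃ x y,
      (x = σ.nv 9 ∧ y = v ∨ x = v ∧ y = σ.nv 9) ∧ σ.ra 3 x ≤ σ.ra 3 y ∧
      heapOf τ = (heapOf σ).link n y x ∧ τ.nv 9 = x ∧ τ.nv 10 = σ.nv 10 + 1 ∧
      τ.na 12 = Function.update (σ.na 12) (σ.nv 10) 0) t σ := by
  simp only [linkRoots, WP.cond_iff, WP.seq_iff, WP.setNat_iff, WP.putNat_iff, WP.skip_iff,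
    BExp.eval, BExp.size, NExp.eval, NExp.size, RExp.eval, RExp.size, State.setN_nv, State.setN_na,
    State.setN_ra, State.putN_nv, State.putN_na, State.putN_ra, hb]
  norm_num only
  simp only [if_true, if_false, hn]
  refine ⟨by omega, by omega, by omega, fun hk => ⟨by omega, by omega, by omega, by omega, by omega,
    by omega, by omega, by omega, σ.nv 9, v, Or.inl ⟨rfl, rfl⟩, hk, ?_⟩, fun hk => ⟨by omega,
    by omega, by omega, by omega, by omega,
    by omega, by omega, by omega, by omega, by omega, v, σ.nv 9, Or.inr ⟨rfl, rfl⟩,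
    (not_le.1 hk).le, ?_⟩⟩
  · simp [heapOf, Heap.link, hd]
  · simp [heapOf, Heap.link, hv]

theorem consolidate_spec {B : ℕ} (hn : σ.nv 0 = n) (hW : W = 3 * a) (ha : n < 2 ^ a)
    (h : HeapInv n (heapOf σ) (σ.ra 3) n) (hL : HoldsRoots n ∅ σ) (hb : ∀ d < W, σ.na 12 d = 0)
    (ht : 75 * σ.nv 8 + 10 + B ≤ t) :
    WP consolidate (fun t' τ => B ≤ t' ∧
      ConsInv n W (heapOf τ) (τ.ra 3) (τ.na 12) (σ.na 11) (σ.nv 8) (σ.nv 8) n ∧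
      ∀ w, τ.na 5 w = 0 ↔ σ.na 5 w = 0) t σ := by
  set k := σ.nv 8 with hk
  set rt := σ.na 11 with hrt
  -- the number of occupied buckets; every link frees one
  set occ : (ℕ → ℕ) → ℕ := fun b => ∑ i ∈ Finset.range W, min 1 (b i) with hocc
  have hou : ∀ d < W, ∀ b y, occ (Function.update b d y) + min 1 (b d) = occ b + min 1 y := by
    intro d hd b y
    have := sum_update_range hd (fun i => min 1 (b i)) (min 1 y)
    rw [← this, hocc]
    congr 1
    refine Finset.sum_congr rfl fun i _ => ?_
    simp only [Function.update_apply]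
    split_ifs <;> rfl
  have hrn : ∀ i < k, rt i < n ∧ σ.na 5 (rt i) = 1 := by
    intro i hi
    obtain ⟨v, hv, hs, -⟩ := hL.mem i hi
    rw [show rt i = v from hv]; exact ⟨v.2, hs⟩
  refine WP.seq (WP.setNat (by simp [NExp.size]; omega) ?_)
  simp only [NExp.eval, NExp.size]
  refine WP.loop (fun t' τ => τ.nv 13 ≤ k ∧
    ConsInv n W (heapOf τ) (τ.ra 3) (τ.na 12) rt k (τ.nv 13) n ∧
    (∀ w, τ.na 5 w = 0 ↔ σ.na 5 w = 0) ∧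
    75 * (k - τ.nv 13) + 50 * occ (τ.na 12) + 5 + B ≤ t') ?_ ?_
  · refine ⟨by simp, ⟨by simpa [heapOf] using h, ?_, ?_, ?_⟩, by simp, ?_⟩
    · intro i _ hi
      exact ⟨(hrn i hi).1, (hrn i hi).2, (hrn i hi).1.ne⟩
    · intro d hd h0
      exact absurd (hb d hd) (by simpa using h0)
    · intro v hv hs
      obtain ⟨i, hi, he⟩ := hL.all ⟨v, hv⟩ ⟨by simpa [heapOf] using hs, by simp⟩
      exact Or.inr (Or.inl ⟨i, by simp, hi, he⟩)
    · have : occ (σ.na 12) = 0 := by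
        simp only [hocc]
        exact Finset.sum_eq_zero fun i hi => by rw [hb i (Finset.mem_range.1 hi)]; rfl
      simp [this]
      omega
  rintro t1 τ1 hf1 ⟨hj, hC, h0, ht1⟩
  have h8 : τ1.nv 8 = k := hf1.nv 8 rfl
  simp only [BExp.eval, BExp.size, NExp.eval, NExp.size, h8]
  refine ⟨by omega, fun hlt => ?_, fun hge => ?_⟩
  swap
  · have : τ1.nv 13 = k := by omega
    rw [this] at hC
    exact ⟨by omega, hC, h0⟩
  set j := τ1.nv 13 with hjdef
  have h11 : τ1.na 11 = rt := hf1.na 11 rfl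
  have hn1 : τ1.nv 0 = n := by rw [hf1.nv 0 rfl]; simpa using hn
  simp only [WP.seq_iff, WP.setNat_iff]
  refine ⟨by simp only [NExp.size]; omega, by simp only [NExp.size]; omega, ?_⟩
  simp only [NExp.eval, NExp.size, State.setN_nv, State.setN_na, if_true, ← hjdef, h11]
  have hC1 := hC.fetch (by omega) hL.inj
  have hrj := hC.rest j le_rfl (by omega)
  refine WP.loop (fun t' τ => 
    ConsInv n W (heapOf τ) (τ.ra 3) (τ.na 12) rt k (j + 1) (τ.nv 9) ∧ τ.nv 9 < n ∧
    τ.na 5 (τ.nv 9) = 1 ∧ τ.na 8 (τ.nv 9) = τ.nv 10 ∧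
    (∀ w, τ.na 5 w = 0 ↔ σ.na 5 w = 0) ∧
    75 * (k - (j + 1)) + 50 * occ (τ.na 12) + 68 + B ≤ t') ?_ ?_
  · refine ⟨by simpa [heapOf] using hC1, by simpa using hrj.1,
      by simpa [heapOf] using hrj.2.1, by simp,
      by simpa using h0, ?_⟩
    simp only [State.setN_na]
    omega
  rintro t2 τ2 hf2 ⟨hC2, hu, hs, hd, h02, ht2⟩
  have hdW : τ2.nv 10 < W := hd ▸ hC2.deg_lt hu hs hW ha
  simp only [BExp.eval, BExp.size, NExp.eval, NExp.size]
  refine ⟨by omega, fun hb1 => ?_, fun hb0 => ?_⟩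
  · obtain ⟨v, hv, hbv, hvs, hvd, -⟩ := hC2.bucket _ hdW (by omega)
    have hn2 : τ2.nv 0 = n := by rw [hf2.nv 0 rfl]; simpa using hn1
    have ho := hou _ hdW (τ2.na 12) 0
    refine (linkRoots_spec hn2 hd hvd hbv (by omega)).conseq ?_
    rintro t3 τ3 hf3 ⟨ht3, x, y, hxy, hkey, hH, h9, h10, h12⟩
    have hr3 : τ3.ra 3 = τ2.ra 3 := hf3.ra 3 rfl
    have hlink := hC2.link hu hs (show τ2.na 8 (τ2.nv 9) < W from hd ▸ hdW)
      (show τ2.na 12 ((heapOf τ2).deg (τ2.nv 9)) = v + 1 by rw [← hbv, ← hd]; rfl) hxy hkey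
    have hyx : y ≠ x := by
      have : v ≠ τ2.nv 9 := (hC2.bucket _ hdW (by omega)).elim fun v' hv' => by
        have : v' = v := by omega
        rw [← this]; exact hv'.2.2.2.2.1
      rcases hxy with ⟨rfl, rfl⟩ | ⟨rfl, rfl⟩ <;> omega
    have hx : x < n ∧ τ2.na 5 x = 1 ∧ τ2.na 8 x = τ2.nv 10 := by
      rcases hxy with ⟨rfl, rfl⟩ | ⟨rfl, rfl⟩
      · exact ⟨hu, hs, hd⟩
      · exact ⟨hv, hvs, hvd⟩
    have hys : τ2.na 5 y = 1 := by rcases hxy with ⟨rfl, rfl⟩ | ⟨rfl, rfl⟩ <;> assumption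
    have h5 : τ3.na 5 = Function.update (τ2.na 5) y 2 := congrArg Heap.stat hH
    have h8' : τ3.na 8 = Function.update (τ2.na 8) x (τ2.na 8 x + 1) := congrArg Heap.deg hH
    refine ⟨?_, by rw [h9]; exact hx.1, ?_, ?_, fun w => ?_, ?_⟩
    · rw [hH, hr3, h12, h9, ← hd]; exact hlink
    · rw [h9, h5, Function.update_of_ne hyx.symm, hx.2.1]
    · rw [h9, h10, h8', Function.update_self, hx.2.2]
    · rw [← h02, h5, Function.update_apply]
      split_ifs with hw
      · simp [hw, hys]
      · rfl
    · rw [h12]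
      have : min 1 (τ2.na 12 (τ2.nv 10)) = 1 := by omega
      simp only [min_eq_right (Nat.zero_le 1)] at ho
      omega
  · have hb0' : τ2.na 12 (τ2.nv 10) = 0 := by omega
    have h13 : τ2.nv 13 = j := by rw [hf2.nv 13 rfl]; simp [hjdef]
    have ho := hou _ hdW (τ2.na 12) (τ2.nv 9 + 1)
    have hst := hC2.store hu hs (show τ2.na 12 ((heapOf τ2).deg (τ2.nv 9)) = 0 by
      rw [← hb0', ← hd]; rfl)
    have hd' : (heapOf τ2).deg (τ2.nv 9) = τ2.nv 10 := hd
    rw [hd'] at hst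
    simp only [WP.seq_iff, WP.putNat_iff, WP.setNat_iff, NExp.size, NExp.eval, State.putN_nv, h13]
    refine ⟨by omega, by omega, by simp only [State.setN_nv, if_true]; omega,
      by simpa [heapOf] using hst, by simpa using h02, ?_⟩
    simp only [State.setN_nv, State.setN_na, State.putN_na, if_true]
    have := Nat.min_le_left 1 (τ2.nv 9 + 1)
    omega

theorem emptyBuckets_spec {rt : ℕ → ℕ} {k : ℕ}
    (h : ConsInv n W (heapOf σ) (σ.ra 3) (σ.na 12) rt k k n) (hW : σ.nv 14 = W)
    (hdW : ∀ v < n, σ.na 5 v = 1 → σ.na 8 v < W)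
    (ht : 30 * W + 10 ≤ t) :
    WP emptyBuckets (fun t' τ => t ≤ t' + (30 * W + 10) ∧ HoldsRoots n ∅ τ ∧ τ.nv 8 ≤ W ∧
      ∀ d < W, τ.na 12 d = 0) t σ := by
  refine WP.seq (WP.setNat (by simp [NExp.size]; omega) ?_)
  simp only [NExp.eval, NExp.size]
  refine WP.forN W 21 (fun j τ => Lists (τ.na 11) (τ.nv 8) (fun v : Fin n => σ.na 5 v = 1 ∧
    σ.na 8 v < j) ∧ τ.nv 8 ≤ j ∧ (∀ d < j, τ.na 12 d = 0) ∧
    ∀ d, j ≤ d → τ.na 12 d = σ.na 12 d)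
    (by simp [hW]) (by simp) rfl rfl (by omega) ⟨⟨by simp, by simp, by simp⟩, by simp⟩ ?_ ?_
  · rintro j t τ hj hx hf hc ⟨hL, h8, hz, hbd⟩
    simp only [WP.cond_iff, WP.seq_iff, WP.setNat_iff, WP.putNat_iff, WP.skip_iff, BExp.eval,
      BExp.size, NExp.eval, NExp.size, State.putN_nv, State.putN_na, State.setN_na, State.setN_nv,
      hx, hbd j le_rfl]
    norm_num only
    simp only [if_true, if_false]
    refine ⟨by omega, fun h1 => ⟨by omega, by omega, by omega, by omega, ?_, by simp [h8], ?_, ?_⟩,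
      fun h1 => ⟨by omega, by omega, ?_, by omega, ?_, ?_⟩⟩
    · obtain ⟨v, hv, hbv, hvs, hvd, -⟩ := h.bucket j hj (by omega)
      have hvd : σ.na 8 v = j := hvd
      have hvs : σ.na 5 v = 1 := hvs
      simp only [hbv, Nat.add_sub_cancel]
      refine hL.push (v := ⟨v, hv⟩) (by simp [hvd]) fun w => ?_
      constructor
      · rintro ⟨hw1, hw2⟩
        rcases Nat.lt_succ_iff_lt_or_eq.1 hw2 with hw | hw
        · exact Or.inl ⟨hw1, hw⟩
        · rcases h.cover w w.2 hw1 with hc | ⟨i, h1, h2, -⟩ | hc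
          · exact absurd hc w.2.ne
          · omega
          · have hw' : (heapOf σ).deg w = j := hw
            rw [hw', hbv] at hc
            exact Or.inr (Fin.ext (by simp; omega))
      · rintro (hw | rfl)
        · exact ⟨hw.1, by omega⟩
        · exact ⟨hvs, by simp [hvd]⟩
    · intro d hd
      rw [Function.update_apply]
      split_ifs with hdj
      · rfl
      · exact hz d (by omega)
    · intro d hd
      rw [Function.update_of_ne (by omega)]
      exact hbd d (by omega)
    · refine hL.congr fun w => ⟨fun hw => ⟨hw.1, by omega⟩, fun hw => ⟨hw.1, ?_⟩⟩
      refine lt_of_le_of_ne (by omega) fun he => ?_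
      rcases h.cover w w.2 hw.1 with hc | ⟨i, h1, h2, -⟩ | hc
      · exact absurd hc w.2.ne
      · omega
      · have hw' : (heapOf σ).deg w = j := he
        rw [hw'] at hc
        omega
    · intro d hd
      rcases Nat.lt_succ_iff_lt_or_eq.1 hd with hd | rfl
      · exact hz d hd
      · rw [hbd d le_rfl]; omega
    · intro d hd
      exact hbd d (by omega)
  · rintro t' τ hf ht' ⟨hL, h8, hz, -⟩
    have h5 : τ.na 5 = σ.na 5 := hf.na 5 rfl
    refine ⟨by omega, ?_, h8, hz⟩
    rw [HoldsRoots, h5]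
    exact hL.congr fun v => ⟨fun hv => ⟨hv.1, by simp⟩, fun hv => ⟨hv.1, hdW v v.2 hv.1⟩⟩

end

/-! ### Removing a root of least key -/

/-- Finds a root of least key, whose index in the list of roots is left in the natural
variable `12`. -/
def findMin : Prog :=
  .setNat 12 (.const 0) ;;
  .forN 13 8 (.cond (.realLe (.get 3 (.get 11 (.var 12))) (.get 3 (.get 11 (.var 13)))) .skip
    (.setNat 12 (.var 13)))

/-- Removes the root whose index is in the natural variable `12`, after its children have been made
roots, and leaves it in the natural variable `5`. -/
def removeRoot : Prog :=
  .setNat 5 (.get 11 (.var 12)) ;;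
  .setNat 8 (.sub (.var 8) (.const 1)) ;;
  .putNat 11 (.var 12) (.get 11 (.var 8)) ;;
  .loop (.natLe (.const 1) (.get 8 (.var 5)))
    (.setNat 9 (.get 10 (.add (.mul (.sub (.get 8 (.var 5)) (.const 1)) (.var 0)) (.var 5))) ;;
      cutProg) ;;
  .putNat 5 (.var 5) (.const 0)

section

variable {n W k : ℕ} {σ : State} {t : ℕ}

theorem findMin_spec (hk : σ.nv 8 = k) (h0 : 1 ≤ k) (ht : 18 * k + 10 ≤ t) :
    WP findMin (fun t' τ => t ≤ t' + (18 * k + 10) ∧ τ.nv 12 < k ∧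
      ∀ i < k, τ.ra 3 (τ.na 11 (τ.nv 12)) ≤ τ.ra 3 (τ.na 11 i)) t σ := by
  refine WP.seq (WP.setNat (by simp [NExp.size]; omega) ?_)
  simp only [NExp.eval, NExp.size]
  refine WP.forN k 9 (fun j τ => τ.nv 12 < k ∧
      ∀ i < j, τ.ra 3 (τ.na 11 (τ.nv 12)) ≤ τ.ra 3 (τ.na 11 i))
    (by simp [hk]) (by simp) rfl rfl (by omega) ⟨by simp; omega, by simp⟩ ?_ ?_
  · rintro j t τ hj hx hf hc ⟨h1, h2⟩
    simp only [WP.cond_iff, WP.skip_iff, WP.setNat_iff, BExp.eval, BExp.size, RExp.eval, RExp.size,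
      NExp.eval, NExp.size, hx]
    refine ⟨by omega, fun hle => ⟨by omega, by omega, by simpa using h1, fun i hi => ?_⟩,
      fun hle => ⟨by omega, by omega, by simpa using hj, fun i hi => ?_⟩⟩
    · simp
      rcases Nat.lt_succ_iff_lt_or_eq.1 hi with hi | rfl
      · exact h2 i hi
      · exact hle
    · simp
      rcases Nat.lt_succ_iff_lt_or_eq.1 hi with hi | rfl
      · exact (not_le.1 hle).le.trans (h2 i hi)
      · exact le_rfl
  · rintro t' τ hf ht' ⟨h1, h2⟩
    exact ⟨by omega, h1, h2⟩

theorem removeRoot_spec (hn : σ.nv 0 = n) (h : HeapInv n (heapOf σ) (σ.ra 3) n)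
    (hL : HoldsRoots n ∅ σ) {z : Fin n} (hz : σ.na 11 (σ.nv 12) = z) (hi : σ.nv 12 < σ.nv 8)
    (hdW : σ.na 8 z ≤ W) (ht : 70 * W + 30 ≤ t) :
    WP removeRoot (fun t' τ => t ≤ t' + (70 * W + 30) ∧ HeapInv n (heapOf τ) (τ.ra 3) n ∧
      HoldsRoots n ∅ τ ∧ τ.nv 5 = z ∧ (∀ w, τ.na 5 w = 0 ↔ σ.na 5 w = 0 ∨ w = z) ∧
      pot n τ ≤ pot n σ + 100 * W ∧ σ.nv 8 ≤ τ.nv 8 + 1) t σ := by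
  have hzs : σ.na 5 z = 1 := by
    obtain ⟨v, hv, hs, -⟩ := hL.mem _ hi
    rw [hz] at hv
    rw [hv]; exact hs
  simp only [removeRoot, WP.seq_iff, WP.setNat_iff, WP.putNat_iff, NExp.eval, NExp.size,
    State.setN_nv, State.setN_na, hz]
  norm_num only
  simp only [if_true, if_false]
  refine ⟨by omega, by omega, by omega, ?_⟩
  refine WP.loop (fun t' τ => HeapInv n (heapOf τ) (τ.ra 3) n ∧ HoldsRoots n {z} τ ∧
    (∀ w, τ.na 5 w = 0 ↔ σ.na 5 w = 0) ∧ τ.na 5 z = 1 ∧ τ.na 8 z ≤ W ∧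
    70 * τ.na 8 z + 10 ≤ t' ∧ t + 70 * τ.na 8 z ≤ t' + (70 * W + 15) ∧
    pot n τ + 100 * τ.na 8 z ≤ pot n σ + 100 * W ∧ σ.nv 8 ≤ τ.nv 8 + 1) ?_ ?_
  · refine ⟨by simpa [heapOf] using h, ?_, by simp, by simpa using hzs, by simpa using hdW, ?_, ?_,
      ?_, by simp; omega⟩
    · rw [HoldsRoots]
      simp only [State.setN_nv, State.setN_na, State.putN_na, State.putN_nv]
      norm_num only
      simp only [if_true, if_false]
      refine (hL.erase hi).congr fun w => ?_
      simp [hz, Fin.ext_iff, eq_comm]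
    · simp; omega
    · simp; omega
    · simp [pot]; omega
  · rintro t' τ hf ⟨⟨ln, tm, hH⟩, hR, h0, hzs', hW, ht1, ht2, hp, h8⟩
    have h5 : τ.nv 5 = z := by rw [hf.nv 5 rfl]; simp
    have hn' : τ.nv 0 = n := by rw [hf.nv 0 rfl]; simpa using hn
    simp only [BExp.eval, BExp.size, NExp.eval, NExp.size, h5]
    refine ⟨by omega, fun hd => ?_, fun hd => ?_⟩
    · obtain ⟨d, hd'⟩ : ∃ d, τ.na 8 z = d + 1 := ⟨τ.na 8 z - 1, by omega⟩
      obtain ⟨hu, hus, huz, -⟩ := hH.slot z z.2 (show τ.na 5 z ≠ 0 by omega) d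
        (show d < τ.na 8 z by omega)
      set u := τ.na 10 (d * n + z) with hudef
      change u < n at hu
      change τ.na 5 u = 2 at hus
      change τ.na 6 u = z at huz
      refine WP.seq (WP.setNat (by simp [NExp.size]; omega) ?_)
      simp only [NExp.eval, NExp.size, h5, hn', hd', Nat.add_sub_cancel, ← hudef]
      have huz' : u ≠ z := by intro hh; rw [hh] at hus; omega
      refine (cutProg_inv (n := n) (X := {z}) (by simpa using hn') (by omega)
        (by simpa [HoldsRoots] using hR) (by simpa using hu) ?_ (by simpa using hus)).conseq ?_
      · simpa [Fin.ext_iff] using huz'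
      rintro t2 τ2 hf2 ⟨ht2', hc, hR2, -, hp2, h82⟩
      have hc' : heapOf τ2 = (heapOf τ).cut n u := by
        rw [hc]; simp [heapOf]
      have hr : τ2.ra 3 = τ.ra 3 := hf2.ra 3 rfl
      have hs2 : τ2.na 5 = Function.update (τ.na 5) u 1 := congrArg Heap.stat hc'
      have hd2 : τ2.na 8 = Function.update (τ.na 8) (τ.na 6 u) (τ.na 8 (τ.na 6 u) - 1) :=
        congrArg Heap.deg hc'
      have hzs2 : τ2.na 5 z = 1 := by rw [hs2, Function.update_of_ne huz'.symm, hzs']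
      have hdz : τ2.na 8 z = d := by rw [hd2, huz, Function.update_self]; omega
      have hpot : pot n (τ.setN 9 u) = pot n τ := by simp [pot]
      simp only [State.setN_nv] at h82
      norm_num only at h82
      simp only [if_false] at h82
      refine ⟨?_, hR2, fun w => ?_, hzs2, by omega, by omega, by omega, by omega, by omega⟩
      · have := hH.cut hu hus (Or.inr rfl)
        rw [← hc', ← hr] at this
        exact HeapInv.congr_exception ⟨ln, tm, this⟩ (Or.inr (by
          rw [show (heapOf τ).par u = z from huz]
          exact fun hh : τ2.na 5 z = 2 => by omega)) n
      · rw [← h0, hs2, Function.update_apply]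
        split_ifs with hw
        · simp [hw, hus]
        · rfl
    · have hd0 : τ.na 8 z = 0 := by omega
      refine WP.putNat (by simp [NExp.size]; omega) ?_
      simp only [NExp.eval, NExp.size, h5]
      refine ⟨by omega, ?_, ?_, by simpa using h5, fun w => ?_, ?_, by simpa using h8⟩
      · have := HeapInv.remove ⟨ln, tm, hH⟩ (z := z) hzs' hd0
        simpa [heapOf] using this
      · rw [HoldsRoots]
        simp only [State.putN_na, State.putN_nv, if_true]
        norm_num only
        refine Lists.congr hR fun w => ?_
        rw [Function.update_apply]
        by_cases hw : w = z
        · simp [hw]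
        · have : (w : ℕ) ≠ z := fun hh => hw (Fin.ext hh)
          simp [hw, this]
      · simp only [State.putN_na, if_true, Function.update_apply]
        split_ifs with hw
        · simp [hw]
        · simp [hw, h0]
      · have : pot n (τ.putN 5 z 0) = pot n τ := by simp [pot]
        omega

end

/-! ### Closing labels by Dijkstra's algorithm -/

/-- Makes all vertices roots of degree `0`, computes the number of buckets (natural variable `14`),
three times the least exponent of a power of two that exceeds the number of vertices, and clears the
buckets. -/
def dijInit : Prog :=
  .forN 13 0 (.putNat 5 (.var 13) (.const 1) ;; .putNat 8 (.var 13) (.const 0) ;;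
    .putNat 9 (.var 13) (.const 0) ;; .putNat 11 (.var 13) (.var 13)) ;;
  .setNat 8 (.var 0) ;;
  .setNat 14 (.const 0) ;;
  .setNat 15 (.const 1) ;;
  .loop (.natLe (.var 15) (.var 0))
    (.setNat 15 (.mul (.var 15) (.const 2)) ;; .setNat 14 (.add (.var 14) (.const 3))) ;;
  .forN 13 14 (.putNat 12 (.var 13) (.const 0))

/-- Closes labels by Dijkstra's algorithm. -/
def dijClose : Prog :=
  buildAdj ;; dijInit ;;
  .loop (.natLe (.const 1) (.var 8))
    (findMin ;; removeRoot ;; consolidate ;; emptyBuckets ;; dijRelax.forOut)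

section

variable {n W k : ℕ} {σ : State} {t : ℕ}

theorem dijInit_spec {a : ℕ} (h0 : n ≠ 0) (hn : σ.nv 0 = n) (ha : a = Nat.log 2 n + 1)
    (ht : 30 * n + 50 * a + 50 ≤ t) :
    WP dijInit (fun t' τ => t ≤ t' + (30 * n + 50 * a + 50) ∧ HeapInv n (heapOf τ) (τ.ra 3) n ∧
      HoldsRoots n ∅ τ ∧ (∀ v < n, τ.na 5 v = 1) ∧ pot n τ = 100 * n ∧ τ.nv 14 = 3 * a ∧
      ∀ d < 3 * a, τ.na 12 d = 0) t σ := by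
  refine WP.seq (WP.forN n 12 (fun j τ => ∀ v < j, τ.na 5 v = 1 ∧ τ.na 8 v = 0 ∧ τ.na 9 v = 0 ∧
    τ.na 11 v = v) (by simp [hn]) (by simp) rfl rfl (by omega) (by simp) ?_ ?_)
  · intro j t τ hj hx hf hc hI
    simp only [WP.seq_iff, WP.putNat_iff, NExp.eval, NExp.size, State.putN_nv, hx]
    refine ⟨by omega, by omega, by omega, by omega, by omega, fun v hv => ?_⟩
    simp [Function.update_apply]
    by_cases hvj : v = j
    · simp [hvj]
    · simpa [hvj] using hI v (by omega)
  intro t1 τ1 hf1 ht1 hI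
  have hn1 : τ1.nv 0 = n := by rw [hf1.nv 0 rfl, hn]
  simp only [WP.seq_iff, WP.setNat_iff, NExp.eval, NExp.size, hn1]
  refine ⟨by omega, by omega, by omega, ?_⟩
  set σ2 := ((τ1.setN 8 n).setN 14 0).setN 15 1 with hσ2
  refine WP.loop (fun t' τ => ∃ b ≤ a, τ.nv 15 = 2 ^ b ∧ τ.nv 14 = 3 * b ∧
    12 * (a - b) + 36 * a + 12 ≤ t' ∧ t + 12 * (a - b) ≤ t' + (30 * n + 12 * a + 20)) ?_ ?_
  · exact ⟨0, by omega, by simp [hσ2], by simp [hσ2], by omega, by omega⟩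
  rintro t3 τ3 hf3 ⟨b, hb, h15, h14, ht3, ht3'⟩
  have hn3 : τ3.nv 0 = n := by rw [hf3.nv 0 rfl]; simpa [hσ2] using hn1
  have hlog : 2 ^ b ≤ n ↔ b < a := by
    rw [ha, Nat.lt_succ_iff]
    constructor
    · intro h; exact Nat.le_log_of_pow_le (by omega) h
    · intro h
      exact Nat.pow_le_of_le_log h0 h
  simp only [BExp.eval, BExp.size, NExp.eval, NExp.size, h15, hn3, hlog]
  refine ⟨by omega, fun hlt => ?_, fun hge => ?_⟩
  · simp only [WP.seq_iff, WP.setNat_iff, NExp.eval, NExp.size]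
    refine ⟨by omega, by omega, b + 1, by omega, by simp [h15, pow_succ], by simp [h14]; omega,
      by omega, by omega⟩
  obtain rfl : b = a := by omega
  have e3 : ∀ i, τ3.na i = τ1.na i := fun i => by rw [hf3.na i rfl]; simp [hσ2]
  refine WP.forN (3 * b) 3 (fun j τ => ∀ d < j, τ.na 12 d = 0)
    (by simp [h14]) (by simp) rfl rfl (by omega) (by simp) ?_ ?_
  · intro j t τ hj hx hf hc hI
    refine WP.putNat (by simpa [NExp.size] using hc) ⟨by simp [NExp.size]; omega, ?_⟩
    intro u hu
    simp only [NExp.eval, hx, State.setN_na, State.putN_na, if_true, Function.update_apply]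
    split_ifs with hvj
    · rfl
    · exact hI u (by omega)
  intro t4 τ4 hf4 ht4 hb4
  have e4 : ∀ i, i ≠ 12 → τ4.na i = τ1.na i := fun i hi => by
    rw [hf4.na i (by simp [Prog.forN, Prog.wna, hi]), e3]
  have h8 : τ4.nv 8 = n := by rw [hf4.nv 8 rfl, hf3.nv 8 rfl]; simp [hσ2]
  refine ⟨by omega, HeapInv.init (fun u hu => ?_) (fun u hu => ?_) (fun u hu => ?_), ⟨?_, ?_, ?_⟩,
    fun v hv => ?_, ?_, by rw [hf4.nv 14 rfl, h14], hb4⟩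
  · show τ4.na 5 u = 1
    rw [e4 5 (by decide)]; exact (hI u hu).1
  · show τ4.na 8 u = 0
    rw [e4 8 (by decide)]; exact (hI u hu).2.1
  · show τ4.na 9 u = 0
    rw [e4 9 (by decide)]; exact (hI u hu).2.2.1
  · intro j hj
    rw [h8] at hj
    rw [e4 11 (by decide), e4 5 (by decide)]
    exact ⟨⟨j, hj⟩, (hI j hj).2.2.2, (hI j hj).1, by simp⟩
  · intro i hi j hj hij
    rw [h8] at hi hj
    rw [e4 11 (by decide), (hI i hi).2.2.2, (hI j hj).2.2.2] at hij
    exact hij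
  · intro v _
    exact ⟨v, by rw [h8]; exact v.2, by rw [e4 11 (by decide), (hI v v.2).2.2.2]⟩
  · rw [e4 5 (by decide)]; exact (hI v hv).1
  · have h9 : ∑ i ∈ Finset.range n, τ4.na 9 i = 0 := Finset.sum_eq_zero fun i hi => by
      rw [e4 9 (by decide)]; exact (hI i (Finset.mem_range.1 hi)).2.2.1
    rw [pot, h8, h9, mul_zero, add_zero]

variable {G : WGraph} {c : Fin G.m → ℕ}

/-- The number of vertices that have not been scanned. -/
def alive (G : WGraph) (s : ℕ → ℕ) : ℕ := (Finset.univ.filter fun v : Fin G.n => s v ≠ 0).card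

/-- The number of edges that have not been scanned. -/
def aliveOut (G : WGraph) (s : ℕ → ℕ) : ℕ :=
  (Finset.univ.filter fun e : Fin G.m => s (G.src e) ≠ 0).card

theorem alive_remove {s s' : ℕ → ℕ} {z : Fin G.n} (hz : s z ≠ 0)
    (h : ∀ w, s' w = 0 ↔ s w = 0 ∨ w = z) : alive G s = alive G s' + 1 := by
  rw [alive, alive, ← Finset.card_insert_of_notMem (a := z) (by simp [h])]
  congr 1
  ext v
  simp only [Finset.mem_filter, Finset.mem_univ, true_and, Finset.mem_insert, Ne, h, not_or,
    Fin.ext_iff]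
  by_cases hv : (v : ℕ) = z
  · simp [hv, hz]
  · simp [hv]

theorem aliveOut_remove {s s' : ℕ → ℕ} {z : Fin G.n} (hz : s z ≠ 0)
    (h : ∀ w, s' w = 0 ↔ s w = 0 ∨ w = z) :
    aliveOut G s = aliveOut G s' + (Finset.univ.filter fun e => G.src e = z).card := by
  rw [aliveOut, aliveOut, ← Finset.card_union_of_disjoint]
  · congr 1
    ext e
    simp only [Finset.mem_filter, Finset.mem_univ, true_and, Finset.mem_union, Ne, h, not_or,
      Fin.ext_iff]
    by_cases he : (G.src e : ℕ) = z
    · simp [he, hz]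
    · simp [he]
  · rw [Finset.disjoint_filter]
    intro e _ h1 h2
    exact h1 ((h _).2 (Or.inr (by rw [h2])))

theorem DijInv.mono {y₀ : ℕ → ℝ} {z : Fin G.n} {j j' : ℕ} (h : DijInv G c y₀ W z j σ)
    (hj : ∀ e, G.src e = z → j' ≤ e.val → j ≤ e.val) : DijInv G c y₀ W z j' σ :=
  ⟨h.heap, h.roots, h.scanned_le, h.le_z, fun e hc hs he => h.closed e hc hs fun hz => hj e hz (he hz),
    h.relaxed, h.bucket⟩

theorem DijInv.scanned_of_roots_eq_zero {z : Fin G.n} {y₀ : ℕ → ℝ} (h : DijInv G c y₀ W z 0 σ)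
    (h8 : σ.nv 8 = 0) (v : Fin G.n) : σ.na 5 v = 0 := by
  by_contra hv
  obtain ⟨w, hw, hs, -⟩ := h.heap.exists_root_le v.2 hv
  obtain ⟨i, hi, -⟩ := h.roots.all ⟨w, hw⟩ ⟨hs, by simp⟩
  omega

/-- One round of Dijkstra's algorithm, with the amortized cost of removing a root. -/
theorem dijStep_spec {y₀ : ℕ → ℝ} {a : ℕ} {z₀ : Fin G.n} {B : ℕ} (hN : HoldsNet G c σ)
    (hA : HoldsAdj G σ) (hW : W = 3 * a) (ha : G.n < 2 ^ a) (hW' : σ.nv 14 = W)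
    (h : DijInv G c y₀ W z₀ 0 σ) (h8 : 1 ≤ σ.nv 8)
    (ht : pot G.n σ + (300 * W + 150) * alive G (σ.na 5) + 450 * aliveOut G (σ.na 5) + B ≤ t) :
    WP (findMin ;; removeRoot ;; consolidate ;; emptyBuckets ;; dijRelax.forOut)
      (fun t' τ => (∃ z, DijInv G c y₀ W z 0 τ) ∧
        pot G.n τ + (300 * W + 150) * alive G (τ.na 5) + 450 * aliveOut G (τ.na 5) + B + 3 ≤ t')
      t σ := by
  set k := σ.nv 8 with hk
  -- the root that will be removed
  have hdW : ∀ τ : State, HeapInv G.n (heapOf τ) (τ.ra 3) G.n → ∀ v < G.n, τ.na 5 v = 1 →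
      τ.na 8 v < W := by
    intro τ hτ v hv hs
    by_contra hd
    have := hτ.two_pow_le (u := v) (a := a) hv (show τ.na 5 v ≠ 0 by omega)
      (show 3 * a ≤ τ.na 8 v by omega)
    omega
  obtain ⟨v₀, -, hv₀, -⟩ := h.roots.mem 0 h8
  have hal : 1 ≤ alive G (σ.na 5) := Finset.card_pos.2 ⟨v₀, by simp [hv₀]⟩
  have hDal : 300 * W + 150 ≤ (300 * W + 150) * alive G (σ.na 5) := Nat.le_mul_of_pos_right _ hal
  have hpk : 100 * k ≤ pot G.n σ := by simp only [pot, hk]; omega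
  refine WP.seq ((findMin_spec rfl h8 (by omega)).conseq fun t1 τ1 hf1 ⟨ht1, hi1, hmin⟩ => ?_)
  have e5 : τ1.na 5 = σ.na 5 := hf1.na 5 rfl
  have e11 : τ1.na 11 = σ.na 11 := hf1.na 11 rfl
  have e8 : τ1.nv 8 = k := hf1.nv 8 rfl
  have e3 : τ1.ra 3 = σ.ra 3 := hf1.ra 3 rfl
  have eH : heapOf τ1 = heapOf σ := by
    simp only [heapOf]
    rw [hf1.na 5 rfl, hf1.na 6 rfl, hf1.na 7 rfl, hf1.na 8 rfl, hf1.na 9 rfl, hf1.na 10 rfl]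
  have hN1 := hN.frame hf1 rfl
  obtain ⟨z, hz, hzs, -⟩ := h.roots.mem _ hi1
  have hzmin : ∀ w : Fin G.n, σ.na 5 w ≠ 0 → σ.ra 3 z ≤ σ.ra 3 w := by
    intro w hw
    obtain ⟨r, hr, hrs, hrw⟩ := h.heap.exists_root_le w.2 hw
    obtain ⟨i, hi, he⟩ := h.roots.all ⟨r, hr⟩ ⟨hrs, by simp⟩
    have := hmin i hi
    rw [e3, e11, hz, he] at this
    exact this.trans hrw
  have hzW := hdW σ h.heap z z.2 hzs
  refine WP.seq ((removeRoot_spec (W := W) hN1.n (by rw [eH, e3]; exact h.heap)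
    (by rw [HoldsRoots, e11, e8, e5]; exact h.roots) (by rw [e11]; exact hz) (by rw [e8]; exact hi1)
    (by rw [hf1.na 8 rfl]; exact hzW.le) (by omega)).conseq ?_)
  rintro t2 τ2 hf2 ⟨ht2, hH2, hR2, hz2, h02, hp2, hk2⟩
  have hp1 : pot G.n τ1 = pot G.n σ := by simp only [pot]; rw [e8, hf1.na 9 rfl]
  rw [hp1] at hp2
  rw [e8] at hk2
  rw [e5] at h02
  have hN2 := hN1.frame hf2 rfl
  have hb2 : ∀ d < W, τ2.na 12 d = 0 := by
    rw [hf2.na 12 rfl, hf1.na 12 rfl]; exact h.bucket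
  have hal2 : alive G (σ.na 5) = alive G (τ2.na 5) + 1 := alive_remove (by omega) h02
  have hao2 := aliveOut_remove (G := G) (z := z) (by omega) h02
  set cz := (Finset.univ.filter fun e => G.src e = z).card with hcz
  rw [hal2, mul_add, mul_one] at ht
  rw [hao2] at ht
  set al := (300 * W + 150) * alive G (τ2.na 5) with hal
  set ao := aliveOut G (τ2.na 5) with hao
  set mk := ∑ i ∈ Finset.range G.n, τ2.na 9 i with hmk
  have hp2' : pot G.n τ2 = 100 * τ2.nv 8 + 200 * mk := rfl
  refine WP.seq ((consolidate_spec (B := 200 * mk + 130 * W + 20 + 450 * cz + al + 450 * ao + B)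
    hN2.n hW ha hH2 hR2 hb2 (by omega)).conseq ?_)
  rintro t3 τ3 hf3 ⟨ht3, hC, h03⟩
  have hW3 : τ3.nv 14 = W := by rw [hf3.nv 14 rfl, hf2.nv 14 rfl, hf1.nv 14 rfl, hW']
  refine WP.seq ((emptyBuckets_spec hC hW3 (hdW τ3 hC.heap) (by omega)).conseq ?_)
  rintro t4 τ4 hf4 ⟨ht4, hR4, h84, hb4⟩
  have hN4 := (hN2.frame hf3 rfl).frame hf4 rfl
  have hA4 : HoldsAdj G τ4 := by
    refine ⟨?_, ?_⟩
    · rw [hf4.na 3 rfl, hf3.na 3 rfl, hf2.na 3 rfl, hf1.na 3 rfl, hf4.na 0 rfl, hf3.na 0 rfl,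
        hf2.na 0 rfl, hf1.na 0 rfl]
      exact hA.head
    · rw [hf4.na 4 rfl, hf3.na 4 rfl, hf2.na 4 rfl, hf1.na 4 rfl, hf4.na 0 rfl, hf3.na 0 rfl,
        hf2.na 0 rfl, hf1.na 0 rfl]
      exact hA.next
  have e43 : τ4.ra 3 = σ.ra 3 := by rw [hf4.ra 3 rfl, hf3.ra 3 rfl, hf2.ra 3 rfl, e3]
  have h42 : ∀ w, τ4.na 5 w = 0 ↔ τ2.na 5 w = 0 := by rw [hf4.na 5 rfl]; exact h03
  have h40 : ∀ w, τ4.na 5 w = 0 ↔ σ.na 5 w = 0 ∨ w = z := fun w => (h42 w).trans (h02 w)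
  have hp4 : pot G.n τ4 = 100 * τ4.nv 8 + 200 * mk := by
    rw [pot, hf4.na 9 rfl, hf3.na 9 rfl]
  have hz4 : τ4.nv 5 = z := by rw [hf4.nv 5 rfl, hf3.nv 5 rfl, hz2]
  have hH4 : HeapInv G.n (heapOf τ4) (τ4.ra 3) G.n := by
    have : heapOf τ4 = heapOf τ3 := by
      simp only [heapOf]
      rw [hf4.na 5 rfl, hf4.na 6 rfl, hf4.na 7 rfl, hf4.na 8 rfl, hf4.na 9 rfl, hf4.na 10 rfl]
    rw [this, hf4.ra 3 rfl]; exact hC.heap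
  have hD4 : DijInv G c y₀ W z G.m τ4 := by
    refine ⟨hH4, hR4, fun u w hu hw => ?_, fun u hu => ?_, fun e hc he hj => ?_, ?_, hb4⟩
    · rw [e43]
      rw [h40] at hu
      rw [Ne, h40, not_or] at hw
      rcases hu with hu | hu
      · exact h.scanned_le u w hu hw.1
      · rw [hu]; exact hzmin w hw.1
    · rw [e43]
      rcases (h40 u).1 hu with hu | hu
      · exact h.scanned_le u z hu (by omega)
      · rw [hu]
    · rw [e43]
      rcases (h40 _).1 he with he | he
      · exact h.closed e hc he fun _ => Nat.zero_le _
      · have := hj (Fin.ext he); have := e.2; omega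
    · rw [e43]; exact h.relaxed
  have hfin : ∀ s : ℕ → ℕ, (∀ w, s w = 0 ↔ τ4.na 5 w = 0) →
      (300 * W + 150) * alive G s + 450 * aliveOut G s = al + 450 * ao := by
    intro s hs
    simp only [hal, hao, alive, aliveOut, Ne, hs, h42]
  refine WP.forOut (c := c) z (fun j t τ => DijInv G c y₀ W z j τ ∧
    pot G.n τ + 440 * (Finset.univ.filter fun e => G.src e = z ∧ e.val < j).card +
      al + 450 * ao + B + 3 ≤ t ∧ ∀ w, τ.na 5 w = 0 ↔ τ4.na 5 w = 0) (t4 - 10 * cz - 6)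
    hN4 hA4 hz4 rfl rfl (by omega) ⟨hD4, ?_, fun w => Iff.rfl⟩ ?_ ?_ ?_ ?_
  · simp only [Fin.is_lt, and_true]
    omega
  · rintro j j' t τ hj he ⟨h1, h2, h3⟩
    have hle : (Finset.univ.filter fun e => G.src e = z ∧ e.val < j').card ≤
        (Finset.univ.filter fun e => G.src e = z ∧ e.val < j).card :=
      Finset.card_le_card fun e => by
        simp only [Finset.mem_filter, Finset.mem_univ, true_and]
        exact fun h => ⟨h.1, by omega⟩
    exact ⟨h1.mono he, by omega, h3⟩
  · rintro j t τ v ⟨h1, h2, h3⟩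
    refine ⟨⟨⟨h1.heap, ?_, h1.scanned_le, h1.le_z, h1.closed, h1.relaxed, h1.bucket⟩, ?_, h3⟩,
      ⟨⟨h1.heap, ?_, h1.scanned_le, h1.le_z, h1.closed, h1.relaxed, h1.bucket⟩, ?_, h3⟩⟩
    · simpa [HoldsRoots] using h1.roots
    · simpa [pot] using h2
    · simpa [HoldsRoots] using h1.roots
    · simpa [pot] using h2
  · rintro e t τ rfl h7 hfr ⟨h1, h2, h3⟩
    have hce : (Finset.univ.filter fun e' => G.src e' = G.src e ∧ e'.val < e + 1).card =
        (Finset.univ.filter fun e' => G.src e' = G.src e ∧ e'.val < e).card + 1 :=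
      card_filter_lt_succ rfl
    rw [hce] at h2
    refine (dijRelax_spec (B := 440 * (Finset.univ.filter fun e' =>
      G.src e' = G.src e ∧ e'.val < e).card + al + 450 * ao + B + 3) (hN4.frame hfr rfl)
      (by rw [hfr.nv 5 rfl, hz4]) h7 ((h3 _).2 ((h40 _).2 (Or.inr rfl))) h1 (by omega)).conseq ?_
    rintro t' τ' hf' ⟨g1, g2, g3⟩
    exact ⟨g1, by omega, fun w => (g3 w).trans (h3 w)⟩
  · rintro t₁ t' τ hfr hle ⟨h1, h2, h3⟩
    refine ⟨⟨z, h1⟩, ?_⟩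
    have := hfin (τ.na 5) h3
    omega

theorem dijClose_closes (hn : G.n ≠ 0) :
    Closes dijClose G c (500 * G.m + 300 * G.n +
      (900 * G.n + 50) * (Nat.log 2 G.n + 1) + 100) := by
  set a := Nat.log 2 G.n + 1 with ha
  have hna : G.n < 2 ^ a := Nat.lt_pow_succ_log_self (by norm_num) _
  set F := 500 * G.m + 300 * G.n + (900 * G.n + 50) * a + 100 with hF
  intro t σ hN _ ht
  suffices WP dijClose (fun t' τ => (∀ v : Fin G.n, τ.ra 3 v ≤ σ.ra 3 v) ∧
      (∀ e, c e = 0 → τ.ra 3 (G.tgt e) ≤ τ.ra 3 (G.src e) + G.r e) ∧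
      ∀ Q : Fin G.n → ℝ → Prop, (∀ e y, c e = 0 → Q (G.src e) y → Q (G.tgt e) (y + G.r e)) →
        (∀ v, Q v (σ.ra 3 v)) → ∀ v, Q v (τ.ra 3 v)) F σ by
    have h := this.add_fuel (t - F)
    rw [Nat.add_sub_cancel' ht] at h
    exact h.conseq fun t' τ _ ⟨h1, h2⟩ => ⟨by omega, h2⟩
  have hFa : F = 500 * G.m + 300 * G.n + 900 * (G.n * a) + 50 * a + 100 := by rw [hF]; ring
  clear_value F
  refine WP.seq ((buildAdj_spec hN (by omega)).conseq fun t1 τ1 hf1 ⟨ht1, hA⟩ => ?_)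
  have hN1 := hN.frame hf1 rfl
  refine WP.seq ((dijInit_spec hn hN1.n ha (by omega)).conseq ?_)
  rintro t2 τ2 hf2 ⟨ht2, hH, hR, hs, hp, hW, hb⟩
  have hN2 := hN1.frame hf2 rfl
  have hA2 : HoldsAdj G τ2 := by
    refine ⟨?_, ?_⟩
    · rw [hf2.na 3 rfl, hf2.na 0 rfl]; exact hA.head
    · rw [hf2.na 4 rfl, hf2.na 0 rfl]; exact hA.next
  have e3 : τ2.ra 3 = σ.ra 3 := by rw [hf2.ra 3 rfl, hf1.ra 3 rfl]
  refine WP.loop (fun t' τ => (∃ z, DijInv G c (σ.ra 3) (3 * a) z 0 τ) ∧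
    pot G.n τ + (300 * (3 * a) + 150) * alive G (τ.na 5) + 450 * aliveOut G (τ.na 5) + 0 + 3 ≤ t')
    ⟨⟨⟨0, Nat.pos_of_ne_zero hn⟩, hH, hR, ?_, ?_, ?_, ?_, hb⟩, ?_⟩ ?_
  · intro u w hu _; have := hs u u.2; omega
  · intro u hu; have := hs u u.2; omega
  · intro e _ hu _; have := hs _ (G.src e).2; omega
  · rw [e3]; exact Relaxed.refl _ _ _
  · have h1 : alive G (τ2.na 5) ≤ G.n := (Finset.card_le_univ _).trans (by simp)
    have h2 : aliveOut G (τ2.na 5) ≤ G.m := (Finset.card_le_univ _).trans (by simp)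
    have h3 : (300 * (3 * a) + 150) * alive G (τ2.na 5) ≤ (300 * (3 * a) + 150) * G.n :=
      Nat.mul_le_mul_left _ h1
    have h4 : (300 * (3 * a) + 150) * G.n = 900 * (G.n * a) + 150 * G.n := by ring
    omega
  · rintro t3 τ3 hf3 ⟨⟨z, hD⟩, ht3⟩
    simp only [BExp.eval, BExp.size, NExp.eval, NExp.size]
    refine ⟨by omega, fun h1 => ?_, fun h1 => ?_⟩
    · refine dijStep_spec (B := 0) (hN2.frame hf3 rfl) ⟨?_, ?_⟩ rfl hna ?_ hD h1 (by omega)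
      · rw [hf3.na 3 rfl, hf3.na 0 rfl]; exact hA2.head
      · rw [hf3.na 4 rfl, hf3.na 0 rfl]; exact hA2.next
      · rw [hf3.nv 14 rfl, hW]
    · exact ⟨hD.relaxed.1, fun e hc => hD.closed e hc (DijInv.scanned_of_roots_eq_zero hD (by omega) _)
        fun _ => Nat.zero_le _, hD.relaxed.2⟩

end

/-! ### Finding a path of least integer cost -/

/-- Tests whether the entry of the vertex in the natural variable `5` in the last row (its index is
in the natural variable `3`) is at most the real variable `5`. -/
def isFeasible : BExp :=
  .and (.realLe (.ofNat (.const 0)) (.get 2 (.add (.mul (.var 3) (.var 0)) (.var 5))))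
    (.realLe (.get 2 (.add (.mul (.var 3) (.var 0)) (.var 5))) (.var 5))

/-- Computes rows for positive integer costs until there is a path to the vertex in the natural
variable `5` whose resource consumption is at most the real variable `5`. -/
def rowsUntil : Prog :=
  .setNat 3 (.const 0) ;; rowProg .skip ;;
  .loop (.not isFeasible) (.setNat 3 (.add (.var 3) (.const 1)) ;; rowProg .skip)

/-- The entry of the vertex in the natural variable `6` in the row in the natural variable `7` comes
from the edge in the natural variable `4`. -/
def isTight : BExp :=
  .and (.and (.natLe (.get 1 (.var 4)) (.var 6)) (.natLe (.var 6) (.get 1 (.var 4))))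
    (.and (.natLe (.get 2 (.var 4)) (.var 7))
      (.and (.realLe (.ofNat (.const 0))
          (.get 2 (.add (.mul (.sub (.var 7) (.get 2 (.var 4))) (.var 0)) (.get 0 (.var 4)))))
        (.realLe (.add
          (.get 2 (.add (.mul (.sub (.var 7) (.get 2 (.var 4))) (.var 0)) (.get 0 (.var 4))))
          (.get 1 (.var 4)))
          (.get 2 (.add (.mul (.var 7) (.var 0)) (.var 6))))))

/-- The entry of the vertex in the natural variable `6` in the row in the natural variable `7` is
that of the previous row. -/
def isOld : BExp :=
  .and (.natLe (.const 1) (.var 7))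
    (.and (.realLe (.ofNat (.const 0))
        (.get 2 (.add (.mul (.sub (.var 7) (.const 1)) (.var 0)) (.var 6))))
      (.realLe (.get 2 (.add (.mul (.sub (.var 7) (.const 1)) (.var 0)) (.var 6)))
        (.get 2 (.add (.mul (.var 7) (.var 0)) (.var 6)))))

/-- Traces an optimal path back, and stores it in reverse order in the natural array `3`, its length
being in the natural variable `8`. -/
def traceBack : Prog :=
  .setNat 6 (.var 5) ;; .setNat 7 (.var 3) ;; .setNat 8 (.const 0) ;;
  .loop (.not (.and (.natLe (.var 6) (.var 2)) (.natLe (.var 2) (.var 6))))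
    (.cond isOld (.setNat 7 (.sub (.var 7) (.const 1)))
      (.forN 4 1 (.cond isTight (.setNat 9 (.var 4)) .skip) ;;
        .putNat 3 (.var 8) (.var 9) ;;
        .setNat 8 (.add (.var 8) (.const 1)) ;;
        .setNat 7 (.sub (.var 7) (.get 2 (.var 9))) ;;
        .setNat 6 (.get 0 (.var 9))))

/-- Outputs a path that is stored in reverse order. -/
def outputPath : Prog :=
  .forN 4 8 (.putNat 0 (.var 4) (.get 3 (.sub (.sub (.var 8) (.const 1)) (.var 4)))) ;;
  .setNat 0 (.const 1) ;; .setNat 1 (.var 8)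

section

variable {G : WGraph} {c : Fin G.m → ℕ} {s t : Fin G.n} {R : ℝ} {σ : State} {f : ℕ}

theorem closes_skip (hc : ∀ e, 1 ≤ c e) : Closes .skip G c 1 := by
  intro t σ _ _ ht
  exact WP.skip ht ⟨by omega, fun v => le_rfl, fun e he => by have := hc e; omega,
    fun Q _ h => h⟩

/-- The row `i` is the first one whose entry for `t` is at most `R`. -/
structure FirstRow (G : WGraph) (c : Fin G.m → ℕ) (s t : Fin G.n) (R : ℝ) (i : ℕ) (σ : State) :
    Prop where
  rows : HoldsRows G c s (i + 1) σ
  idx : σ.nv 3 = i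
  le : σ.ra 2 (i * G.n + t) ≤ R
  nonneg : 0 ≤ σ.ra 2 (i * G.n + t)
  first : ∀ q, G.IsWalk s q t → G.res q ≤ R → i ≤ (q.map c).sum

theorem rowsUntil_spec {M : ℕ} (hc : ∀ e, 1 ≤ c e) (hN : HoldsNet G c σ) (h2 : σ.nv 2 = s)
    (h5 : σ.nv 5 = t) (hR : σ.rv 5 = R) {p : List (Fin G.m)} (hp : G.IsWalk s p t)
    (hpR : G.res p ≤ R) (hpM : (p.map c).sum ≤ M)
    (hf : (M + 1) * (90 * G.m + 60 * G.n + 80) + 50 ≤ f) :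
    WP rowsUntil (fun f' τ => f ≤ f' + ((M + 1) * (90 * G.m + 60 * G.n + 80) + 50) ∧
      ∃ i ≤ M, FirstRow G c s t R i τ) f σ := by
  set L := 90 * G.m + 60 * G.n + 80 with hL
  rw [add_mul, one_mul] at hf ⊢
  refine WP.seq (WP.setNat (by simp [NExp.size]; omega) (WP.seq ?_))
  simp only [NExp.eval, NExp.size]
  have hrow : ∀ {k t σ}, HoldsRows G c s k σ → σ.nv 3 = k → 90 * G.m + 60 * G.n + 51 ≤ t →
      WP (rowProg .skip) (fun t' τ => t ≤ t' + (90 * G.m + 60 * G.n + 51) ∧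
        HoldsRows G c s (k + 1) τ) t σ := fun h hk ht =>
    rowProg_spec (closes_skip hc) rfl rfl rfl h hk ht
  have h0 : HoldsRows G c s 0 (σ.setN 3 0) :=
    ⟨hN.n, hN.m, h2, hN.src, hN.tgt, hN.costs, hN.r, by simp⟩
  refine (hrow h0 (by simp) (by omega)).conseq fun f1 τ1 hf1 ⟨hf1', hR1⟩ => ?_
  refine WP.loop (fun f' τ => ∃ i ≤ M, HoldsRows G c s (i + 1) τ ∧ τ.nv 3 = i ∧ τ.nv 5 = t ∧
    τ.rv 5 = R ∧ (∀ q, G.IsWalk s q t → G.res q ≤ R → i ≤ (q.map c).sum) ∧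
    (M - i) * L + 30 ≤ f' ∧ f + (M - i) * L ≤ f' + (M * L + L + 2)) ?_ ?_
  · refine ⟨0, by omega, hR1, ?_, ?_, ?_, by simp, by simp; omega, by simp; omega⟩
    · rw [hf1.nv 3 rfl]; simp
    · rw [hf1.nv 5 rfl]; simpa using h5
    · rw [hf1.rv 5 rfl]; simpa using hR
  rintro f2 τ2 - ⟨i, hi, hR2, h3, h5, hR, hq, hf2, hf2'⟩
  have hE := hR2.rows i (by omega) t
  simp only [isFeasible, BExp.eval, BExp.size, NExp.eval, NExp.size, RExp.eval, RExp.size, h3, h5,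
    hR, hR2.n, Nat.cast_zero]
  refine ⟨by omega, fun hn => ?_, fun hn => ?_⟩
  · have hq' : ∀ q, G.IsWalk s q t → G.res q ≤ R → i + 1 ≤ (q.map c).sum := by
      intro q hw hr
      by_contra hlt
      have := hE.of_walk hw (by omega)
      exact hn ⟨this.1, this.2.trans hr⟩
    have hiM : i + 1 ≤ M := (hq' p hp hpR).trans hpM
    obtain ⟨d, hd⟩ : ∃ d, M - i = d + 1 := ⟨M - i - 1, by omega⟩
    have hd' : M - (i + 1) = d := by omega
    rw [hd, add_mul] at hf2 hf2'
    refine WP.seq (WP.setNat (by simp [NExp.size]; omega) ?_)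
    simp only [NExp.eval, NExp.size, h3]
    refine (hrow (hR2.setN (by omega) _) (by simp) (by omega)).conseq fun f3 τ3 hf3 ⟨hf3', hR3⟩ =>
      ⟨i + 1, hiM, hR3, ?_, ?_, ?_, hq', ?_, ?_⟩
    · rw [hf3.nv 3 rfl]; simp
    · rw [hf3.nv 5 rfl]; simpa using h5
    · rw [hf3.rv 5 rfl]; simpa using hR
    · rw [hd']; omega
    · rw [hd']; omega
  · rw [not_not] at hn
    exact ⟨by omega, i, hi, hR2, h3, hn.2, hn.1, hq⟩

/-- The state of tracing back: `q` is a walk from `v` to `t`, and the path to `v` that is encoded in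
row `i` completes it to an optimal path.  No vertex of `q` other than `v` can be reached by a walk of
cost at most `i` as cheaply as `v`, which ensures that no vertex is visited twice. -/
structure TraceInv (G : WGraph) (c : Fin G.m → ℕ) (s t : Fin G.n) (R : ℝ) (D : ℕ → ℝ) (i₀ : ℕ)
    (v : Fin G.n) (i : ℕ) (q : List (Fin G.m)) : Prop where
  path : G.IsPath v q t
  cost : (q.map c).sum + i ≤ i₀
  nonneg : 0 ≤ D (i * G.n + v)
  res : D (i * G.n + v) + G.res q ≤ R
  apart : ∀ x ∈ q.map G.tgt, ∀ w, G.IsWalk s w x → (w.map c).sum ≤ i → D (i * G.n + v) < G.res w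

theorem TraceInv.old {D : ℕ → ℝ} {i₀ i : ℕ} {v : Fin G.n} {q : List (Fin G.m)}
    (h : TraceInv G c s t R D i₀ v (i + 1) q) (h0 : 0 ≤ D (i * G.n + v))
    (h1 : D (i * G.n + v) ≤ D ((i + 1) * G.n + v)) : TraceInv G c s t R D i₀ v i q :=
  ⟨h.path, by have := h.cost; omega, h0, by linarith [h.res],
    fun x hx w hw hc => h1.trans_lt (h.apart x hx w hw (by omega))⟩

theorem TraceInv.step {D : ℕ → ℝ} {i₀ i : ℕ} {q : List (Fin G.m)} {e : Fin G.m}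
    (h : TraceInv G c s t R D i₀ (G.tgt e) i q) (hc : 1 ≤ c e) (hci : c e ≤ i)
    (hE : ∀ j ≤ i, ∀ v, IsEntry G c s v j (D (j * G.n + v)))
    (hold : 0 ≤ D ((i - 1) * G.n + G.tgt e) → D (i * G.n + G.tgt e) < D ((i - 1) * G.n + G.tgt e))
    (h0 : 0 ≤ D ((i - c e) * G.n + G.src e))
    (h1 : D ((i - c e) * G.n + G.src e) + G.r e ≤ D (i * G.n + G.tgt e)) :
    TraceInv G c s t R D i₀ (G.src e) (i - c e) (e :: q) := by
  have hr := G.r_nonneg e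
  have hap : ∀ x ∈ (e :: q).map G.tgt, ∀ w, G.IsWalk s w x → (w.map c).sum ≤ i - c e →
      D ((i - c e) * G.n + G.src e) < G.res w := by
    intro x hx w hw hc'
    rcases List.mem_cons.1 hx with rfl | hx
    · have := (hE (i - 1) (by omega) (G.tgt e)).of_walk hw (by omega)
      linarith [hold this.1]
    · linarith [h.apart x hx w hw (by omega)]
  refine ⟨⟨⟨rfl, h.path.1⟩, List.nodup_cons.2 ⟨fun hx => ?_, h.path.2⟩⟩, ?_, h0, ?_, hap⟩
  · obtain ⟨w, hw, hwc, hwr⟩ := (hE (i - c e) (by omega) (G.src e)).exists_isPath h0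
    exact absurd hwr (hap _ hx w hw.1 hwc).ne'
  · have := h.cost
    simp only [List.map_cons, List.sum_cons]; omega
  · rw [G.res_cons]; linarith [h.res]

/-- In every row, an entry of a vertex other than `s` comes from some edge. -/
theorem exists_tight {D : ℕ → ℝ} {i : ℕ} {v : Fin G.n} (hv : v ≠ s)
    (hE : ∀ j ≤ i, ∀ v, IsEntry G c s v j (D (j * G.n + v))) (h0 : 0 ≤ D (i * G.n + v)) :
    ∃ e, G.tgt e = v ∧ c e ≤ i ∧ 0 ≤ D ((i - c e) * G.n + G.src e) ∧
      D ((i - c e) * G.n + G.src e) + G.r e ≤ D (i * G.n + v) := by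
  obtain ⟨p, hp, hpc, hpr⟩ := (hE i le_rfl v).exists_isPath h0
  rcases List.eq_nil_or_concat p with rfl | ⟨p, e, rfl⟩
  · exact absurd hp.1.symm hv
  rw [List.concat_eq_append] at hp hpc hpr
  obtain ⟨h1, h2⟩ := G.isWalk_concat.1 hp.1
  have hpc' : (p.map c).sum + c e ≤ i := by simpa using hpc
  have := (hE (i - c e) (by omega) (G.src e)).of_walk h1 (by omega)
  rw [G.res_concat] at hpr
  exact ⟨e, h2, by omega, this.1, by linarith⟩

theorem traceBack_spec {i₀ : ℕ} (hc : ∀ e, 1 ≤ c e) (h : FirstRow G c s t R i₀ σ)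
    (h5 : σ.nv 5 = t) (hf : (i₀ + 1) * (80 * G.m + 80) ≤ f) :
    WP traceBack (fun f' τ => f ≤ f' + (i₀ + 1) * (80 * G.m + 80) ∧ ∃ q, G.IsPath s q t ∧
      (q.map c).sum ≤ i₀ ∧ G.res q ≤ R ∧ τ.nv 8 = q.length ∧
      ∀ j (hj : j < q.length), τ.na 3 (q.length - 1 - j) = q[j]) f σ := by
  rw [add_mul, one_mul] at hf ⊢
  set L := 80 * G.m + 80 with hL
  set D := σ.ra 2 with hD
  have hE : ∀ i ≤ i₀, ∀ j ≤ i, ∀ v, IsEntry G c s v j (D (j * G.n + v)) := fun i hi j hj =>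
    h.rows.rows j (by omega)
  simp only [traceBack, WP.seq_iff, WP.setNat_iff, NExp.eval, NExp.size, State.setN_nv]
  norm_num only
  simp only [if_false, h5, h.idx]
  refine ⟨by omega, by omega, by omega, ?_⟩
  set σ1 := ((σ.setN 6 t).setN 7 i₀).setN 8 0 with hσ1
  have hR1 : HoldsRows G c s (i₀ + 1) σ1 :=
    ((h.rows.setN (by omega) _).setN (by omega) _).setN (by omega) _
  refine WP.loop (fun f' τ => ∃ v q i, τ.nv 6 = v.val ∧ τ.nv 7 = i ∧ τ.nv 8 = q.length ∧
    (∀ j (hj : j < q.length), τ.na 3 (q.length - 1 - j) = (q[j]).val) ∧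
    TraceInv G c s t R D i₀ v i q ∧ i * L + 12 ≤ f' ∧ f + i * L ≤ f' + (i₀ * L + 8)) ?_ ?_
  · refine ⟨t, [], i₀, by simp [hσ1], by simp [hσ1], by simp [hσ1], by simp,
      ⟨⟨rfl, by simp⟩, by simp, h.nonneg, ?_, by simp⟩, by omega, by omega⟩
    rw [G.res_nil, add_zero]; exact h.le
  rintro f2 τ2 hf2 ⟨v, q, i, h6, h7, h8, h3, hT, hf2', hf2''⟩
  have hR2 := hR1.frame hf2 rfl rfl
  have hD2 : τ2.ra 2 = D := by rw [hf2.ra 2 rfl]; simp [hσ1, hD]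
  have hi : i ≤ i₀ := by have := hT.cost; omega
  simp only [BExp.eval, BExp.size, NExp.eval, NExp.size, h6, hR2.start]
  refine ⟨by omega, fun hvs => ?_, fun hvs => ?_⟩
  swap
  · rw [not_not] at hvs
    obtain rfl : v = s := Fin.ext (by omega)
    exact ⟨by omega, q, hT.path, by have := hT.cost; omega, by linarith [hT.res, hT.nonneg], h8, h3⟩
  have hvs' : v ≠ s := by rintro rfl; exact hvs ⟨le_rfl, le_rfl⟩
  obtain ⟨e₀, he₀⟩ := exists_tight hvs' (hE i hi) hT.nonneg
  obtain ⟨d, rfl⟩ : ∃ d, i = d + 1 := ⟨i - 1, by have := hc e₀; omega⟩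
  rw [add_mul, one_mul] at hf2' hf2''
  rw [WP.cond_iff]
  simp only [isOld, BExp.eval, BExp.size, NExp.eval, NExp.size, RExp.eval, RExp.size, h6, h7, hR2.n,
    hD2, Nat.cast_zero, Nat.add_sub_cancel, Nat.le_add_left, true_and]
  refine ⟨by omega, fun ho => ?_, fun ho => ?_⟩
  · simp only [WP.setNat_iff, NExp.eval, NExp.size, h7, Nat.add_sub_cancel]
    exact ⟨by omega, v, q, d, by simpa using h6, by simp, by simpa using h8, by simpa using h3,
      hT.old ho.1 ho.2, by omega, by omega⟩
  set Good : Fin G.m → Prop := fun e => G.tgt e = v ∧ c e ≤ d + 1 ∧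
    0 ≤ D ((d + 1 - c e) * G.n + G.src e) ∧
    D ((d + 1 - c e) * G.n + G.src e) + G.r e ≤ D ((d + 1) * G.n + v) with hGood
  refine WP.seq (WP.forN G.m 60 (fun j τ => (∃ e, e.val < j ∧ Good e) →
    ∃ e, τ.nv 9 = e.val ∧ Good e) (by simp [hR2.m]) (by simp) rfl rfl (by omega) (by simp) ?_ ?_)
  · intro j f4 τ4 hj hx hf4 hf4' hI
    have hR4 := hR2.frame hf4 rfl rfl
    have e2 : τ4.ra 2 = D := by rw [hf4.ra 2 rfl, hD2]
    obtain ⟨e, rfl⟩ : ∃ e : Fin G.m, e.val = j := ⟨⟨j, hj⟩, rfl⟩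
    simp only [isTight, WP.cond_iff, WP.setNat_iff, WP.skip_iff, BExp.eval, BExp.size, NExp.eval,
      NExp.size, RExp.eval, RExp.size, hx, hf4.nv 6 rfl, hf4.nv 7 rfl, h6, h7, hR4.n, hR4.src,
      hR4.tgt, hR4.costs, hR4.r, e2, Nat.cast_zero]
    have hiff : ((G.tgt e : ℕ) ≤ v ∧ (v : ℕ) ≤ G.tgt e) ↔ G.tgt e = v :=
      ⟨fun h => Fin.ext (by omega), fun h => by simp [h]⟩
    rw [hiff]
    refine ⟨by omega, fun hg => ⟨by omega, by omega, fun _ => ⟨e, by simp, hg⟩⟩,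
      fun hg => ⟨by omega, by omega, ?_⟩⟩
    rintro ⟨e', he', hg'⟩
    obtain ⟨e'', h1, h2⟩ := hI ⟨e', by
      have : e'.val ≠ e := fun hh => hg ((Fin.ext hh : e' = e) ▸ hg')
      omega, hg'⟩
    exact ⟨e'', by simpa using h1, h2⟩
  intro f5 τ5 hf5 hf5' hI
  obtain ⟨e, h9, he⟩ := hI ⟨e₀, e₀.2, he₀⟩
  have hR5 := hR2.frame hf5 rfl rfl
  obtain ⟨rfl, he2, he3, he4⟩ := he
  have hT' := hT.step (hc e) he2 (hE _ hi) (fun h0 => by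
    by_contra hlt; exact ho ⟨h0, not_lt.1 hlt⟩) he3 he4
  have hdL : (d + 1 - c e) * L ≤ d * L := Nat.mul_le_mul_right _ (by have := hc e; omega)
  simp only [WP.seq_iff, WP.putNat_iff, WP.setNat_iff, NExp.eval, NExp.size, State.setN_nv,
    State.setN_na, State.putN_nv, State.putN_na, h9, hf5.nv 8 rfl, h8]
  norm_num only
  simp only [if_true, if_false, hf5.nv 7 rfl, h7, hR5.costs, hR5.src]
  refine ⟨by omega, by omega, by omega, by omega, G.src e, e :: q, d + 1 - c e, by simp, by simp,
    by simp, ?_, hT', by omega, ?_⟩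
  · intro j hj
    simp only [hf5.na 3 rfl, List.length_cons, Nat.add_sub_cancel, Function.update_apply]
    cases j with
    | zero => simp
    | succ j =>
      simp only [List.length_cons, Nat.add_lt_add_iff_right] at hj
      simp only [List.getElem_cons_succ]
      rw [if_neg (by omega), ← h3 j hj, Nat.sub_sub, Nat.add_comm 1]
  · omega

theorem outputPath_spec {q : List (Fin G.m)} (h8 : σ.nv 8 = q.length)
    (h3 : ∀ j (hj : j < q.length), σ.na 3 (q.length - 1 - j) = q[j])
    (hf : 20 * q.length + 20 ≤ f) :
    WP outputPath (fun f' τ => f ≤ f' + (20 * q.length + 20) ∧ HoldsOutput τ (some q)) f σ := by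
  refine WP.seq (WP.forN q.length 8 (fun j τ => ∀ i (hi : i < q.length), i < j → τ.na 0 i = q[i])
    (by simp [h8]) (by simp) rfl rfl (by omega) (by simp) ?_ ?_)
  · intro j t τ hj hx hf hc hI
    refine WP.putNat (by simpa [NExp.size] using hc) ⟨by simp [NExp.size]; omega, ?_⟩
    intro i hi hij
    simp only [NExp.eval, hx, State.setN_na, State.putN_na, if_true, Function.update_apply,
      hf.nv 8 rfl, h8, hf.na 3 rfl]
    split_ifs with hvj
    · subst hvj; exact h3 _ hi
    · exact hI i hi (by omega)
  intro f1 τ1 hf1 hf1' hI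
  simp only [WP.seq_iff, WP.setNat_iff, NExp.eval, NExp.size, State.setN_nv, hf1.nv 8 rfl, h8]
  norm_num only
  simp only [if_false]
  refine ⟨by omega, by omega, by omega, by simp, by simp, fun j => ?_⟩
  simpa using hI j j.2 j.2

/-- Finds a path of least cost among the paths to the vertex in the natural variable `5` whose
resource consumption is at most the real variable `5`. -/
def cheapestPath : Prog := rowsUntil ;; traceBack ;; outputPath

theorem cheapestPath_spec {M : ℕ} (hc : ∀ e, 1 ≤ c e) (hN : HoldsNet G c σ) (h2 : σ.nv 2 = s)
    (h5 : σ.nv 5 = t) (hR : σ.rv 5 = R) {p : List (Fin G.m)} (hp : G.IsWalk s p t)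
    (hpR : G.res p ≤ R) (hpM : (p.map c).sum ≤ M)
    (hf : (M + 1) * (170 * G.m + 60 * G.n + 160) + 20 * G.n + 70 ≤ f) :
    WP cheapestPath (fun f' τ => f ≤ f' + ((M + 1) * (170 * G.m + 60 * G.n + 160) + 20 * G.n + 70) ∧
      ∃ q, HoldsOutput τ (some q) ∧ G.IsPath s q t ∧ G.res q ≤ R ∧
        ∀ q', G.IsWalk s q' t → G.res q' ≤ R → (q.map c).sum ≤ (q'.map c).sum) f σ := by
  have e1 : (M + 1) * (170 * G.m + 60 * G.n + 160) =
      (M + 1) * (90 * G.m + 60 * G.n + 80) + (M + 1) * (80 * G.m + 80) := by ring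
  rw [e1] at hf ⊢
  refine WP.seq ((rowsUntil_spec hc hN h2 h5 hR hp hpR hpM (by omega)).conseq ?_)
  rintro f1 τ1 hf1 ⟨hf1', i, hi, hF⟩
  have hle : (i + 1) * (80 * G.m + 80) ≤ (M + 1) * (80 * G.m + 80) :=
    Nat.mul_le_mul_right _ (by omega)
  refine WP.seq ((traceBack_spec hc hF (by rw [hf1.nv 5 rfl, h5]) (by omega)).conseq ?_)
  rintro f2 τ2 hf2 ⟨hf2', q, hq, hqc, hqR, h8, h3⟩
  have hql := hq.length_lt
  refine (outputPath_spec h8 h3 (by omega)).conseq ?_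
  rintro f3 τ3 hf3 ⟨hf3', hO⟩
  exact ⟨by omega, q, hO, hq, hqR, fun q' hw hr => hqc.trans (hF.first q' hw hr)⟩

end

/-! ### Scaled costs -/

/-- The edge costs in units of `δ`, rounded down. -/
noncomputable def WGraph.scaled (G : WGraph) (δ : ℝ) (e : Fin G.m) : ℕ := ⌊G.c e / δ⌋₊

section

variable {G : WGraph} {δ : ℝ}

theorem mul_sum_scaled_le (hδ : 0 < δ) (p : List (Fin G.m)) :
    δ * (p.map (G.scaled δ)).sum ≤ G.cost p := by
  induction p with
  | nil => simp [WGraph.cost]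
  | cons e p ih =>
    have h : δ * (G.scaled δ e : ℝ) ≤ G.c e := by
      have := Nat.floor_le (div_nonneg (G.c_nonneg e) hδ.le)
      rw [le_div_iff₀ hδ] at this
      rw [mul_comm]; exact this
    simp only [WGraph.cost, List.map_cons, List.sum_cons, Nat.cast_add, mul_add] at ih ⊢
    linarith

theorem cost_le_mul_sum_scaled (hδ : 0 < δ) (p : List (Fin G.m)) :
    G.cost p ≤ δ * ((p.map (G.scaled δ)).sum + p.length) := by
  induction p with
  | nil => simp [WGraph.cost]
  | cons e p ih =>
    have h : G.c e ≤ δ * (G.scaled δ e + 1) := by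
      have := (Nat.lt_floor_add_one (G.c e / δ)).le
      rw [div_le_iff₀ hδ] at this
      rw [mul_comm]; exact this
    simp only [WGraph.cost, List.map_cons, List.sum_cons, Nat.cast_add, mul_add, List.length_cons,
      Nat.cast_one] at ih h ⊢
    linarith

theorem sum_scaled_le_zero_iff (hδ : 0 < δ) (p : List (Fin G.m)) :
    (p.map (G.scaled δ)).sum ≤ 0 ↔ ∀ e ∈ p, G.c e < δ := by
  rw [Nat.le_zero, List.sum_eq_zero_iff]
  simp only [List.mem_map, forall_exists_index, and_imp, forall_apply_eq_imp_iff₂, WGraph.scaled,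
    Nat.floor_eq_zero, div_lt_one hδ]

theorem sum_map_add_one {m : ℕ} (c : Fin m → ℕ) (p : List (Fin m)) :
    (p.map fun e => c e + 1).sum = (p.map c).sum + p.length := by
  induction p with
  | nil => rfl
  | cons e p ih => simp only [List.map_cons, List.sum_cons, List.length_cons, ih]; omega

variable {I : Instance}

theorem Instance.exists_isSolution_cost_eq (h : ∃ p, I.IsSolution p) :
    ∃ p, I.IsSolution p ∧ (∀ q, I.IsSolution q → I.G.cost p ≤ I.G.cost q) ∧
      I.Copt = I.G.cost p := by
  have hfin : {p | I.IsSolution p}.Finite :=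
    (List.finite_length_lt (Fin I.G.m) I.G.n).subset fun p hp => hp.1.length_lt
  obtain ⟨p, hp, hmin⟩ := hfin.exists_minimalFor I.G.cost _ h
  have hle : ∀ q, I.IsSolution q → I.G.cost p ≤ I.G.cost q := fun q hq =>
    (le_total _ _).elim id fun hh => hmin hq hh
  refine ⟨p, hp, hle, IsLeast.csInf_eq ⟨⟨p, hp, rfl⟩, ?_⟩⟩
  rintro _ ⟨q, hq, rfl⟩
  exact hle q hq

/-- There is a solution all edges of which cost less than `x`. -/
def Instance.FeasibleBelow (I : Instance) (x : ℝ) : Prop :=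
  ∃ p, I.IsSolution p ∧ ∀ e ∈ p, I.G.c e < x

theorem Instance.feasibleBelow_iff {x : ℝ} (hx : 0 < x) :
    I.FeasibleBelow x ↔ ∃ p, I.IsSolution p ∧ (p.map (I.G.scaled x)).sum ≤ 0 := by
  simp only [FeasibleBelow, sum_scaled_le_zero_iff hx]

theorem WGraph.le_cost (G : WGraph) {p : List (Fin G.m)} {e : Fin G.m} (he : e ∈ p) :
    G.c e ≤ G.cost p :=
  List.single_le_sum (by simp only [List.mem_map]; rintro _ ⟨e, -, rfl⟩; exact G.c_nonneg e) _
    (List.mem_map_of_mem he)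

theorem WGraph.cost_le_mul (G : WGraph) {p : List (Fin G.m)} {x : ℝ} (h : ∀ e ∈ p, G.c e ≤ x) :
    G.cost p ≤ p.length * x := by
  have := List.sum_le_card_nsmul (p.map G.c) x (by simpa using h)
  simpa [cost] using this

/-- The optimal cost is determined up to a factor `n` by a threshold `x` such that there is a
solution without edges that cost more than `x`, but none without edges that cost at least `x`. -/
theorem Instance.bounds_of_threshold {x : ℝ} (h1 : ¬ I.FeasibleBelow x)
    (h2 : ∃ p, I.IsSolution p ∧ ∀ e ∈ p, I.G.c e ≤ x) :
    x ≤ I.Copt ∧ I.Copt ≤ I.G.n * x := by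
  obtain ⟨p, hp, hpx⟩ := h2
  obtain ⟨q, hq, hmin, hC⟩ := I.exists_isSolution_cost_eq ⟨p, hp⟩
  have hx : ∃ e ∈ q, x ≤ I.G.c e := by
    by_contra! hh
    exact h1 ⟨q, hq, hh⟩
  obtain ⟨e, he, hxe⟩ := hx
  rw [hC]
  refine ⟨hxe.trans (I.G.le_cost he), (hmin p hp).trans ((I.G.cost_le_mul hpx).trans ?_)⟩
  by_cases hx0 : 0 ≤ x
  · exact mul_le_mul_of_nonneg_right (by exact_mod_cast hp.1.length_lt.le) hx0
  · -- a negative threshold would admit only the empty path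
    rcases p with _ | ⟨e, p⟩
    · exact absurd hp.1.1 I.s_ne_t
    · linarith [hpx e (by simp), I.G.c_nonneg e]

/-- One halving of the ratio between the bounds, when the test for a scaled cost of at most `8 g`
with unit `L / (4 g)` succeeds. -/
theorem Instance.refine_of_test {L : ℝ} {g : ℕ} (hL : 0 < L) (hg : 1 ≤ g) (hgn : 8 * g ≤ I.G.n)
    (h : ∃ p, I.IsSolution p ∧ (p.map (I.G.scaled (L / (4 * g)))).sum ≤ 8 * g) :
    I.Copt * (2 * g) ≤ I.G.n * L := by
  obtain ⟨p, hp, hps⟩ := h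
  obtain ⟨q, hq, hmin, hC⟩ := I.exists_isSolution_cost_eq ⟨p, hp⟩
  have hg' : (0 : ℝ) < g := by exact_mod_cast hg
  have h1 := cost_le_mul_sum_scaled (G := I.G) (δ := L / (4 * g)) (by positivity) p
  have h2 : ((p.map (I.G.scaled (L / (4 * g)))).sum : ℝ) ≤ 8 * g := by exact_mod_cast hps
  have h3 : (p.length : ℝ) ≤ I.G.n := by exact_mod_cast hp.1.length_lt.le
  have h4 : (8 * g : ℝ) ≤ I.G.n := by exact_mod_cast hgn
  have h5 : I.Copt ≤ L / (4 * g) * (2 * I.G.n) := by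
    rw [hC]
    refine (hmin p hp).trans (h1.trans (mul_le_mul_of_nonneg_left (by linarith) (by positivity)))
  calc I.Copt * (2 * g) ≤ L / (4 * g) * (2 * I.G.n) * (2 * g) := by gcongr
    _ = I.G.n * L := by field_simp; ring

/-- The same when the test fails. -/
theorem Instance.refine_of_not_test {L : ℝ} {g : ℕ} (hL : 0 < L) (hg : 1 ≤ g)
    (hs : ∃ p, I.IsSolution p)
    (h : ¬ ∃ p, I.IsSolution p ∧ (p.map (I.G.scaled (L / (4 * g)))).sum ≤ 8 * g) :
    2 * L ≤ I.Copt := by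
  obtain ⟨q, hq, hmin, hC⟩ := I.exists_isSolution_cost_eq hs
  have hg' : (0 : ℝ) < g := by exact_mod_cast hg
  have h1 := mul_sum_scaled_le (G := I.G) (δ := L / (4 * g)) (by positivity) q
  have h2 : 8 * g ≤ (q.map (I.G.scaled (L / (4 * g)))).sum := by
    by_contra hh
    exact h ⟨q, hq, by omega⟩
  have h3 : (8 * g : ℝ) ≤ (q.map (I.G.scaled (L / (4 * g)))).sum := by exact_mod_cast h2
  rw [hC]
  calc 2 * L = L / (4 * g) * (8 * g) := by field_simp; ring
    _ ≤ L / (4 * g) * (q.map (I.G.scaled (L / (4 * g)))).sum := by gcongr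
    _ ≤ _ := h1

/-- A solution of least scaled cost, with unit `ε L / n`, is a `(1 + ε)`-approximation if `L` is a
lower bound for the optimum. -/
theorem Instance.approx_of_scaled {L ε : ℝ} (hL : 0 < L) (hε : 0 < ε) (hLC : L ≤ I.Copt)
    {q : List (Fin I.G.m)} (hq : I.IsSolution q)
    (hmin : ∀ q', I.IsSolution q' → (q.map fun e => I.G.scaled (ε * L / I.G.n) e + 1).sum ≤
      (q'.map fun e => I.G.scaled (ε * L / I.G.n) e + 1).sum) :
    I.G.cost q ≤ (1 + ε) * I.Copt := by
  obtain ⟨p, hp, -, hC⟩ := I.exists_isSolution_cost_eq ⟨q, hq⟩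
  have hn : (0 : ℝ) < I.G.n := by exact_mod_cast I.s.pos
  set δ := ε * L / I.G.n with hδ
  have hδ0 : 0 < δ := by positivity
  have h1 := hmin p hp
  rw [sum_map_add_one, sum_map_add_one] at h1
  have h1' : (((q.map (I.G.scaled δ)).sum : ℝ) + q.length) ≤ (p.map (I.G.scaled δ)).sum + p.length :=
    by exact_mod_cast h1
  have h2 := cost_le_mul_sum_scaled (G := I.G) hδ0 q
  have h3 := mul_sum_scaled_le (G := I.G) hδ0 p
  have h4 : (p.length : ℝ) ≤ I.G.n := by exact_mod_cast hp.1.length_lt.le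
  have h5 : δ * p.length ≤ ε * L := by
    calc δ * p.length ≤ δ * I.G.n := by gcongr
      _ = ε * L := by rw [hδ]; field_simp
  have h6 := mul_le_mul_of_nonneg_left h1' hδ0.le
  have h7 : ε * L ≤ ε * I.Copt := by gcongr
  rw [mul_add δ ((p.map (I.G.scaled δ)).sum : ℝ)] at h6
  rw [← hC] at h3
  linarith

/-- The scaled cost of an optimal solution, with unit `ε L / n`. -/
theorem Instance.exists_scaled_le {L ε : ℝ} (hL : 0 < L) (hε : 0 < ε) (hCL : I.Copt ≤ 8 * L)
    (hs : ∃ p, I.IsSolution p) : ∃ p, I.IsSolution p ∧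
      (p.map fun e => I.G.scaled (ε * L / I.G.n) e + 1).sum ≤ ⌊8 * I.G.n / ε⌋₊ + I.G.n := by
  obtain ⟨p, hp, -, hC⟩ := I.exists_isSolution_cost_eq hs
  have hn : (0 : ℝ) < I.G.n := by exact_mod_cast I.s.pos
  refine ⟨p, hp, ?_⟩
  rw [sum_map_add_one]
  refine add_le_add (Nat.le_floor ?_) hp.1.length_lt.le
  have h3 := mul_sum_scaled_le (G := I.G) (δ := ε * L / I.G.n) (by positivity) p
  rw [← hC] at h3
  rw [le_div_iff₀ hε]
  have h4 : ε * L / I.G.n * (p.map (I.G.scaled (ε * L / I.G.n))).sum ≤ 8 * L := h3.trans hCL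
  rw [div_mul_eq_mul_div, div_le_iff₀ hn] at h4
  nlinarith

theorem Instance.sum_scaled_eq_length {x δ : ℝ} (hpos : ∀ e, 0 < I.G.c e → x ≤ I.G.c e)
    {p : List (Fin I.G.m)} (hpx : ∀ e ∈ p, I.G.c e < x) :
    (p.map fun e => I.G.scaled δ e + 1).sum = p.length := by
  rw [sum_map_add_one, Nat.add_eq_right, List.sum_eq_zero_iff]
  simp only [List.mem_map, forall_exists_index, and_imp, forall_apply_eq_imp_iff₂]
  intro e he
  have h0 : I.G.c e = 0 :=
    le_antisymm (not_lt.1 fun hh => absurd (hpos e hh) (not_le.2 (hpx e he))) (I.G.c_nonneg e)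
  simp [WGraph.scaled, h0]

/-- If there is a solution of cost `0`, then a solution of least scaled cost, with unit `x / (n + 1)`
where `x` is a lower bound for the positive costs, has cost `0`. -/
theorem Instance.cost_eq_zero_of_scaled {x : ℝ} (hx : 0 < x) (hpos : ∀ e, 0 < I.G.c e → x ≤ I.G.c e)
    {p q : List (Fin I.G.m)} (hp : I.IsSolution p) (hpx : ∀ e ∈ p, I.G.c e < x)
    (hmin : (q.map fun e => I.G.scaled (x / (I.G.n + 1)) e + 1).sum ≤
      (p.map fun e => I.G.scaled (x / (I.G.n + 1)) e + 1).sum) :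
    I.G.cost q = 0 := by
  have hn : (0 : ℝ) < I.G.n + 1 := by positivity
  rw [I.sum_scaled_eq_length hpos hpx] at hmin
  have hl := hp.1.length_lt
  refine List.sum_eq_zero ?_
  simp only [List.mem_map, forall_exists_index, and_imp, forall_apply_eq_imp_iff₂]
  intro e he
  by_contra hne
  have hxe := hpos e (lt_of_le_of_ne (I.G.c_nonneg e) (Ne.symm hne))
  have h1 : I.G.scaled (x / (I.G.n + 1)) e + 1 ≤ (q.map fun e =>
      I.G.scaled (x / (I.G.n + 1)) e + 1).sum :=
    List.single_le_sum (by simp) _ (List.mem_map_of_mem he)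
  have h2 : I.G.n + 1 ≤ I.G.scaled (x / (I.G.n + 1)) e := by
    refine Nat.le_floor ?_
    rw [le_div_iff₀ (by positivity)]
    push_cast
    calc ((I.G.n : ℝ) + 1) * (x / (I.G.n + 1)) = x := by field_simp
      _ ≤ _ := hxe
  omega

end

/-! ### Testing for solutions of bounded scaled cost -/

/-- The program does not assign to names from `N` on. -/
structure Prog.Avoids (P : Prog) (N : ℕ) : Prop where
  nv : ∀ y, N ≤ y → P.wnv y = false
  na : ∀ y, N ≤ y → P.wna y = false
  rv : ∀ y, N ≤ y → P.wrv y = false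
  ra : ∀ y, N ≤ y → P.wra y = false

theorem Prog.Avoids.mono {P : Prog} {N N' : ℕ} (h : P.Avoids N) (hN : N ≤ N') : P.Avoids N' :=
  ⟨fun y hy => h.nv y (by omega), fun y hy => h.na y (by omega), fun y hy => h.rv y (by omega),
    fun y hy => h.ra y (by omega)⟩

theorem Prog.exists_avoids (P : Prog) : ∃ N, P.Avoids N := by
  induction P with
  | skip => exact ⟨0, by constructor <;> simp [wnv, wna, wrv, wra]⟩
  | setNat x | putNat x | setReal x | putReal x | setFloor x =>
    exact ⟨x + 1, by constructor <;> (simp [wnv, wna, wrv, wra]; try omega)⟩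
  | seq P Q hP hQ | cond _ P Q hP hQ =>
    obtain ⟨N, hP⟩ := hP
    obtain ⟨M, hQ⟩ := hQ
    have hP := hP.mono (le_max_left N M)
    have hQ := hQ.mono (le_max_right N M)
    exact ⟨max N M, fun y hy => by simp [wnv, hP.nv y hy, hQ.nv y hy],
      fun y hy => by simp [wna, hP.na y hy, hQ.na y hy],
      fun y hy => by simp [wrv, hP.rv y hy, hQ.rv y hy],
      fun y hy => by simp [wra, hP.ra y hy, hQ.ra y hy]⟩
  | loop _ P hP =>
    obtain ⟨N, hP⟩ := hP
    exact ⟨N, hP.nv, hP.na, hP.rv, hP.ra⟩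

/-- The memory holds the instance and the accuracy, with those parts of them that are not part of
the input of row programs saved under names from `N` on. -/
structure Saved (I : Instance) (ε : ℝ) (N : ℕ) (σ : State) : Prop where
  n : σ.nv 0 = I.G.n
  m : σ.nv 1 = I.G.m
  s : σ.nv 2 = I.s
  src : ∀ e : Fin I.G.m, σ.na 0 e = I.G.src e
  tgt : ∀ e : Fin I.G.m, σ.na 1 e = I.G.tgt e
  r : ∀ e : Fin I.G.m, σ.ra 1 e = I.G.r e
  t : σ.nv N = I.t
  R : σ.rv N = I.R
  eps : σ.rv (N + 1) = ε
  c : ∀ e : Fin I.G.m, σ.ra N e = I.G.c e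

/-- The memories agree on the names from `N` on, except for two natural variables and for natural
arrays. -/
structure Agree (N : ℕ) (σ τ : State) : Prop where
  nv : ∀ y, N ≤ y → y ≠ N + 2 → y ≠ N + 3 → τ.nv y = σ.nv y
  rv : ∀ y, N ≤ y → τ.rv y = σ.rv y
  ra : ∀ y, N ≤ y → τ.ra y = σ.ra y

/-- Computes the rows up to the index in the natural variable `N + 1`, for the costs in units of the
real variable `N + 2`. -/
def computeRows (N : ℕ) (P : Prog) : Prog :=
  .forN (N + 2) 1
    (.setFloor (N + 3) (.div (.get N (.var (N + 2))) (.var (N + 2))) ;;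
      .putNat 2 (.var (N + 2)) (.var (N + 3))) ;;
  .setNat (N + 2) (.const 0) ;;
  .loop (.natLe (.var (N + 2)) (.var (N + 1)))
    (.setNat 3 (.var (N + 2)) ;; P ;; .setNat (N + 2) (.add (.var (N + 2)) (.const 1)))

/-- Tests whether the last row has an entry for the target that respects the resource bound. -/
def hasSolution (N : ℕ) : BExp :=
  .and (.realLe (.ofNat (.const 0)) (.get 2 (.add (.mul (.var (N + 1)) (.var 0)) (.var N))))
    (.realLe (.get 2 (.add (.mul (.var (N + 1)) (.var 0)) (.var N))) (.var N))

/-- Runs `Q₁` if there is a solution of scaled cost at most the natural variable `N + 1`, with the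
real variable `N + 2` as the unit, and `Q₂` otherwise. -/
def testThen (N : ℕ) (P Q₁ Q₂ : Prog) : Prog := computeRows N P ;; .cond (hasSolution N) Q₁ Q₂

/-- The time for a test with `k + 1` rows, if a row takes time `F`. -/
def testTime (m F k : ℕ) : ℕ := 20 * m + (k + 1) * (F + 10) + 50

section

variable {I : Instance} {ε : ℝ} {N : ℕ} {σ τ : State} {t F k : ℕ} {P Q₁ Q₂ : Prog}

theorem Agree.trans {ρ : State} (h : Agree N σ τ) (h' : Agree N τ ρ) : Agree N σ ρ :=
  ⟨fun y h1 h2 h3 => (h'.nv y h1 h2 h3).trans (h.nv y h1 h2 h3),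
    fun y h1 => (h'.rv y h1).trans (h.rv y h1), fun y h1 => (h'.ra y h1).trans (h.ra y h1)⟩

theorem Prog.Avoids.agree (h : P.Avoids N) (hf : P.Frame σ τ) : Agree N σ τ :=
  ⟨fun y hy _ _ => hf.nv y (h.nv y hy), fun y hy => hf.rv y (h.rv y hy),
    fun y hy => hf.ra y (h.ra y hy)⟩

theorem Saved.of_agree (h : Saved I ε N σ) (ha : Agree N σ τ) {c : Fin I.G.m → ℕ} {k : ℕ}
    (hR : HoldsRows I.G c I.s k τ) : Saved I ε N τ :=
  ⟨hR.n, hR.m, hR.start, hR.src, hR.tgt, hR.r, by rw [ha.nv N le_rfl (by omega) (by omega), h.t],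
    by rw [ha.rv N le_rfl, h.R], by rw [ha.rv (N + 1) (by omega), h.eps],
    by rw [ha.ra N le_rfl]; exact h.c⟩

theorem Saved.setN (h : Saved I ε N σ) {x : ℕ} (hx : 2 < x) (hN : x ≠ N) (v : ℕ) :
    Saved I ε N (σ.setN x v) :=
  ⟨by rw [State.setN_nv, if_neg (by omega), h.n], by rw [State.setN_nv, if_neg (by omega), h.m],
    by rw [State.setN_nv, if_neg (by omega), h.s], h.src, h.tgt, h.r,
    by rw [State.setN_nv, if_neg (by omega), h.t], h.R, h.eps, h.c⟩

theorem Saved.setR (h : Saved I ε N σ) {x : ℕ} (hx : x ≠ N) (hx' : x ≠ N + 1) (v : ℝ) :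
    Saved I ε N (σ.setR x v) :=
  ⟨h.n, h.m, h.s, h.src, h.tgt, h.r, h.t, by rw [State.setR_rv, if_neg (by omega), h.R],
    by rw [State.setR_rv, if_neg (by omega), h.eps], h.c⟩

/-- `P` computes rows for `G` in time `F`. -/
def RowBound (P : Prog) (G : WGraph) (F : ℕ) : Prop :=
  ∀ (c : Fin G.m → ℕ) (s : Fin G.n) (k : ℕ) (t : ℕ) (σ : State), HoldsRows G c s k σ →
    σ.nv 3 = k → F ≤ t → WP P (fun t' τ => t ≤ t' + F ∧ HoldsRows G c s (k + 1) τ) t σ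

theorem computeRows_spec (hN : 20 ≤ N) (hP : P.Avoids N) (hF : RowBound P I.G F)
    (h : Saved I ε N σ) (hk : σ.nv (N + 1) = k) (ht : 20 * I.G.m + (k + 1) * (F + 10) + 20 ≤ t) :
    WP (computeRows N P) (fun t' τ => t ≤ t' + (20 * I.G.m + (k + 1) * (F + 10) + 20) ∧
      HoldsRows I.G (I.G.scaled (σ.rv (N + 2))) I.s (k + 1) τ ∧ Agree N σ τ) t σ := by
  set δ := σ.rv (N + 2) with hδ
  refine WP.seq (WP.forN I.G.m 8 (fun j τ => Agree N σ τ ∧ HoldsRows I.G (fun e => τ.na 2 e) I.s 0 τ ∧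
    ∀ e : Fin I.G.m, e.val < j → τ.na 2 e = I.G.scaled δ e)
    h.m (by omega) (by simp [Prog.wnv]) (by simp [Prog.wnv]) (by omega) ?_ ?_ ?_)
  · refine ⟨⟨fun y h1 h2 h3 => by simp [h2], fun y _ => rfl, fun y _ => rfl⟩,
      ⟨?_, ?_, ?_, h.src, h.tgt, fun _ => rfl, h.r, by simp⟩, by simp⟩
    · rw [State.setN_nv, if_neg (by omega), h.n]
    · rw [State.setN_nv, if_neg (by omega), h.m]
    · rw [State.setN_nv, if_neg (by omega), h.s]
  · rintro j t τ hj hx hf hc ⟨hA, hR, hI⟩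
    obtain ⟨e, rfl⟩ : ∃ e : Fin I.G.m, e.val = j := ⟨⟨j, hj⟩, rfl⟩
    have hne : N + 2 ≠ N + 3 := by omega
    simp only [WP.seq_iff, WP.setFloor_iff, WP.putNat_iff, RExp.eval, RExp.size, NExp.eval,
      NExp.size, State.setN_nv, if_true, if_neg hne, hx]
    refine ⟨by omega, by omega, by omega, ⟨fun y h1 h2 h3 => ?_, fun y hy => ?_, fun y hy => ?_⟩,
      ⟨?_, ?_, ?_, ?_, ?_, fun _ => rfl, hR.r, by simp⟩, ?_⟩
    · simpa [h2, h3] using hA.nv y h1 h2 h3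
    · simpa using hA.rv y hy
    · simpa using hA.ra y hy
    · simpa [show 0 ≠ N + 3 by omega] using hR.n
    · simpa [show 1 ≠ N + 3 by omega, show 1 ≠ N + 2 by omega] using hR.m
    · simpa [show 2 ≠ N + 3 by omega, show 2 ≠ N + 2 by omega, show N ≠ 0 by omega] using hR.start
    · simpa using hR.src
    · simpa using hR.tgt
    · intro e' he'
      rw [hA.ra N le_rfl, hA.rv (N + 2) (by omega), h.c]
      simp only [State.setN_na, State.putN_na, if_true, Function.update_apply]
      split_ifs with hee
      · rw [Fin.ext hee]; rfl
      · exact hI e' (by omega)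
  rintro t1 τ1 hf1 ht1 ⟨hA1, hR1, hI1⟩
  have hc1 : (fun e : Fin I.G.m => τ1.na 2 e) = I.G.scaled δ := funext fun e => hI1 e e.2
  rw [hc1] at hR1
  refine WP.seq (WP.setNat (by simp [NExp.size]; omega) ?_)
  simp only [NExp.eval, NExp.size]
  refine WP.loop (fun t' τ => ∃ i ≤ k + 1, τ.nv (N + 2) = i ∧ HoldsRows I.G (I.G.scaled δ) I.s i τ ∧
    Agree N σ τ ∧ (k + 1 - i) * (F + 10) + 3 ≤ t' ∧
    t + (k + 1 - i) * (F + 10) ≤ t' + (17 * I.G.m + (k + 1) * (F + 10) + 10)) ?_ ?_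
  · refine ⟨0, by omega, by simp, hR1.setN (by omega) _, hA1.trans ⟨fun y h1 h2 h3 => by simp [h2],
      fun _ _ => rfl, fun _ _ => rfl⟩, by simp; omega, by simp; omega⟩
  rintro t2 τ2 - ⟨i, hi, hi2, hR2, hA2, ht2, ht2'⟩
  have hk2 : τ2.nv (N + 1) = k := by rw [hA2.nv (N + 1) (by omega) (by omega) (by omega), hk]
  simp only [BExp.eval, BExp.size, NExp.eval, NExp.size, hi2, hk2]
  refine ⟨by omega, fun hik => ?_, fun hik => ?_⟩
  · obtain ⟨d, hd⟩ : ∃ d, k + 1 - i = d + 1 := ⟨k - i, by omega⟩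
    have hd' : k + 1 - (i + 1) = d := by omega
    rw [hd, add_mul] at ht2 ht2'
    refine WP.seq (WP.setNat (by simp [NExp.size]; omega) (WP.seq ?_))
    simp only [NExp.eval, NExp.size, hi2]
    refine (hF _ _ i _ _ (hR2.setN (by omega) _) (by simp) (by omega)).conseq ?_
    rintro t3 τ3 hf3 ⟨ht3, hR3⟩
    have hA3 : Agree N σ τ3 := hA2.trans (Agree.trans (τ := τ2.setN 3 i)
      ⟨fun y h1 h2 h3 => by simp [show y ≠ 3 by omega], fun _ _ => rfl, fun _ _ => rfl⟩
      (hP.agree hf3))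
    have h23 : τ3.nv (N + 2) = i := by
      rw [hf3.nv (N + 2) (hP.nv _ (by omega))]
      simpa [show N ≠ 1 by omega] using hi2
    refine WP.setNat (by simp [NExp.size]; omega) ?_
    simp only [NExp.eval, NExp.size, h23]
    exact ⟨i + 1, by omega, by simp, hR3.setN (by omega) _, hA3.trans ⟨fun y h1 h2 h3 => by
      simp [h2], fun _ _ => rfl, fun _ _ => rfl⟩, by rw [hd']; omega, by rw [hd']; omega⟩
  · obtain rfl : i = k + 1 := by omega
    exact ⟨by omega, hR2, hA2⟩

/-- The rule for tests. -/
theorem WP.testThen {Q : ℕ → State → Prop} (hN : 20 ≤ N) (hP : P.Avoids N)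
    (hF : RowBound P I.G F) (h : Saved I ε N σ) (k : ℕ) (hk : σ.nv (N + 1) = k) {δ : ℝ}
    (hδ : σ.rv (N + 2) = δ) (ht : testTime I.G.m F k ≤ t)
    (h1 : ∀ t' τ, Saved I ε N τ → Agree N σ τ → t ≤ t' + testTime I.G.m F k →
      (∃ p, I.IsSolution p ∧ (p.map (I.G.scaled δ)).sum ≤ k) → WP Q₁ Q t' τ)
    (h2 : ∀ t' τ, Saved I ε N τ → Agree N σ τ → t ≤ t' + testTime I.G.m F k →
      (¬ ∃ p, I.IsSolution p ∧ (p.map (I.G.scaled δ)).sum ≤ k) → WP Q₂ Q t' τ) :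
    WP (testThen N P Q₁ Q₂) Q t σ := by
  simp only [testTime] at ht h1 h2
  subst hδ
  refine WP.seq ((computeRows_spec hN hP hF h hk (by omega)).conseq ?_)
  rintro t1 τ1 - ⟨ht1, hR, hA⟩
  have hS := h.of_agree hA hR
  have hk1 : τ1.nv (N + 1) = k := by rw [hA.nv (N + 1) (by omega) (by omega) (by omega), hk]
  have hE := hR.rows k (by omega) I.t
  have hiff : (hasSolution N).eval τ1 ↔
      ∃ p, I.IsSolution p ∧ (p.map (I.G.scaled (σ.rv (N + 2)))).sum ≤ k := by
    simp only [hasSolution, BExp.eval, RExp.eval, NExp.eval, hk1, hS.n, hS.t, hS.R, Nat.cast_zero]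
    constructor
    · rintro ⟨h0, hle⟩
      obtain ⟨p, hp, hpk, hpr⟩ := hE.exists_isPath h0
      exact ⟨p, ⟨hp, hpr.trans_le hle⟩, hpk⟩
    · rintro ⟨p, hp, hpk⟩
      have := hE.of_walk hp.1.1 hpk
      exact ⟨this.1, this.2.trans hp.2⟩
  have hs : (hasSolution N).size = 18 := rfl
  refine WP.cond (by omega) (fun hb => h1 _ _ hS hA (by omega) (hiff.1 hb))
    (fun hb => h2 _ _ hS hA (by omega) (by rwa [hiff] at hb))

end

/-! ### Finding a threshold -/

/-- The number of edges of index less than `j` with a cost strictly between `lo` and `hi` that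
satisfies `p`. -/
noncomputable def WGraph.countBelow (G : WGraph) (lo hi : ℝ) (j : ℕ) (p : ℝ → Prop) : ℕ :=
  Nat.card {e : Fin G.m // (lo < G.c e ∧ G.c e < hi) ∧ e.val < j ∧ p (G.c e)}

/-- The number of edges with a cost strictly between `lo` and `hi`. -/
noncomputable def WGraph.between (G : WGraph) (lo hi : ℝ) : ℕ :=
  Nat.card {e : Fin G.m // lo < G.c e ∧ G.c e < hi}

section

variable {G : WGraph} {lo hi mn piv : ℝ} {j b cnt : ℕ} {p p' : ℝ → Prop}

theorem countBelow_zero : G.countBelow lo hi 0 p = 0 := by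
  rw [WGraph.countBelow, Nat.card_eq_zero]
  exact Or.inl ⟨fun e => by have := e.2.2.1; omega⟩

theorem countBelow_mono (h : ∀ x, p x → p' x) :
    G.countBelow lo hi j p ≤ G.countBelow lo hi j p' :=
  Nat.card_le_card_of_injective
    (fun e => (⟨e.1, e.2.1, e.2.2.1, h _ e.2.2.2⟩ : {e : Fin G.m // _}))
    fun a b hab => Subtype.ext (by simpa using hab)

theorem countBelow_succ (e : Fin G.m) (he : lo < G.c e ∧ G.c e < hi) (hp : p (G.c e)) :
    G.countBelow lo hi (e + 1) p = G.countBelow lo hi e p + 1 := by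
  classical
  simp only [WGraph.countBelow, Nat.card_eq_fintype_card, Fintype.card_subtype]
  rw [← Finset.card_insert_of_notMem (a := e) (by simp)]
  congr 1
  ext e'
  simp only [Finset.mem_filter, Finset.mem_univ, true_and, Finset.mem_insert]
  constructor
  · rintro ⟨h1, h2, h3⟩
    by_cases h : e'.val = e
    · exact Or.inl (Fin.ext h)
    · exact Or.inr ⟨h1, by omega, h3⟩
  · rintro (rfl | ⟨h1, h2, h3⟩)
    · exact ⟨he, by omega, hp⟩
    · exact ⟨h1, by omega, h3⟩

theorem countBelow_succ_of_not (e : Fin G.m) (he : ¬ ((lo < G.c e ∧ G.c e < hi) ∧ p (G.c e))) :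
    G.countBelow lo hi (e + 1) p = G.countBelow lo hi e p := by
  classical
  simp only [WGraph.countBelow, Nat.card_eq_fintype_card, Fintype.card_subtype]
  congr 1
  ext e'
  simp only [Finset.mem_filter, Finset.mem_univ, true_and]
  constructor
  · rintro ⟨h1, h2, h3⟩
    refine ⟨h1, lt_of_le_of_ne (by omega) fun hh => he ?_, h3⟩
    rw [← Fin.ext hh]
    exact ⟨h1, h3⟩
  · rintro ⟨h1, h2, h3⟩
    exact ⟨h1, by omega, h3⟩

theorem countBelow_le_succ (e : Fin G.m) :
    G.countBelow lo hi e p ≤ G.countBelow lo hi (e + 1) p := by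
  by_cases he : (lo < G.c e ∧ G.c e < hi) ∧ p (G.c e)
  · rw [countBelow_succ e he.1 he.2]; omega
  · rw [countBelow_succ_of_not e he]

/-- The state of the search for a pivot.  The edges with costs between `lo` and `hi` are divided, in
order of their indices, into blocks of `b` edges; `cnt` edges of the current block have been looked
at, and `mn` is the least cost of these; `piv` is the largest of the least costs of the complete
blocks, or `lo` if there is none. -/
structure ScanInv (G : WGraph) (lo hi : ℝ) (b j cnt : ℕ) (mn piv : ℝ) : Prop where
  le_piv : lo ≤ piv
  blocks : ∃ q, G.countBelow lo hi j (fun _ => True) = q * b + cnt ∧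
    q ≤ G.countBelow lo hi j (· ≤ piv) ∧
    (0 < cnt → q + 1 ≤ G.countBelow lo hi j fun x => x ≤ piv ∨ x ≤ mn)
  current : 0 < cnt → cnt ≤ G.countBelow lo hi j (mn ≤ ·)
  above : piv ≠ lo → b ≤ G.countBelow lo hi j (piv ≤ ·)

theorem ScanInv.skip {e : Fin G.m} (h : ScanInv G lo hi b e cnt mn piv)
    (he : ¬ (lo < G.c e ∧ G.c e < hi)) : ScanInv G lo hi b (e + 1) cnt mn piv := by
  have hp : ∀ p, G.countBelow lo hi (e + 1) p = G.countBelow lo hi e p := fun p =>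
    countBelow_succ_of_not e fun hh => he hh.1
  exact ⟨h.le_piv, by simpa only [hp] using h.blocks, by simpa only [hp] using h.current,
    by simpa only [hp] using h.above⟩

theorem ScanInv.next {e : Fin G.m} (h : ScanInv G lo hi b e cnt mn piv)
    (he : lo < G.c e ∧ G.c e < hi) {mn' : ℝ}
    (hmn : (0 < cnt ∧ mn ≤ G.c e ∧ mn' = mn) ∨ (¬ (0 < cnt ∧ mn ≤ G.c e) ∧ mn' = G.c e)) :
    ScanInv G lo hi b (e + 1) (cnt + 1) mn' piv := by
  obtain ⟨q, h1, h2, h3⟩ := h.blocks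
  refine ⟨h.le_piv, ⟨q, ?_, h2.trans (countBelow_le_succ e), fun _ => ?_⟩, fun _ => ?_,
    fun hp => (h.above hp).trans (countBelow_le_succ e)⟩
  · rw [countBelow_succ e he trivial, h1]; ring
  · rcases hmn with ⟨hc, hle, rfl⟩ | ⟨hn, rfl⟩
    · exact (h3 hc).trans (countBelow_le_succ e)
    · rw [countBelow_succ e he (Or.inr le_rfl)]
      exact Nat.succ_le_succ (h2.trans (countBelow_mono fun x hx => Or.inl hx))
  · rcases hmn with ⟨hc, hle, rfl⟩ | ⟨hn, rfl⟩
    · rw [countBelow_succ e he hle]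
      exact Nat.succ_le_succ (h.current hc)
    · rw [countBelow_succ e he le_rfl]
      refine Nat.succ_le_succ ?_
      by_cases hc : 0 < cnt
      · have := not_le.1 fun hh => hn ⟨hc, hh⟩
        exact (h.current hc).trans (countBelow_mono fun x hx => this.le.trans hx)
      · omega

theorem ScanInv.complete (h : ScanInv G lo hi b j b mn piv) (hb : 0 < b) {piv' : ℝ}
    (hp : (mn ≤ piv ∧ piv' = piv) ∨ (piv < mn ∧ piv' = mn)) :
    ScanInv G lo hi b j 0 mn piv' := by
  obtain ⟨q, h1, h2, h3⟩ := h.blocks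
  have hle : piv ≤ piv' ∧ mn ≤ piv' := by
    rcases hp with ⟨hp, rfl⟩ | ⟨hp, rfl⟩
    · exact ⟨le_rfl, hp⟩
    · exact ⟨hp.le, le_rfl⟩
  refine ⟨h.le_piv.trans hle.1, ⟨q + 1, by rw [h1]; ring, (h3 hb).trans (countBelow_mono fun x hx =>
    hx.elim (fun hx => hx.trans hle.1) fun hx => hx.trans hle.2), by omega⟩, by omega, fun hne => ?_⟩
  rcases hp with ⟨hp, rfl⟩ | ⟨hp, rfl⟩
  · exact h.above hne
  · exact h.current hb

theorem between_add_le (q : ℝ → Prop) {lo' hi' : ℝ} (hlo : lo ≤ lo') (hhi : hi' ≤ hi)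
    (hq : ∀ x, lo' < x → x < hi' → ¬ q x) :
    G.between lo' hi' + G.countBelow lo hi G.m q ≤ G.countBelow lo hi G.m fun _ => True := by
  classical
  simp only [WGraph.between, WGraph.countBelow, Nat.card_eq_fintype_card, Fintype.card_subtype]
  rw [← Finset.card_union_of_disjoint]
  · refine Finset.card_le_card fun e => ?_
    simp only [Finset.mem_union, Finset.mem_filter, Finset.mem_univ, true_and]
    rintro (⟨h1, h2⟩ | ⟨h1, h2, -⟩)
    · exact ⟨⟨hlo.trans_lt h1, h2.trans_le hhi⟩, e.2, trivial⟩
    · exact ⟨h1, h2, trivial⟩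
  · rw [Finset.disjoint_filter]
    rintro e - ⟨h1, h2⟩ ⟨-, -, h3⟩
    exact hq _ h1 h2 h3

theorem between_eq : G.between lo hi = G.countBelow lo hi G.m fun _ => True := by
  classical
  simp only [WGraph.between, WGraph.countBelow, Nat.card_eq_fintype_card, Fintype.card_subtype]
  congr 1
  ext e
  simp

theorem between_le : G.between lo hi ≤ G.m :=
  (Nat.card_le_card_of_injective _ Subtype.val_injective).trans (by simp)

/-- A pivot reduces the number of candidates by at least `b`, unless it is already small. -/
theorem ScanInv.between_le (h : ScanInv G lo hi b G.m cnt mn piv) (hcnt : cnt < b) :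
    (piv = lo → G.between lo hi < b) ∧ (lo < piv →
      G.between lo (min piv hi) + b ≤ G.between lo hi ∧
      (G.between piv hi + b ≤ G.between lo hi ∨ G.between piv hi < b * b)) := by
  obtain ⟨q, h1, h2, h3⟩ := h.blocks
  refine ⟨fun hp => ?_, fun hp => ⟨?_, ?_⟩⟩
  · have h0 : G.countBelow lo hi G.m (· ≤ piv) = 0 := by
      rw [WGraph.countBelow, Nat.card_eq_zero]
      exact Or.inl ⟨fun e => by
        have h1 := e.2.1.1
        have h2 := e.2.2.2
        exact absurd h1 (not_lt.2 (h2.trans hp.le))⟩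
    have hq : q = 0 := by omega
    rw [between_eq, h1, hq]; omega
  · have := between_add_le (G := G) (lo := lo) (hi := hi) (piv ≤ ·) (lo' := lo) (hi' := min piv hi)
      le_rfl (min_le_right _ _) (fun x _ hx => not_le.2 (hx.trans_le (min_le_left _ _)))
    rw [between_eq (hi := hi)]
    have := h.above hp.ne'
    omega
  · have h4 := between_add_le (G := G) (lo := lo) (hi := hi) (· ≤ piv) (lo' := piv) (hi' := hi)
      hp.le le_rfl (fun x hx _ => not_le.2 hx)
    rw [between_eq (lo := lo)]
    by_cases hqb : b ≤ q
    · left; omega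
    · right
      have : (q + 1) * b ≤ b * b := Nat.mul_le_mul_right _ (by omega)
      rw [add_mul] at this
      omega

end

/-- Searches a pivot (real variable `N + 6`) among the costs between the real variables `N + 4` and
`N + 3`, with blocks of the size in the natural variable `N + 5`. -/
def findPivot (N : ℕ) : Prog :=
  .setNat (N + 6) (.const 0) ;;
  .setReal (N + 6) (.var (N + 4)) ;;
  .forN (N + 2) 1
    (.cond (.and (.not (.realLe (.get N (.var (N + 2))) (.var (N + 4))))
        (.not (.realLe (.var (N + 3)) (.get N (.var (N + 2))))))
      (.cond (.and (.natLe (.const 1) (.var (N + 6)))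
          (.realLe (.var (N + 5)) (.get N (.var (N + 2))))) .skip
          (.setReal (N + 5) (.get N (.var (N + 2)))) ;;
        .setNat (N + 6) (.add (.var (N + 6)) (.const 1)) ;;
        .cond (.natLe (.var (N + 5)) (.var (N + 6)))
          (.setNat (N + 6) (.const 0) ;;
            .cond (.realLe (.var (N + 5)) (.var (N + 6))) .skip (.setReal (N + 6) (.var (N + 5))))
          .skip)
      .skip)

section

variable {I : Instance} {ε : ℝ} {N : ℕ} {σ τ : State} {t F k b : ℕ} {P Q₁ Q₂ : Prog} {lo hi : ℝ}

theorem findPivot_spec (h : Saved I ε N σ) (hlo : σ.rv (N + 4) = lo)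
    (hhi : σ.rv (N + 3) = hi) (hb : σ.nv (N + 5) = b) (hb0 : 0 < b) (ht : 50 * I.G.m + 20 ≤ t) :
    WP (findPivot N) (fun t' τ => t ≤ t' + (50 * I.G.m + 20) ∧ ∃ cnt mn, cnt < b ∧
      ScanInv I.G lo hi b I.G.m cnt mn (τ.rv (N + 6))) t σ := by
  refine WP.seq (WP.setNat (by simp [NExp.size]; omega) (WP.seq (WP.setReal
    (by simp [NExp.size, RExp.size]; omega) ?_)))
  simp only [NExp.eval, NExp.size, RExp.eval, RExp.size, State.setN_rv, hlo]
  refine WP.forN I.G.m 40 (fun j τ => τ.nv (N + 6) < b ∧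
    ScanInv I.G lo hi b j (τ.nv (N + 6)) (τ.rv (N + 5)) (τ.rv (N + 6)))
    (by simp [h.m]) (by omega) (by simp [Prog.wnv]) (by simp [Prog.wnv]) (by omega) ?_ ?_ ?_
  · refine ⟨by simpa using hb0, ⟨by simp, ⟨0, ?_, by simp, by simp⟩, by simp, by simp⟩⟩
    simp [countBelow_zero]
  · rintro j t τ hj hx hf hc ⟨hcnt, hS⟩
    obtain ⟨e, rfl⟩ : ∃ e : Fin I.G.m, e.val = j := ⟨⟨j, hj⟩, rfl⟩
    have hce : τ.ra N e = I.G.c e := by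
      rw [hf.ra N (by simp [Prog.forN, Prog.wra])]; simpa using h.c e
    have hlo' : τ.rv (N + 4) = lo := by
      rw [hf.rv (N + 4) (by simp [Prog.forN, Prog.wrv])]; simpa using hlo
    have hhi' : τ.rv (N + 3) = hi := by
      rw [hf.rv (N + 3) (by simp [Prog.forN, Prog.wrv])]; simpa using hhi
    have hb' : τ.nv (N + 5) = b := by
      rw [hf.nv (N + 5) (by simp [Prog.forN, Prog.wnv])]; simpa using hb
    have key : ∀ (t' : ℕ) (τ' : State) (mn' : ℝ), t ≤ t' + 23 → τ'.nv (N + 6) = τ.nv (N + 6) →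
        τ'.nv (N + 5) = b → τ'.rv (N + 5) = mn' → τ'.rv (N + 6) = τ.rv (N + 6) →
        ScanInv I.G lo hi b (e + 1) (τ.nv (N + 6) + 1) mn' (τ.rv (N + 6)) →
        WP (.setNat (N + 6) (.add (.var (N + 6)) (.const 1)) ;;
          .cond (.natLe (.var (N + 5)) (.var (N + 6)))
          (.setNat (N + 6) (.const 0) ;;
            .cond (.realLe (.var (N + 5)) (.var (N + 6))) .skip (.setReal (N + 6) (.var (N + 5))))
          .skip) (fun t' τ => t ≤ t' + 40 ∧ (τ.setN (N + 2) (e + 1)).nv (N + 6) < b ∧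
            ScanInv I.G lo hi b (e + 1) ((τ.setN (N + 2) (e + 1)).nv (N + 6))
              ((τ.setN (N + 2) (e + 1)).rv (N + 5)) ((τ.setN (N + 2) (e + 1)).rv (N + 6)))
          t' τ' := by
      intro t' τ' mn' ht' h6 h5 hmn hpiv hS'
      simp only [WP.cond_iff, WP.seq_iff, WP.setNat_iff, WP.setReal_iff, WP.skip_iff, BExp.eval,
        BExp.size, NExp.eval, NExp.size, RExp.eval, RExp.size, State.setN_nv, State.setN_rv,
        State.setR_rv, State.setR_nv, Nat.add_left_cancel_iff, h6, h5, hmn, hpiv]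
      norm_num only
      simp only [if_true, if_false]
      refine ⟨by omega, by omega, fun hfull => ⟨by omega, by omega, fun hle => ⟨by omega, by omega,
        hb0, ?_⟩, fun hle => ⟨by omega, by omega, hb0, ?_⟩⟩, fun hfull => ⟨by omega, by omega,
        by omega, ?_⟩⟩
      · have : τ.nv (N + 6) + 1 = b := by omega
        rw [this] at hS'
        exact hS'.complete hb0 (Or.inl ⟨hle, rfl⟩)
      · have : τ.nv (N + 6) + 1 = b := by omega
        rw [this] at hS'
        exact hS'.complete hb0 (Or.inr ⟨not_le.1 hle, rfl⟩)
      · exact hS'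
    simp only [WP.cond_iff (b := .and _ (.not _)), WP.skip_iff, BExp.eval, BExp.size, NExp.eval,
      NExp.size, RExp.eval, RExp.size, hx, hce, hlo', hhi', not_le]
    refine ⟨by omega, fun he => WP.seq ?_, fun he => ⟨by omega, by omega, ?_, ?_⟩⟩
    · simp only [WP.cond_iff, WP.skip_iff, WP.setReal_iff, BExp.eval, BExp.size, NExp.eval,
        NExp.size, RExp.eval, RExp.size, hx, hce]
      refine ⟨by omega, fun hle => ⟨by omega, key _ _ _ (by omega) rfl hb' rfl rfl
        (hS.next he (Or.inl ⟨hle.1, hle.2, rfl⟩))⟩, fun hle => ⟨by omega, key _ _ (I.G.c e)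
          (by omega) rfl hb' (by simp) (by simp) (hS.next he (Or.inr ⟨hle, rfl⟩))⟩⟩
    · simpa using hcnt
    · simpa using hS.skip he
  · rintro t' τ hf ht' ⟨hcnt, hS⟩
    exact ⟨by omega, _, _, hcnt, hS⟩

/-- One round of the search for the threshold.  The costs in the interval are divided into blocks of
`b` costs each, and the pivot is the largest of the least costs of the blocks.  A test decides on
which side of the pivot the search goes on.  Either way, `b` costs are discarded, unless fewer than
`b * b` costs remain. -/
def threshRound (N : ℕ) (P : Prog) : Prog :=
  .setNat (N + 5) (.div (.add (.var (N + 4)) (.const 2)) (.const 3)) ;;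
  findPivot N ;;
  .cond (.realLe (.var (N + 6)) (.var (N + 4))) .skip
    (.setReal (N + 2) (.var (N + 6)) ;; .setNat (N + 1) (.const 0) ;;
      testThen N P (.cond (.realLe (.var (N + 3)) (.var (N + 6))) .skip
        (.setReal (N + 3) (.var (N + 6)))) (.setReal (N + 4) (.var (N + 6)))) ;;
  .setNat (N + 4) (.sub (.var (N + 4)) (.const 1))

/-- Narrows the interval between the real variables `N + 4` and `N + 3` until it contains no
costs. -/
def threshold (N : ℕ) (P : Prog) : Prog :=
  .setNat (N + 4) (.mul (.const 3) (.var 0)) ;;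
  .loop (.natLe (.const 1) (.var (N + 4))) (threshRound N P)

/-- The state of the search for the threshold when `r` rounds remain.  With `r + 2 = 3 b + i`, the
number of costs in the interval is at most `b * b + i * b`, so that it vanishes at the end. -/
structure ThreshInv (I : Instance) (ε : ℝ) (N r : ℕ) (τ : State) : Prop where
  saved : Saved I ε N τ
  idx : τ.nv (N + 4) = r
  pos : 0 < τ.rv (N + 4)
  feasible : I.FeasibleBelow (τ.rv (N + 3))
  infeasible : ¬ I.FeasibleBelow (τ.rv (N + 4))
  card : ∃ b i, r + 2 = 3 * b + i ∧ i ≤ 2 ∧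
    I.G.between (τ.rv (N + 4)) (τ.rv (N + 3)) ≤ b * b + i * b

/-- The time for a round of the search for the threshold. -/
def threshTime (m F : ℕ) : ℕ := 50 * m + testTime m F 0 + 60

theorem threshRound_spec {r : ℕ} (hN : 20 ≤ N) (hP : P.Avoids N) (hF : RowBound P I.G F)
    (h : ThreshInv I ε N (r + 1) σ) (ht : threshTime I.G.m F ≤ t) :
    WP (threshRound N P) (fun t' τ => t ≤ t' + threshTime I.G.m F ∧ ThreshInv I ε N r τ) t σ := by
  obtain ⟨hS, hr, hpos, hfe, hinf, b, i, hri, hi, hcard⟩ := h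
  rw [threshTime] at ht ⊢
  have hb0 : 0 < b := by omega
  -- what remains after the number of candidates has been reduced
  have hdec : ∀ K, (K + b ≤ I.G.between (σ.rv (N + 4)) (σ.rv (N + 3)) ∨ K < b * b) →
      ∃ b i, r + 2 = 3 * b + i ∧ i ≤ 2 ∧ K ≤ b * b + i * b := by
    intro K hK
    rcases i with _ | i
    · obtain ⟨b, rfl⟩ : ∃ b', b = b' + 1 := ⟨b - 1, by omega⟩
      refine ⟨b, 2, by omega, le_rfl, ?_⟩
      have : (b + 1) * (b + 1) = b * b + 2 * b + 1 := by ring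
      omega
    · refine ⟨b, i, by omega, by omega, ?_⟩
      rw [add_mul, one_mul] at hcard
      omega
  have hdiv : (σ.nv (N + 4) + 2) / 3 = b := by omega
  refine WP.seq (WP.setNat (by simp [NExp.size]; omega) ?_)
  simp only [NExp.eval, NExp.size, hdiv]
  have hS0 : Saved I ε N (σ.setN (N + 5) b) := hS.setN (by omega) (by omega) _
  refine WP.seq ((findPivot_spec hS0 rfl rfl (by simp) hb0 (by omega)).conseq ?_)
  rintro t1 τ1 hf1 ⟨ht1, cnt, mn, hcnt, hscan⟩
  obtain ⟨hB1, hB2⟩ := hscan.between_le hcnt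
  have e4 : τ1.rv (N + 4) = σ.rv (N + 4) := hf1.rv (N + 4) (by
    simp [findPivot, Prog.forN, Prog.wrv])
  have e3 : τ1.rv (N + 3) = σ.rv (N + 3) := hf1.rv (N + 3) (by
    simp [findPivot, Prog.forN, Prog.wrv])
  have n4 : τ1.nv (N + 4) = r + 1 := by
    rw [hf1.nv (N + 4) (by simp [findPivot, Prog.forN, Prog.wnv])]; simpa using hr
  have hS1 : Saved I ε N τ1 := by
    refine ⟨?_, ?_, ?_, ?_, ?_, ?_, ?_, ?_, ?_, ?_⟩
    · rw [hf1.nv 0 (by simp [findPivot, Prog.forN, Prog.wnv]), hS0.n]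
    · rw [hf1.nv 1 (by simp [findPivot, Prog.forN, Prog.wnv]), hS0.m]
    · rw [hf1.nv 2 (by simp [findPivot, Prog.forN, Prog.wnv]; omega), hS0.s]
    · rw [hf1.na 0 rfl]; exact hS0.src
    · rw [hf1.na 1 rfl]; exact hS0.tgt
    · rw [hf1.ra 1 rfl]; exact hS0.r
    · rw [hf1.nv N (by simp [findPivot, Prog.forN, Prog.wnv]), hS0.t]
    · rw [hf1.rv N (by simp [findPivot, Prog.forN, Prog.wrv]), hS0.R]
    · rw [hf1.rv (N + 1) (by simp [findPivot, Prog.forN, Prog.wrv]), hS0.eps]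
    · rw [hf1.ra N rfl]; exact hS0.c
  simp only [State.setN_rv] at hscan hB1 hB2
  set piv := τ1.rv (N + 6) with hpiv
  set lo := σ.rv (N + 4) with hlo
  set hi := σ.rv (N + 3) with hhi
  -- the final decrement of the counter
  have hend : ∀ (t' : ℕ) (τ : State), t ≤ t' + (50 * I.G.m + testTime I.G.m F 0 + 56) →
      Saved I ε N τ → τ.nv (N + 4) = r + 1 → 0 < τ.rv (N + 4) → I.FeasibleBelow (τ.rv (N + 3)) →
      ¬ I.FeasibleBelow (τ.rv (N + 4)) →
      (I.G.between (τ.rv (N + 4)) (τ.rv (N + 3)) + b ≤ I.G.between lo hi ∨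
        I.G.between (τ.rv (N + 4)) (τ.rv (N + 3)) < b * b) →
      4 ≤ t' → WP (.setNat (N + 4) (.sub (.var (N + 4)) (.const 1)))
        (fun t' τ => t ≤ t' + (50 * I.G.m + testTime I.G.m F 0 + 60) ∧ ThreshInv I ε N r τ) t' τ := by
    intro t' τ ht' hSτ h4 h5 h6 h7 h8 h9
    refine WP.setNat (by simp [NExp.size]; omega) ?_
    simp only [NExp.eval, NExp.size, h4, Nat.add_sub_cancel]
    exact ⟨by omega, hSτ.setN (by omega) (by omega) _, by simp, h5, h6, h7, hdec _ h8⟩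
  refine WP.seq ?_
  rw [WP.cond_iff]
  simp only [BExp.eval, BExp.size, RExp.eval, RExp.size, e4, ← hpiv]
  refine ⟨by omega, fun hle => ?_, fun hlt => ?_⟩
  · have hpl : piv = lo := le_antisymm hle hscan.le_piv
    have h3 := hB1 hpl
    refine WP.skip (by omega) (hend _ _ (by omega) hS1 n4 (by rw [e4]; exact hpos)
      (by rw [e3]; exact hfe) (by rw [e4]; exact hinf) ?_ (by omega))
    rw [e3, e4]
    exact Or.inr (h3.trans_le (Nat.le_mul_of_pos_left _ hb0))
  have hlt' : lo < piv := not_le.1 hlt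
  obtain ⟨hB3, hB4⟩ := hB2 hlt'
  refine WP.seq (WP.setReal (by simp [RExp.size]; omega) (WP.seq (WP.setNat
    (by simp [NExp.size, RExp.size]; omega) ?_)))
  simp only [NExp.eval, NExp.size, RExp.eval, RExp.size, ← hpiv]
  have hS2 : Saved I ε N ((τ1.setR (N + 2) piv).setN (N + 1) 0) :=
    (hS1.setR (by omega) (by omega) _).setN (by omega) (by omega) _
  refine WP.testThen hN hP hF hS2 0 (by simp) (δ := piv) (by simp) (by omega) ?_ ?_
  · intro t3 τ3 hS3 hA3 ht3 hsol
    replace hsol := (I.feasibleBelow_iff (hpos.trans hlt')).2 hsol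
    have f3 : τ3.rv (N + 3) = hi := by rw [hA3.rv _ (by omega)]; simpa using e3
    have f4 : τ3.rv (N + 4) = lo := by rw [hA3.rv _ (by omega)]; simpa using e4
    have f6 : τ3.rv (N + 6) = piv := by rw [hA3.rv _ (by omega)]; simp [hpiv]
    have m4 : τ3.nv (N + 4) = r + 1 := by
      rw [hA3.nv _ (by omega) (by omega) (by omega)]; simpa using n4
    simp only [WP.cond_iff, WP.skip_iff, WP.setReal_iff, BExp.eval, BExp.size, RExp.eval, RExp.size,
      f3, f6]
    refine ⟨by omega, fun hhp => ⟨by omega, ?_⟩, fun hhp => ⟨by omega, ?_⟩⟩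
    · refine hend _ _ (by omega) hS3 m4 (by rw [f4]; exact hpos) (by rw [f3]; exact hfe)
        (by rw [f4]; exact hinf) ?_ (by omega)
      rw [f3, f4]
      rw [min_eq_right hhp] at hB3
      exact Or.inl hB3
    · refine hend _ _ (by omega) (hS3.setR (by omega) (by omega) _) m4
        (by simpa [f4] using hpos) (by simpa using hsol) (by simpa [f4] using hinf) ?_ (by omega)
      rw [min_eq_left (not_le.1 hhp).le] at hB3
      simpa [f4] using Or.inl hB3
  · intro t3 τ3 hS3 hA3 ht3 hsol
    replace hsol := mt (I.feasibleBelow_iff (hpos.trans hlt')).1 hsol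
    have f3 : τ3.rv (N + 3) = hi := by rw [hA3.rv _ (by omega)]; simpa using e3
    have f6 : τ3.rv (N + 6) = piv := by rw [hA3.rv _ (by omega)]; simp [hpiv]
    have m4 : τ3.nv (N + 4) = r + 1 := by
      rw [hA3.nv _ (by omega) (by omega) (by omega)]; simpa using n4
    refine WP.setReal (by simp [RExp.size]; omega) ?_
    simp only [RExp.eval, RExp.size, f6]
    refine hend _ _ (by omega) (hS3.setR (by omega) (by omega) _) m4 (by simpa using hpos.trans hlt')
      (by simpa [f3] using hfe) (by simpa using hsol) ?_ (by omega)
    simpa [f3] using hB4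

/-- When no costs are left in the interval, its lower end is a threshold. -/
theorem threshold_spec (hN : 20 ≤ N) (hP : P.Avoids N) (hF : RowBound P I.G F)
    (hS : Saved I ε N σ) (hpos : 0 < σ.rv (N + 4)) (hfe : I.FeasibleBelow (σ.rv (N + 3)))
    (hinf : ¬ I.FeasibleBelow (σ.rv (N + 4)))
    (ht : 3 * I.G.n * (threshTime I.G.m F + 3) + 10 ≤ t) :
    WP (threshold N P) (fun t' τ => t ≤ t' + (3 * I.G.n * (threshTime I.G.m F + 3) + 10) ∧
      Saved I ε N τ ∧ 0 < τ.rv (N + 4) ∧ τ.rv (N + 4) ≤ I.Copt ∧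
      I.Copt ≤ I.G.n * τ.rv (N + 4)) t σ := by
  refine WP.seq (WP.setNat (by simp [NExp.size]; omega) ?_)
  simp only [NExp.eval, NExp.size, hS.n]
  refine WP.loop (fun t' τ => ∃ r ≤ 3 * I.G.n, ThreshInv I ε N r τ ∧
    r * (threshTime I.G.m F + 3) + 3 ≤ t' ∧ t + r * (threshTime I.G.m F + 3) ≤
      t' + (3 * I.G.n * (threshTime I.G.m F + 3) + 7)) ?_ ?_
  · refine ⟨3 * I.G.n, le_rfl, ⟨hS.setN (by omega) (by omega) _, by simp, hpos, hfe,
      hinf, I.G.n, 2, rfl, le_rfl, ?_⟩, by omega, by omega⟩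
    exact between_le.trans (I.G.m_le.trans (Nat.le_add_right _ _))
  · rintro t1 τ1 - ⟨r, hr, hI, ht1, ht1'⟩
    simp only [BExp.eval, BExp.size, NExp.eval, NExp.size, hI.idx]
    refine ⟨by omega, fun h1 => ?_, fun h1 => ?_⟩
    · obtain ⟨r, rfl⟩ : ∃ r', r = r' + 1 := ⟨r - 1, by omega⟩
      rw [add_mul] at ht1 ht1'
      refine (threshRound_spec hN hP hF hI (by omega)).conseq ?_
      rintro t2 τ2 - ⟨ht2, hI2⟩
      exact ⟨r, by omega, hI2, by omega, by omega⟩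
    · obtain rfl : r = 0 := by omega
      obtain ⟨hS', -, hpos', ⟨p, hp, hpx⟩, hinf', b, i, hbi, hi, hcard⟩ := hI
      have h0 : I.G.between (τ1.rv (N + 4)) (τ1.rv (N + 3)) = 0 := by
        obtain rfl : b = 0 := by omega
        omega
      have hno : ∀ e, ¬ (τ1.rv (N + 4) < I.G.c e ∧ I.G.c e < τ1.rv (N + 3)) := by
        intro e he
        rw [WGraph.between, Nat.card_eq_zero] at h0
        rcases h0 with h0 | h0
        · exact h0.false ⟨e, he⟩
        · exact absurd h0 (by simpa using Subtype.finite)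
      have := I.bounds_of_threshold hinf' ⟨p, hp, fun e he => not_lt.1 fun hlt =>
        hno e ⟨hlt, hpx e he⟩⟩
      exact ⟨by omega, hS', hpos', this⟩

end

/-! ### Narrowing the bounds for the optimum -/

/-- Increases the lower bound for the optimum in the real variable `N + 4` until it is exact up to
the factor `8`.  If the natural variable `N + 7` is `g`, the ratio between the bounds is at most
`n / g`; a test with `8 g + 1` rows doubles `g`. -/
def narrow (N : ℕ) (P : Prog) : Prog :=
  .setNat (N + 7) (.const 1) ;;
  .loop (.not (.natLe (.var 0) (.mul (.const 8) (.var (N + 7)))))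
    (.setReal (N + 2) (.div (.var (N + 4)) (.mul (.ofNat (.const 4)) (.ofNat (.var (N + 7))))) ;;
      .setNat (N + 1) (.mul (.const 8) (.var (N + 7))) ;;
      testThen N P .skip (.setReal (N + 4) (.mul (.ofNat (.const 2)) (.var (N + 4)))) ;;
      .setNat (N + 7) (.mul (.const 2) (.var (N + 7))))

/-- Outputs a path of least scaled cost, with the real variable `N + 2` as the unit, where the
scaled costs are increased by `1` to make them positive. -/
def outputScaled (N : ℕ) : Prog :=
  .forN (N + 2) 1
    (.setFloor (N + 3) (.div (.get N (.var (N + 2))) (.var (N + 2))) ;;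
      .putNat 2 (.var (N + 2)) (.add (.var (N + 3)) (.const 1))) ;;
  .setNat 5 (.var N) ;; .setReal 5 (.var N) ;; cheapestPath

section

variable {I : Instance} {ε : ℝ} {N : ℕ} {σ τ : State} {t F : ℕ} {P : Prog}

/-- The tests take time proportional to the values of `g`, which add up to at most `n`. -/
theorem narrow_spec (hN : 20 ≤ N) (hP : P.Avoids N) (hF : RowBound P I.G F)
    (hS : Saved I ε N σ) (hs : ∃ p, I.IsSolution p) (hpos : 0 < σ.rv (N + 4))
    (hle : σ.rv (N + 4) ≤ I.Copt) (hge : I.Copt ≤ I.G.n * σ.rv (N + 4))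
    (ht : I.G.n * (9 * F + 20 * I.G.m + 167) + 10 ≤ t) :
    WP (narrow N P) (fun t' τ => t ≤ t' + (I.G.n * (9 * F + 20 * I.G.m + 167) + 10) ∧
      Saved I ε N τ ∧ 0 < τ.rv (N + 4) ∧ τ.rv (N + 4) ≤ I.Copt ∧
      I.Copt ≤ 8 * τ.rv (N + 4)) t σ := by
  have hn : 1 ≤ I.G.n := I.s.pos
  set V := 9 * F + 20 * I.G.m + 167 with hV
  refine WP.seq (WP.setNat (by simp [NExp.size]; omega) ?_)
  simp only [NExp.eval, NExp.size]
  refine WP.loop (fun t' τ => ∃ g d, 1 ≤ g ∧ I.G.n = g + d ∧ τ.nv (N + 7) = g ∧ Saved I ε N τ ∧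
    0 < τ.rv (N + 4) ∧ τ.rv (N + 4) ≤ I.Copt ∧ I.Copt * g ≤ I.G.n * τ.rv (N + 4) ∧
    d * V + 6 ≤ t' ∧ t + d * V ≤ t' + (I.G.n * V + 2)) ?_ ?_
  · obtain ⟨d, hd⟩ : ∃ d, I.G.n = 1 + d := ⟨I.G.n - 1, by omega⟩
    have hdV : d * V ≤ I.G.n * V := Nat.mul_le_mul_right _ (by omega)
    exact ⟨1, d, le_rfl, hd, by simp, hS.setN (by omega) (by omega) _, hpos, hle, by simpa using hge,
      by omega, by omega⟩
  rintro t1 τ1 - ⟨g, d, hg, hgd, hx, hS1, hpos1, hle1, hge1, ht1, ht1'⟩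
  simp only [BExp.eval, BExp.size, NExp.eval, NExp.size, hx, hS1.n, not_not]
  refine ⟨by omega, fun hlt => ?_, fun hend => ⟨by omega, hS1, hpos1, hle1, ?_⟩⟩
  · obtain ⟨d, rfl⟩ : ∃ d', d = g + d' := ⟨d - g, by omega⟩
    have hgV : 8 * g * (F + 10) + (F + 20 * I.G.m + 87) ≤ g * V := by
      have : F + 20 * I.G.m + 87 ≤ g * (F + 20 * I.G.m + 87) := Nat.le_mul_of_pos_left _ hg
      have h2 : g * V = 8 * g * (F + 10) + g * (F + 20 * I.G.m + 87) := by rw [hV]; ring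
      omega
    have hT : testTime I.G.m F (8 * g) = 8 * g * (F + 10) + (F + 20 * I.G.m + 60) := by
      rw [testTime]; ring
    rw [add_mul] at ht1 ht1'
    refine WP.seq (WP.setReal (by simp [RExp.size, NExp.size]; omega) (WP.seq (WP.setNat
      (by simp [RExp.size, NExp.size]; omega) (WP.seq ?_))))
    simp only [NExp.eval, NExp.size, RExp.eval, RExp.size, State.setR_nv, hx]
    have hS2 := (hS1.setR (x := N + 2) (by omega) (by omega) (τ1.rv (N + 4) /
      (((4 : ℕ) : ℝ) * (g : ℝ)))).setN (x := N + 1) (by omega) (by omega) (8 * g)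
    -- the doubling that ends the round
    have hdouble : ∀ (t' : ℕ) (τ : State), t1 ≤ t' + (g * V - 4) → 4 ≤ t' → Saved I ε N τ →
        τ.nv (N + 7) = g → 0 < τ.rv (N + 4) → τ.rv (N + 4) ≤ I.Copt →
        I.Copt * (2 * g) ≤ I.G.n * τ.rv (N + 4) →
        WP (.setNat (N + 7) (.mul (.const 2) (.var (N + 7)))) (fun t' τ => ∃ g d, 1 ≤ g ∧
          I.G.n = g + d ∧ τ.nv (N + 7) = g ∧ Saved I ε N τ ∧ 0 < τ.rv (N + 4) ∧
          τ.rv (N + 4) ≤ I.Copt ∧ I.Copt * g ≤ I.G.n * τ.rv (N + 4) ∧ d * V + 6 ≤ t' ∧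
          t + d * V ≤ t' + (I.G.n * V + 2)) t' τ := by
      intro t' τ ht' h4 hSτ h7 h5 h6 h8
      refine WP.setNat (by simp [NExp.size]; omega) ?_
      simp only [NExp.eval, NExp.size, h7]
      exact ⟨2 * g, d, by omega, by omega, by simp, hSτ.setN (by omega) (by omega) _, h5, h6,
        by simpa using h8, by omega, by omega⟩
    refine WP.testThen hN hP hF hS2 (8 * g) (by simp) (δ := τ1.rv (N + 4) / (4 * g)) (by simp)
      (by omega) ?_ ?_
    · intro t3 τ3 hS3 hA3 ht3 hsol
      have hC := I.refine_of_test hpos1 hg (by omega) hsol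
      clear hsol hs
      have f4 : τ3.rv (N + 4) = τ1.rv (N + 4) := by rw [hA3.rv _ (by omega)]; simp
      have f7 : τ3.nv (N + 7) = g := by
        rw [hA3.nv _ (by omega) (by omega) (by omega)]; simpa using hx
      exact WP.skip (by omega) (hdouble _ _ (by omega) (by omega) hS3 f7 (by rwa [f4]) (by rwa [f4])
        (by rwa [f4]))
    · intro t3 τ3 hS3 hA3 ht3 hsol
      have hC := I.refine_of_not_test hpos1 hg hs hsol
      clear hsol hs
      have f4 : τ3.rv (N + 4) = τ1.rv (N + 4) := by rw [hA3.rv _ (by omega)]; simp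
      have f7 : τ3.nv (N + 7) = g := by
        rw [hA3.nv _ (by omega) (by omega) (by omega)]; simpa using hx
      refine WP.setReal (by simp [RExp.size, NExp.size]; omega) ?_
      simp only [RExp.eval, RExp.size, NExp.eval, NExp.size, f4]
      refine hdouble _ _ (by omega) (by omega) (hS3.setR (by omega) (by omega) _) f7
        (by simpa using hpos1) (by simpa using hC) ?_
      simp only [State.setR_rv, if_true, Nat.cast_ofNat]
      linarith
  · have h1 : (I.G.n : ℝ) ≤ 8 * g := by exact_mod_cast hend
    have h2 : (0 : ℝ) < g := by exact_mod_cast hg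
    have h3 := hge1.trans (mul_le_mul_of_nonneg_right h1 hpos1.le)
    exact le_of_mul_le_mul_right (by linarith) h2

theorem outputScaled_spec {M : ℕ} {δ : ℝ} (hN : 20 ≤ N) (hS : Saved I ε N σ)
    (hδ : σ.rv (N + 2) = δ)
    (hs : ∃ p, I.IsSolution p ∧ (p.map fun e => I.G.scaled δ e + 1).sum ≤ M)
    (ht : (M + 1) * (170 * I.G.m + 60 * I.G.n + 160) + 20 * I.G.n + 30 * I.G.m + 90 ≤ t) :
    WP (outputScaled N) (fun t' τ => t ≤ t' + ((M + 1) * (170 * I.G.m + 60 * I.G.n + 160) +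
      20 * I.G.n + 30 * I.G.m + 90) ∧ ∃ q, HoldsOutput τ (some q) ∧ I.IsSolution q ∧
      ∀ q', I.IsSolution q' → (q.map fun e => I.G.scaled δ e + 1).sum ≤
        (q'.map fun e => I.G.scaled δ e + 1).sum) t σ := by
  obtain ⟨p, hp, hpM⟩ := hs
  refine WP.seq (WP.forN I.G.m 10 (fun j τ => ∀ e : Fin I.G.m, e.val < j →
    τ.na 2 e = I.G.scaled δ e + 1) hS.m (by omega) (by simp [Prog.wnv]) (by simp [Prog.wnv])
    (by omega) (by simp) ?_ ?_)
  · rintro j t τ hj hx hf hc hI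
    obtain ⟨e, rfl⟩ : ∃ e : Fin I.G.m, e.val = j := ⟨⟨j, hj⟩, rfl⟩
    have hne : N + 2 ≠ N + 3 := by omega
    have h1 : τ.ra N e = I.G.c e := by rw [hf.ra N rfl, hS.c]
    have h2 : τ.rv (N + 2) = δ := by rw [hf.rv _ rfl, hδ]
    simp only [WP.seq_iff, WP.setFloor_iff, WP.putNat_iff, RExp.eval, RExp.size, NExp.eval,
      NExp.size, State.setN_nv, if_true, if_neg hne, hx, h1, h2]
    refine ⟨by omega, by omega, by omega, fun e' he' => ?_⟩
    simp only [State.setN_na, State.putN_na, if_true, Function.update_apply]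
    split_ifs with hee
    · rw [Fin.ext hee]; rfl
    · exact hI e' (by omega)
  rintro t1 τ1 hf1 ht1 hI
  have g0 : τ1.nv 0 = I.G.n := by rw [hf1.nv 0 (by simp [Prog.forN, Prog.wnv]), hS.n]
  have g1 : τ1.nv 1 = I.G.m := by rw [hf1.nv 1 (by simp [Prog.forN, Prog.wnv]), hS.m]
  have g2 : τ1.nv 2 = I.s := by rw [hf1.nv 2 (by simp [Prog.forN, Prog.wnv]; omega), hS.s]
  have gN : τ1.nv N = I.t := by rw [hf1.nv N (by simp [Prog.forN, Prog.wnv]), hS.t]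
  have gR : τ1.rv N = I.R := by rw [hf1.rv N rfl, hS.R]
  refine WP.seq (WP.setNat (by simp [NExp.size]; omega) (WP.seq (WP.setReal
    (by simp [NExp.size, RExp.size]; omega) ?_)))
  simp only [NExp.eval, NExp.size, RExp.eval, RExp.size, State.setN_rv, gN, gR]
  refine (cheapestPath_spec (G := I.G) (c := fun e => I.G.scaled δ e + 1) (s := I.s) (t := I.t)
    (R := I.R) (p := p) (M := M) (fun _ => by omega) ⟨by simpa using g0, by simpa using g1,
      ?_, ?_, ?_, ?_⟩ (by simpa using g2) (by simp) (by simp) hp.1.1 hp.2 hpM (by omega)).conseq ?_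
  · intro e
    simpa [hf1.na 0 (by simp [Prog.forN, Prog.wna])] using hS.src e
  · intro e
    simpa [hf1.na 1 (by simp [Prog.forN, Prog.wna])] using hS.tgt e
  · intro e
    simpa using hI e e.2
  · intro e
    simpa [hf1.ra 1 (by simp [Prog.forN, Prog.wra])] using hS.r e
  · rintro t' τ - ⟨h1, q, hq, hqp, hqR, hmin⟩
    exact ⟨by omega, q, hq, ⟨hqp, hqR⟩, fun q' hq' => hmin q' hq'.1.1 hq'.2⟩

end

/-! ### The approximation algorithm -/

/-- Saves the input and sets the real variable `N + 3` to a number greater than all costs. -/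
def saveInput (N : ℕ) : Prog :=
  .setNat N (.var 3) ;; .setReal N (.var 0) ;; .setReal (N + 1) (.var 1) ;;
  .setReal (N + 3) (.ofNat (.const 1)) ;;
  .forN (N + 2) 1
    (.putReal N (.var (N + 2)) (.get 0 (.var (N + 2))) ;;
      .setReal (N + 3) (.add (.var (N + 3)) (.get 0 (.var (N + 2)))))

/-- Sets the real variable `N + 4` to a positive number that is at most the least positive cost. -/
def leastPositive (N : ℕ) : Prog :=
  .setReal (N + 4) (.var (N + 3)) ;;
  .forN (N + 2) 1
    (.cond (.and (.not (.realLe (.get N (.var (N + 2))) (.ofNat (.const 0))))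
        (.realLe (.get N (.var (N + 2))) (.var (N + 4))))
      (.setReal (N + 4) (.get N (.var (N + 2)))) .skip)

/-- The approximation algorithm that uses the row program `P`, which must avoid the names from `N`
on. -/
def approximate (N : ℕ) (P : Prog) : Prog :=
  saveInput N ;;
  .setReal (N + 2) (.var (N + 3)) ;; .setNat (N + 1) (.const 0) ;;
  testThen N P
    (leastPositive N ;;
      .setReal (N + 2) (.var (N + 4)) ;; .setNat (N + 1) (.const 0) ;;
      testThen N P
        (.setReal (N + 2) (.div (.var (N + 4)) (.ofNat (.add (.var 0) (.const 1)))) ;;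
          outputScaled N)
        (threshold N P ;; narrow N P ;;
          .setReal (N + 2) (.div (.mul (.var (N + 1)) (.var (N + 4))) (.ofNat (.var 0))) ;;
          outputScaled N))
    (.setNat 0 (.const 0))

section

variable {I : Instance} {ε : ℝ} {N : ℕ} {σ τ : State} {t F : ℕ} {P : Prog}

theorem saveInput_spec (hN : 20 ≤ N) (h : HoldsInput I ε σ) (ht : 30 * I.G.m + 40 ≤ t) :
    WP (saveInput N) (fun t' τ => t ≤ t' + (30 * I.G.m + 40) ∧ Saved I ε N τ ∧
      0 < τ.rv (N + 3) ∧ ∀ e, I.G.c e < τ.rv (N + 3)) t σ := by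
  refine WP.seq (WP.setNat (by simp [NExp.size]; omega) (WP.seq (WP.setReal
    (by simp [NExp.size, RExp.size]; omega) (WP.seq (WP.setReal
    (by simp [NExp.size, RExp.size]; omega) (WP.seq (WP.setReal
    (by simp [NExp.size, RExp.size]; omega) ?_)))))))
  simp only [NExp.eval, NExp.size, RExp.eval, RExp.size, State.setN_rv, State.setR_rv,
    Nat.cast_one, show 1 ≠ N by omega, if_false, h.t, h.R, h.eps]
  refine WP.forN I.G.m 20 (fun j τ => 1 ≤ τ.rv (N + 3) ∧
    (∀ e : Fin I.G.m, e.val < j → τ.ra N e = I.G.c e) ∧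
    ∀ e : Fin I.G.m, e.val < j → I.G.c e < τ.rv (N + 3))
    (by simpa [show 1 ≠ N by omega] using h.m) (by omega) (by simp [Prog.wnv]) (by simp [Prog.wnv])
    (by omega) (by simp) ?_ ?_
  · rintro j t τ hj hx hf hc ⟨h1, h2, h3⟩
    obtain ⟨e, rfl⟩ : ∃ e : Fin I.G.m, e.val = j := ⟨⟨j, hj⟩, rfl⟩
    have hce : τ.ra 0 e = I.G.c e := by
      rw [hf.ra 0 (by simp [Prog.forN, Prog.wra]; omega)]; simpa using h.c e
    have h0 : 0 ≠ N := by omega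
    simp only [WP.seq_iff, WP.setReal_iff, WP.putReal_iff, RExp.eval, RExp.size, NExp.eval,
      NExp.size, State.putR_nv, State.putR_rv, State.putR_ra, hx, hce, h0, if_false]
    have hnn := I.G.c_nonneg e
    refine ⟨by omega, by omega, by omega, ?_, fun e' he' => ?_, fun e' he' => ?_⟩
    · simp only [State.setN_rv, State.setR_rv, if_true]; linarith
    · simp only [State.setN_ra, State.setR_ra, State.putR_ra, if_true, Function.update_apply]
      split_ifs with hee
      · rw [Fin.ext hee]
      · exact h2 e' (by omega)
    · simp only [State.setN_rv, State.setR_rv, if_true]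
      by_cases hee : e'.val = e
      · rw [Fin.ext hee]; linarith
      · linarith [h3 e' (by omega)]
  · rintro t' τ hf ht' ⟨h1, h2, h3⟩
    refine ⟨by omega, ⟨?_, ?_, ?_, ?_, ?_, ?_, ?_, ?_, ?_, fun e => h2 e e.2⟩, by linarith,
      fun e => h3 e e.2⟩
    · rw [hf.nv 0 (by simp [Prog.forN, Prog.wnv])]; simpa [show 0 ≠ N by omega] using h.n
    · rw [hf.nv 1 (by simp [Prog.forN, Prog.wnv])]; simpa [show 1 ≠ N by omega] using h.m
    · rw [hf.nv 2 (by simp [Prog.forN, Prog.wnv]; omega)]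
      simpa [show 2 ≠ N by omega] using h.s
    · rw [hf.na 0 rfl]; simpa using h.src
    · rw [hf.na 1 rfl]; simpa using h.tgt
    · rw [hf.ra 1 (by simp [Prog.forN, Prog.wra]; omega)]; simpa using h.r
    · rw [hf.nv N (by simp [Prog.forN, Prog.wnv])]; simp
    · rw [hf.rv N (by simp [Prog.forN, Prog.wrv])]; simp
    · rw [hf.rv (N + 1) (by simp [Prog.forN, Prog.wrv])]; simp

theorem leastPositive_spec (h : Saved I ε N σ) (hN : 20 ≤ N) (hpos : 0 < σ.rv (N + 3))
    (ht : 30 * I.G.m + 20 ≤ t) :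
    WP (leastPositive N) (fun t' τ => t ≤ t' + (30 * I.G.m + 20) ∧ Saved I ε N τ ∧
      τ.rv (N + 3) = σ.rv (N + 3) ∧ 0 < τ.rv (N + 4) ∧
      ∀ e, 0 < I.G.c e → τ.rv (N + 4) ≤ I.G.c e) t σ := by
  refine WP.seq (WP.setReal (by simp [RExp.size]; omega) ?_)
  simp only [RExp.eval, RExp.size]
  refine WP.forN I.G.m 20 (fun j τ => 0 < τ.rv (N + 4) ∧
    ∀ e : Fin I.G.m, e.val < j → 0 < I.G.c e → τ.rv (N + 4) ≤ I.G.c e)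
    (by simpa using h.m) (by omega) (by simp [Prog.wnv]) (by simp [Prog.wnv])
    (by omega) (by simpa using hpos) ?_ ?_
  · rintro j t τ hj hx hf hc ⟨h1, h2⟩
    obtain ⟨e, rfl⟩ : ∃ e : Fin I.G.m, e.val = j := ⟨⟨j, hj⟩, rfl⟩
    have hce : τ.ra N e = I.G.c e := by
      rw [hf.ra N (by simp [Prog.forN, Prog.wra])]; simpa using h.c e
    simp only [WP.cond_iff, WP.setReal_iff, WP.skip_iff, BExp.eval, BExp.size, RExp.eval, RExp.size,
      NExp.eval, NExp.size, hx, hce, Nat.cast_zero, not_le]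
    refine ⟨by omega, fun hb => ⟨by omega, by omega, ?_, fun e' he' hp => ?_⟩,
      fun hb => ⟨by omega, by omega, ?_, fun e' he' hp => ?_⟩⟩
    · simpa using hb.1
    · simp only [State.setN_rv, State.setR_rv, if_true]
      by_cases hee : e'.val = e
      · rw [Fin.ext hee]
      · exact hb.2.trans (h2 e' (by omega) hp)
    · simpa using h1
    · simp only [State.setN_rv]
      by_cases hee : e'.val = e
      · rw [Fin.ext hee] at hp ⊢
        exact (not_le.1 fun hh => hb ⟨hp, hh⟩).le
      · exact h2 e' (by omega) hp
  · rintro t' τ hf ht' ⟨h1, h2⟩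
    refine ⟨by omega, ⟨?_, ?_, ?_, ?_, ?_, ?_, ?_, ?_, ?_, ?_⟩, ?_, h1, fun e => h2 e e.2⟩
    · rw [hf.nv 0 (by simp [Prog.forN, Prog.wnv])]; simpa using h.n
    · rw [hf.nv 1 (by simp [Prog.forN, Prog.wnv])]; simpa using h.m
    · rw [hf.nv 2 (by simp [Prog.forN, Prog.wnv]; omega)]; simpa using h.s
    · rw [hf.na 0 rfl]; simpa using h.src
    · rw [hf.na 1 rfl]; simpa using h.tgt
    · rw [hf.ra 1 rfl]; simpa using h.r
    · rw [hf.nv N (by simp [Prog.forN, Prog.wnv])]; simpa using h.t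
    · rw [hf.rv N (by simp [Prog.forN, Prog.wrv])]; simpa using h.R
    · rw [hf.rv (N + 1) (by simp [Prog.forN, Prog.wrv])]; simpa using h.eps
    · rw [hf.ra N rfl]; simpa using h.c
    · rw [hf.rv (N + 3) (by simp [Prog.forN, Prog.wrv])]; simp

theorem Instance.Copt_nonneg (I : Instance) : 0 ≤ I.Copt := by
  refine Real.sInf_nonneg ?_
  rintro _ ⟨p, -, rfl⟩
  exact I.G.cost_nonneg p

/-- The time of the approximation algorithm if a row takes time `F`, and `M` bounds the scaled costs
of the computed paths. -/
def approximateTime (n m F M : ℕ) : ℕ :=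
  (M + 1) * (170 * m + 60 * n + 160) + 3 * n * (threshTime m F + 3) + n * (9 * F + 20 * m + 167) +
    2 * testTime m F 0 + 20 * n + 90 * m + 300

theorem approximate_spec {M : ℕ} (hN : 20 ≤ N) (hε : 0 < ε) (hP : P.Avoids N)
    (hF : RowBound P I.G F) (h : HoldsInput I ε σ) (hM : ⌊8 * I.G.n / ε⌋₊ + I.G.n ≤ M)
    (ht : approximateTime I.G.n I.G.m F M ≤ t) :
    WP (approximate N P) (fun t' τ => t ≤ t' + approximateTime I.G.n I.G.m F M ∧
      ∃ o, HoldsOutput τ o ∧ I.IsAnswer ε o) t σ := by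
  rw [approximateTime] at ht ⊢
  set A := (M + 1) * (170 * I.G.m + 60 * I.G.n + 160) with hA
  set B := 3 * I.G.n * (threshTime I.G.m F + 3) with hB
  set C := I.G.n * (9 * F + 20 * I.G.m + 167) with hC
  set D := testTime I.G.m F 0 with hD
  refine WP.seq ((saveInput_spec hN h (by omega)).conseq ?_)
  rintro t1 τ1 - ⟨ht1, hS1, hpos1, hc1⟩
  refine WP.seq (WP.setReal (by simp [RExp.size]; omega) (WP.seq (WP.setNat
    (by simp [NExp.size, RExp.size]; omega) ?_)))
  simp only [NExp.eval, NExp.size, RExp.eval, RExp.size]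
  refine WP.testThen hN hP hF ((hS1.setR (by omega) (by omega) _).setN (by omega) (by omega) _) 0
    (by simp) (δ := τ1.rv (N + 3)) (by simp) (by omega) ?_ ?_
  swap
  · -- there is no solution
    intro t2 τ2 hS2 hA2 ht2 hsol
    have hno : ¬ ∃ p, I.IsSolution p := fun ⟨p, hp⟩ =>
      hsol ((I.feasibleBelow_iff hpos1).1 ⟨p, hp, fun e _ => hc1 e⟩)
    clear hsol
    refine WP.setNat (by simp [NExp.size]; omega) ⟨?_, none, by simp [HoldsOutput, NExp.eval], hno⟩
    clear hno
    simp only [NExp.size]; omega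
  intro t2 τ2 hS2 hA2 ht2 hsol
  have hfe1 := (I.feasibleBelow_iff hpos1).2 hsol
  have hs : ∃ p, I.IsSolution p := let ⟨p, hp, _⟩ := hsol; ⟨p, hp⟩
  clear hsol
  have f3 : τ2.rv (N + 3) = τ1.rv (N + 3) := by rw [hA2.rv _ (by omega)]; simp
  refine WP.seq ((leastPositive_spec hS2 hN (by rwa [f3]) (by omega)).conseq ?_)
  rintro t3 τ3 - ⟨ht3, hS3, g3, hpos3, hc3⟩
  rw [f3] at g3
  refine WP.seq (WP.setReal (by simp [RExp.size]; omega) (WP.seq (WP.setNat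
    (by simp [NExp.size, RExp.size]; omega) ?_)))
  simp only [NExp.eval, NExp.size, RExp.eval, RExp.size]
  refine WP.testThen hN hP hF ((hS3.setR (by omega) (by omega) _).setN (by omega) (by omega) _) 0
    (by simp) (δ := τ3.rv (N + 4)) (by simp) (by omega) ?_ ?_
  · -- there is a solution of cost `0`
    intro t4 τ4 hS4 hA4 ht4 hsol
    obtain ⟨p, hp, hpx⟩ := (I.feasibleBelow_iff hpos3).2 hsol
    clear hsol
    have f4 : τ4.rv (N + 4) = τ3.rv (N + 4) := by rw [hA4.rv _ (by omega)]; simp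
    refine WP.seq (WP.setReal (by simp [NExp.size, RExp.size]; omega) ?_)
    simp only [NExp.eval, NExp.size, RExp.eval, RExp.size, f4, hS4.n]
    refine (outputScaled_spec (M := M) hN (hS4.setR (by omega) (by omega) _)
      (δ := τ3.rv (N + 4) / (I.G.n + 1)) (by simp) ⟨p, hp, ?_⟩ (by omega)).conseq ?_
    · rw [I.sum_scaled_eq_length hc3 hpx]
      have := hp.1.length_lt
      clear hs
      omega
    · rintro t5 τ5 - ⟨ht5, q, hq, hqs, hmin⟩
      refine ⟨by clear hmin; omega, some q, hq, hqs, ?_⟩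
      rw [I.cost_eq_zero_of_scaled hpos3 hc3 hp hpx (hmin p hp)]
      exact mul_nonneg (by linarith) I.Copt_nonneg
  · intro t4 τ4 hS4 hA4 ht4 hsol
    have hinf := mt (I.feasibleBelow_iff hpos3).1 hsol
    clear hsol
    have f4 : τ4.rv (N + 4) = τ3.rv (N + 4) := by rw [hA4.rv _ (by omega)]; simp
    have f3' : τ4.rv (N + 3) = τ3.rv (N + 3) := by rw [hA4.rv _ (by omega)]; simp
    refine WP.seq ((threshold_spec hN hP hF hS4 (by rwa [f4]) (by rwa [f3', g3]) (by rwa [f4])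
      (by omega)).conseq ?_)
    rintro t5 τ5 - ⟨ht5, hS5, hpos5, hle5, hge5⟩
    refine WP.seq ((narrow_spec hN hP hF hS5 hs hpos5 hle5 hge5 (by omega)).conseq ?_)
    rintro t6 τ6 - ⟨ht6, hS6, hpos6, hle6, hge6⟩
    refine WP.seq (WP.setReal (by simp [NExp.size, RExp.size]; omega) ?_)
    simp only [NExp.eval, NExp.size, RExp.eval, RExp.size, hS6.eps, hS6.n]
    obtain ⟨p, hp, hpM⟩ := I.exists_scaled_le hpos6 hε hge6 hs
    refine (outputScaled_spec (M := M) hN (hS6.setR (by omega) (by omega) _)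
      (δ := ε * τ6.rv (N + 4) / I.G.n) (by simp) ⟨p, hp, hpM.trans hM⟩ (by omega)).conseq ?_
    rintro t7 τ7 - ⟨ht7, q, hq, hqs, hmin⟩
    exact ⟨by clear hmin; omega, some q, hq, hqs,
      I.approx_of_scaled hpos6 hε hle6 hqs fun q' hq' => hmin q' hq'⟩

end

/-! ### Running times -/

section

variable {𝒢 𝒢' : Set WGraph} {f : WGraph → ℝ} {P A : Prog} {G : WGraph} {K : ℝ → ℝ}
  {τ τ' : WGraph → ℝ → ℝ}

theorem WGraph.exists_holdsRows (G : WGraph) (s : Fin G.n) :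
    ∃ σ : State, HoldsRows G (fun _ => 0) s 0 σ ∧ σ.nv 3 = 0 := by
  refine ⟨⟨fun x => if x = 0 then G.n else if x = 1 then G.m else if x = 2 then s else 0,
    fun a i => if h : i < G.m then if a = 0 then G.src ⟨i, h⟩ else if a = 1 then G.tgt ⟨i, h⟩
      else 0 else 0, fun _ => 0, fun _ i => if h : i < G.m then G.r ⟨i, h⟩ else 0⟩,
    ⟨?_, ?_, ?_, ?_, ?_, ?_, ?_, ?_⟩, ?_⟩ <;> simp

theorem ComputesRow.nonneg (h : ComputesRow P 𝒢 f) (hG : G ∈ 𝒢) (s : Fin G.n) : 0 ≤ f G := by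
  obtain ⟨σ, hσ, h3⟩ := G.exists_holdsRows s
  obtain ⟨T, -, -, -, hT⟩ := h G hG _ _ _ σ hσ h3
  exact (Nat.cast_nonneg T).trans hT

theorem ComputesRow.rowBound (h : ComputesRow P 𝒢 f) (hG : G ∈ 𝒢) : RowBound P G ⌊f G⌋₊ := by
  intro c s k t σ hR hk ht
  obtain ⟨T, τ, hE, hR', hT⟩ := h G hG c s k σ hR hk
  have hT' := Nat.le_floor hT
  exact ⟨T, τ, t - T, hE, by omega, by omega, hR'⟩

theorem RowBound.computesRow (h : ∀ G ∈ 𝒢, ∃ F : ℕ, RowBound P G F ∧ (F : ℝ) ≤ f G) :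
    ComputesRow P 𝒢 f := by
  intro G hG c s k σ hR hk
  obtain ⟨F, hF, hFf⟩ := h G hG
  obtain ⟨T, τ, t', hE, ht, hle, hR'⟩ := hF c s k F σ hR hk le_rfl
  exact ⟨T, τ, hE, hR', le_trans (by exact_mod_cast (by omega : T ≤ F)) hFf⟩

theorem ApproximatesIn.mono {K' : ℝ → ℝ} (h : ApproximatesIn A 𝒢 K τ)
    (h𝒢 : ∀ I : Instance, I.G ∈ 𝒢' → I.G ∈ 𝒢)
    (hτ : ∀ I : Instance, I.G ∈ 𝒢' → ∀ ε ε₀, 0 < ε → ε ≤ ε₀ →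
      K ε₀ * τ I.G ε ≤ K' ε₀ * τ' I.G ε) : ApproximatesIn A 𝒢' K' τ' := by
  intro I hI ε ε₀ hε hε₀ σ hσ
  obtain ⟨T, σ', o, hE, hO, hA, hT⟩ := h I (h𝒢 I hI) ε ε₀ hε hε₀ σ hσ
  exact ⟨T, σ', o, hE, hO, hA, hT.trans (hτ I hI ε ε₀ hε hε₀)⟩

theorem Instance.two_le_n (I : Instance) : 2 ≤ I.G.n := by
  by_contra h
  exact I.s_ne_t (Fin.ext (by have := I.s.2; have := I.t.2; omega))

theorem approximateTime_le {n m F : ℕ} {ε ε₀ : ℝ} (hm : 1 ≤ m) (hn : 1 ≤ n) (hnm : n ≤ 2 * m)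
    (hε : 0 < ε) (hε₀ : ε ≤ ε₀) :
    (approximateTime n m F (⌊8 * n / ε⌋₊ + n) : ℝ) ≤
      (4000 + 4000 * ε₀) * (n * m / ε) + 14 * (n * F) := by
  have h1 : n ≤ n * m := Nat.le_mul_of_pos_right _ hm
  have h2 : m ≤ n * m := Nat.le_mul_of_pos_left _ hn
  have h3 : approximateTime n m F (⌊8 * n / ε⌋₊ + n) ≤
      450 * (⌊8 * n / ε⌋₊ * m) + 2500 * (n * m) + 14 * (n * F) := by
    have e1 : (⌊8 * n / ε⌋₊ + n + 1) * (170 * m + 60 * n + 160) ≤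
        (⌊8 * n / ε⌋₊ + 2 * n) * (450 * m) := Nat.mul_le_mul (by omega) (by omega)
    have e2 : (⌊8 * n / ε⌋₊ + 2 * n) * (450 * m) =
        450 * (⌊8 * n / ε⌋₊ * m) + 900 * (n * m) := by ring
    have e3 : 3 * n * (threshTime m F + 3) = 210 * (n * m) + 3 * (n * F) + 369 * n := by
      rw [threshTime, testTime]; ring
    have e4 : n * (9 * F + 20 * m + 167) = 9 * (n * F) + 20 * (n * m) + 167 * n := by ring
    have e5 : F ≤ n * F := Nat.le_mul_of_pos_left _ hn
    simp only [approximateTime, e3, e4]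
    simp only [testTime]
    omega
  have h4 : (⌊8 * n / ε⌋₊ : ℝ) ≤ 8 * n / ε := Nat.floor_le (by positivity)
  have h5 : (⌊8 * n / ε⌋₊ : ℝ) * m ≤ 8 * (n * m / ε) := by
    calc (⌊8 * n / ε⌋₊ : ℝ) * m ≤ 8 * n / ε * m := by gcongr
      _ = _ := by ring
  have h6 : (n * m : ℝ) ≤ ε₀ * (n * m / ε) := by
    calc (n * m : ℝ) = ε * (n * m / ε) := by field_simp
      _ ≤ _ := by gcongr
  have h7 : (approximateTime n m F (⌊8 * n / ε⌋₊ + n) : ℝ) ≤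
      450 * (⌊8 * n / ε⌋₊ * m) + 2500 * (n * m) + 14 * (n * F) := by exact_mod_cast h3
  have h8 : (0 : ℝ) ≤ n * m / ε := by positivity
  have h9 : (0 : ℝ) ≤ n * m := by positivity
  linarith

/-- From a row program to an approximation algorithm, with an explicit constant. -/
theorem ComputesRow.exists_approximatesIn (h : ComputesRow P 𝒢 f) :
    ∃ A, ApproximatesIn A 𝒢 (fun ε₀ => 4000 + 4000 * ε₀)
      (fun G ε => (G.n : ℝ) * G.m * (1 / ε + f G / G.m)) := by
  obtain ⟨N, hN⟩ := P.exists_avoids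
  refine ⟨approximate (max N 20) P, ?_⟩
  intro I hI ε ε₀ hε hε₀ σ hσ
  have hf0 := h.nonneg hI I.s
  have hn := I.two_le_n
  have hnm := I.conn.n_le
  obtain ⟨T, τ, t', hE, ht, hle, o, hO, hA⟩ := approximate_spec (le_max_right N 20) hε
    (hN.mono (le_max_left N 20)) (h.rowBound hI) hσ le_rfl le_rfl
  refine ⟨T, τ, o, hE, hO, hA, ?_⟩
  have hT : T ≤ approximateTime I.G.n I.G.m ⌊f I.G⌋₊ (⌊8 * I.G.n / ε⌋₊ + I.G.n) := by
    clear hA; omega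
  have hm : 1 ≤ I.G.m := by omega
  have hm' : (0 : ℝ) < I.G.m := by exact_mod_cast hm
  have hε₀' := hε.trans_le hε₀
  have h1 := approximateTime_le (F := ⌊f I.G⌋₊) hm (by omega) (by omega : I.G.n ≤ 2 * I.G.m) hε hε₀
  have h2 : (I.G.n : ℝ) * ⌊f I.G⌋₊ ≤ I.G.n * f I.G := by
    gcongr; exact Nat.floor_le hf0
  have h3 : (0 : ℝ) ≤ I.G.n * f I.G := by positivity
  have h4 : (4000 + 4000 * ε₀) * ((I.G.n : ℝ) * I.G.m * (1 / ε + f I.G / I.G.m)) =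
      (4000 + 4000 * ε₀) * (I.G.n * I.G.m / ε) + (4000 + 4000 * ε₀) * (I.G.n * f I.G) := by
    field_simp
  have h5 : 14 * (I.G.n * f I.G : ℝ) ≤ (4000 + 4000 * ε₀) * (I.G.n * f I.G) := by
    gcongr; linarith
  calc (T : ℝ) ≤ _ := by exact_mod_cast hT
    _ ≤ _ := h1
    _ ≤ _ := by rw [h4]; linarith

/-- The graphs that occur in instances: these are connected and have at least two vertices. -/
def instanceGraphs : Set WGraph := {G | G.WeaklyConnected ∧ 2 ≤ G.n}

theorem Instance.mem_instanceGraphs (I : Instance) : I.G ∈ instanceGraphs := ⟨I.conn, I.two_le_n⟩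

theorem rowBound_rowProg {Cl : Prog} {F : ℕ} (hn : Cl.keepsNet = true) (ha : Cl.wra 2 = false)
    (hv : Cl.wrv 2 = false) (hCl : ∀ c, Closes Cl G c F) :
    RowBound (rowProg Cl) G (90 * G.m + 60 * G.n + 50 + F) :=
  fun c _ _ _ _ hR hk ht => rowProg_spec (hCl c) hn ha hv hR hk ht

theorem log_two_add_one_le {n : ℕ} (hn : 2 ≤ n) :
    (Nat.log 2 n + 1 : ℝ) ≤ 4 * Real.log n := by
  have h2 := Real.log_two_gt_d9
  have h3 : Real.log 2 ≤ Real.log n := Real.log_le_log (by norm_num) (by exact_mod_cast hn)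
  have h4 : (Nat.log 2 n : ℝ) * Real.log 2 ≤ Real.log n := by
    rw [← Real.log_pow]
    refine Real.log_le_log (by positivity) ?_
    exact_mod_cast Nat.pow_log_le_self 2 (by omega)
  have h5 : (0 : ℝ) ≤ Nat.log 2 n := Nat.cast_nonneg _
  nlinarith

theorem computesRow_dijkstra : ComputesRow (rowProg dijClose) instanceGraphs
    (fun G => 10000 * (G.m + G.n * Real.log G.n)) := by
  refine RowBound.computesRow fun G ⟨hc, hn⟩ => ⟨_, rowBound_rowProg rfl rfl rfl
    (fun c => dijClose_closes (c := c) (by omega)), ?_⟩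
  have hnm := hc.n_le
  have h1 := log_two_add_one_le hn
  have h2 : (G.n : ℝ) ≤ G.m + 1 := by exact_mod_cast hnm
  have h3 : (1 : ℝ) ≤ G.m := by exact_mod_cast (by omega : 1 ≤ G.m)
  have h4 : (2 : ℝ) ≤ G.n := by exact_mod_cast hn
  push_cast
  have h5 : (900 * G.n + 50 : ℝ) * (Nat.log 2 G.n + 1) ≤ 950 * G.n * (4 * Real.log G.n) := by
    gcongr; linarith
  have h6 : 0 ≤ (G.n : ℝ) * Real.log G.n := by
    have : (0 : ℝ) ≤ Nat.log 2 G.n := Nat.cast_nonneg _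
    have : 0 ≤ Real.log G.n := by linarith
    positivity
  linarith

theorem computesRow_acyclic : ComputesRow (rowProg dagClose)
    {G | G.Acyclic ∧ G ∈ instanceGraphs} (fun G => 2000 * G.m) := by
  refine RowBound.computesRow fun G ⟨hG, hc, hn⟩ => ⟨_, rowBound_rowProg rfl rfl rfl
    (fun c => dagClose_closes (c := c) hG), ?_⟩
  have hnm := hc.n_le
  exact_mod_cast (by omega : 90 * G.m + 60 * G.n + 50 + (200 * G.m + 200 * G.n + 200) ≤ 2000 * G.m)

/-- Passing from a bound with a separate term for the rows to a bound in terms of other quantities,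
with a constant that depends on the bound for `ε`. -/
theorem mul_bound_le {n m ε ε₀ C K x y : ℝ} (hn : 0 ≤ n) (hm : 0 < m) (hε : 0 < ε) (hε₀ : ε ≤ ε₀)
    (hC : 0 ≤ C) (hK : 0 ≤ K) (hy : 0 ≤ y) (hx : x ≤ C * (m + y)) :
    K * (n * m * (1 / ε + x / m)) ≤ K * (1 + C) * (1 + ε₀) * (n * m * (1 / ε + y / m)) := by
  have hε₀' := hε.trans_le hε₀
  have h1 : 1 ≤ ε₀ * (1 / ε) := by rw [mul_one_div, le_div_iff₀ hε]; linarith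
  have h2 : x / m ≤ C * (1 + y / m) := by
    rw [div_le_iff₀ hm]
    calc x ≤ C * (m + y) := hx
      _ = _ := by field_simp
  have h3 : 0 ≤ y / m := by positivity
  have h4 : 0 < 1 / ε := by positivity
  have h5 : 1 / ε + x / m ≤ (1 + C) * (1 + ε₀) * (1 / ε + y / m) := by
    have h6 : C * 1 ≤ C * (ε₀ * (1 / ε)) := by gcongr
    have h7 : 0 ≤ C * (1 / ε) + ε₀ * (1 / ε) + (1 + ε₀) * (y / m) + C * ε₀ * (y / m) := by
      positivity
    linarith
  calc K * (n * m * (1 / ε + x / m))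
      ≤ K * (n * m * ((1 + C) * (1 + ε₀) * (1 / ε + y / m))) := by gcongr
    _ = _ := by ring

end

end RSP

theorem mainTheorem2 :
    (∃ K : ℝ → ℝ, ∀ (𝒢 : Set RSP.WGraph) (f : RSP.WGraph → ℝ) (P : RSP.Prog),
      RSP.ComputesRow P 𝒢 f →
        ∃ A : RSP.Prog, RSP.ApproximatesIn A 𝒢 K
          (fun G ε => (G.n : ℝ) * G.m * (1 / ε + f G / G.m))) ∧
    (∃ A : RSP.Prog,
      (∃ K : ℝ → ℝ, RSP.ApproximatesIn A Set.univ K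
        (fun G ε => (G.n : ℝ) * G.m * (1 / ε + G.n * Real.log G.n / G.m))) ∧
      (∀ a : ℝ, 0 < a → ∃ K : ℝ → ℝ,
        RSP.ApproximatesIn A {G | a * (G.n * Real.log G.n) ≤ G.m} K
          (fun G ε => (G.n : ℝ) * G.m / ε))) ∧
    (∃ (A : RSP.Prog) (K : ℝ → ℝ), RSP.ApproximatesIn A {G | G.Acyclic} K
      (fun G ε => (G.n : ℝ) * G.m / ε)) := by
  have hm : ∀ I : RSP.Instance, (0 : ℝ) < I.G.m := fun I => by
    have := I.conn.n_le
    have := I.two_le_n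
    exact_mod_cast (by omega : 0 < I.G.m)
  refine ⟨⟨_, fun 𝒢 f P h => h.exists_approximatesIn⟩, ?_, ?_⟩
  · obtain ⟨A, hA⟩ := RSP.computesRow_dijkstra.exists_approximatesIn
    refine ⟨A, ⟨fun ε₀ => (4000 + 4000 * ε₀) * (1 + 10000) * (1 + ε₀),
      hA.mono (fun I _ => I.mem_instanceGraphs) fun I _ ε ε₀ hε hε₀ => ?_⟩, fun a ha =>
      ⟨fun ε₀ => (4000 + 4000 * ε₀) * (1 + 10000 * (1 + 1 / a)) * (1 + ε₀),
      hA.mono (fun I _ => I.mem_instanceGraphs) fun I hI ε ε₀ hε hε₀ => ?_⟩⟩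
    · have hlog : 0 ≤ Real.log I.G.n := Real.log_natCast_nonneg _
      exact RSP.mul_bound_le (by positivity) (hm I) hε hε₀ (by norm_num)
        (by linarith) (by positivity) le_rfl
    · have h : (10000 * (I.G.m + I.G.n * Real.log I.G.n) : ℝ) ≤
          10000 * (1 + 1 / a) * (I.G.m + 0) := by
        have h1 : (I.G.n * Real.log I.G.n : ℝ) ≤ I.G.m / a := by
          rw [le_div_iff₀ ha, mul_comm]; exact hI
        calc (10000 * (I.G.m + I.G.n * Real.log I.G.n) : ℝ) ≤ 10000 * (I.G.m + I.G.m / a) := by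
              gcongr
          _ = _ := by ring
      have := RSP.mul_bound_le (n := I.G.n) (by positivity) (hm I) hε hε₀ (by positivity)
        (show 0 ≤ 4000 + 4000 * ε₀ by linarith) le_rfl h
      simpa only [zero_div, add_zero, mul_one_div] using this
  · obtain ⟨A, hA⟩ := RSP.computesRow_acyclic.exists_approximatesIn
    refine ⟨A, fun ε₀ => (4000 + 4000 * ε₀) * (1 + 2000) * (1 + ε₀),
      hA.mono (fun I hI => ⟨hI, I.mem_instanceGraphs⟩) fun I _ ε ε₀ hε hε₀ => ?_⟩
    have := RSP.mul_bound_le (n := I.G.n) (x := 2000 * I.G.m) (C := 2000) (by positivity) (hm I) hε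
      hε₀ (by norm_num) (show 0 ≤ 4000 + 4000 * ε₀ by linarith) le_rfl (by simp)
    simpa only [zero_div, add_zero, mul_one_div] using this
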